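/- **Setting.** A planar rigid body of mass $m>0$ and radius of gyration $\rho>0$ has centre of mass at the origin in its reference configuration $q=0$, where $q=(x,z,\theta)$. It is supported at two distinct body-fixed points $p_i=(l_i,-h)$, $i=1,2$, by straight segments with tangents $t_i=(\cos\phi_i,\sin\phi_i)$, normals $n_i=(-\sin\phi_i,\cos\phi_i)$ and friction coefficients $\mu_i\ge 0$, under a constant force $f_{ex}$ and torque $\tau_{ex}$. With $J=\begin{pmatrix}0&-1\\1&0\end{pmatrix}$, put $x_i=((x,z)+\theta Jp_i)\cdot t_i$ and $z_i=((x,z)+\theta Jp_i)\cdot n_i$. *Zero-order dynamics (ZOD).* Under contact forces $f_1,f_2$ the body moves with $m(\ddot x,\ddot z)=f_1+f_2+f_{ex}$, $m\rho^2\ddot\theta=-p_1^TJf_1-p_2^TJf_2+\tau_{ex}$. A state is feasible if $z_i\ge0$, and $\dot z_i\ge 0$ if $z_i=0$. Trajectories $(q(t),\dot q(t))$ are feasible, have continuous $q$, and move after every instant for some time with constant forces that satisfy $0\le f_i\cdot n_i\perp z_i\ge0$; $0\le f_i\cdot n_i\perp\dot z_i\ge0$ if $z_i=0$; and $f_i\cdot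 t_i\in-\mu_i\,\mathrm{sgn}(\dot x_i)\,f_i\cdot n_i$ with $\mathrm{sgn}(0)=[-1,1]$. At each $t>0$ the velocity has a left limit $\dot q^-$. It is continuous there unless some $z_i=0$, $\dot z_i^-<0$; then it jumps to $\dot q^+$ with $m(\Delta\dot x,\Delta\dot z)=\hat f_1+\hat f_2$, $m\rho^2\Delta\dot\theta=-p_1^TJ\hat f_1-p_2^TJ\hat f_2$, where the impulses $\hat f_i$ satisfy the same complementarity relations with $\dot q^+$. Among several solutions, impacts with only one non-zero impulse are preferred, and then impacts after which every contact with non-zero impulse sticks ($\dot x_i^+=0$). Impacts may accumulate from the left, and the trajectory goes on afterwards. *Modes.* Each contact is in mode S ($\ddot z_i=\ddot x_i=0$; consistent if $|f_i\cdot t_i|<\mu_i f_i\cdot n_i$), F ($f_i=0$; consistent if $\ddot z_i>0$ whenever $z_i=\dot z_i=0$), P or N ($\ddot z_i=0$, $f_i\cdot t_i=\mp\mu_if_i\cdot n_i$; consistent if $f_i\cdot n_i>0$, and $\pm\ddot x_i>0$ whenever $\dot x_i=0$), with the evident kinematic admissibility conditions on $(q,\dot q)$. A mode other than SS is consistent in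 a state if it is admissible and exactly one pair of forces satisfies its constraints; SS, if infinitely many do. The rest state $q=0$ is a *persistent equilibrium* if: (1) SS, and no other mode, is consistent at $q=\dot q=0$; (2) in each of the modes PF, NF, FP, FN the ZOD has a unique solution, and either $f_i\cdot n_i<0$ at the slipping contact $i$ or $\ddot z_j<0$ at the free contact $j$; (3) in the modes PP, NN (if $\cos\phi_1\cos\phi_2>0$), respectively PN, NP (if $\cos\phi_1\cos\phi_2<0$), the ZOD has a unique solution, and $f_i\cdot n_i>0$ for $i=1,2$. *Reduced maps.* The Poincaré section consists of the pre-impact states with $z_1=z_2=0$, $\dot z_1^-=0$, $\dot z_2^-<0$. If the trajectory that starts with the impact at such a state, with angle $\varphi=\arctan(\dot x_2^- /|\dot z_2^-|)\in I=(-\frac\pi2,\frac\pi2)$, crosses the section again, then $R(\varphi)$ is the angle and $G(\varphi)$ is the ratio of the new to the old value of $|\dot z_2^-|$ at the next crossing; otherwise $R(\varphi)$ and $G(\varphi)$ are undefined. *FTLS.* Let $\Delta=\max(\sqrt{z_1},\sqrt{z_2},\sqrt{|x_2|},|\dot z_1|,|\dot z_2|,|\dot x_2|)$. The equilibrium is finite-time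 Lyapunov stable if for every $\varepsilon>0$ there is $\delta>0$ such that every feasible initial state with $\Delta<\delta$ has a trajectory for all times $t\ge 0$, and every such trajectory satisfies $\Delta<\varepsilon$ for all $t>0$ and reaches, at a time $t_f<\varepsilon$, a static configuration with both contacts closed, in which it remains. **Theorem 3.** Assume that $\cos\phi_1\ne0\ne\cos\phi_2$; that the Painlevé paradox is excluded at each single contact, i.e. $\mu_i\,|(p_i\cdot t_i)(p_i\cdot n_i)|<\rho^2+(p_i\cdot t_i)^2$; that the contacts are numbered so that $\ddot z_1<0$ in mode FF; that $q=0$ is a persistent equilibrium; and that $\ddot x_2\neq0$ in each of the two modes of (3). If $G(\varphi)<1$ for every $\varphi\in I$ at which $R$ is defined, then the equilibrium is finite-time Lyapunov stable under the zero-order dynamics. -/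

import Mathlib

open Filter Topology

noncomputable section

namespace TwoContact

/-- Vectors of the plane, with coordinates along the `x` and `z` axes. -/
abbrev Vec : Type := ℝ × ℝ

/-- Configurations `q = (x, z, θ)` of a planar rigid body: displacement of the centre of mass from
its reference position, and rotation angle. Also used for velocities and accelerations. -/
abbrev Config : Type := ℝ × ℝ × ℝ

/-- Euclidean scalar product of the plane. -/
def dot (a b : Vec) : ℝ := a.1 * b.1 + a.2 * b.2

/-- The matrix `J = [[0, -1], [1, 0]]` applied to a vector. -/
def rot (a : Vec) : Vec := (-a.2, a.1)

/-- A planar rigid body on two frictional contacts (index `0` is contact 1, index `1` is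
contact 2) under a constant external load. The centre of mass is at the origin in the reference
configuration `q = 0`, and the `x` axis is parallel to the line through the two contacts. -/
structure Body where
  /-- mass -/
  m : ℝ
  /-- radius of gyration -/
  ρ : ℝ
  /-- height of the centre of mass above the line of the contacts -/
  h : ℝ
  /-- signed horizontal position of each contact relative to the centre of mass -/
  l : Fin 2 → ℝ
  /-- angle of each contact tangent with the `x` axis -/
  φ : Fin 2 → ℝ
  /-- friction coefficients -/
  μ : Fin 2 → ℝ
  /-- external force -/
  fex : Vec
  /-- external torque about the centre of mass -/
  τex : ℝ
  m_pos : 0 < m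
  ρ_pos : 0 < ρ
  μ_nonneg : ∀ i, 0 ≤ μ i
  l_ne : l 0 ≠ l 1

variable (B : Body)

/-- Contact point `p i` (in the reference configuration). -/
def Body.p (i : Fin 2) : Vec := (B.l i, -B.h)

/-- Unit tangent at contact `i`. -/
def Body.t (i : Fin 2) : Vec := (Real.cos (B.φ i), Real.sin (B.φ i))

/-- Unit normal at contact `i`. -/
def Body.n (i : Fin 2) : Vec := (-Real.sin (B.φ i), Real.cos (B.φ i))

/-- The displacement (velocity, acceleration) of the vertex `i` of the body that belongs to the
displacement (velocity, acceleration) `w` of the body, evaluated at `q = 0` and zero velocity. -/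
def Body.vertex (i : Fin 2) (w : Config) : Vec := (w.1, w.2.1) + w.2.2 • rot (B.p i)

/-- Tangential component of the displacement (velocity, acceleration) of contact `i`:
`B.tan i q` is `x i`, `B.tan i v` is its first and `B.tan i a` its second time derivative. -/
def Body.tan (i : Fin 2) (w : Config) : ℝ := dot (B.vertex i w) (B.t i)

/-- Normal component of the displacement (velocity, acceleration) of contact `i`:
`B.nor i q` is `z i`, `B.nor i v` is its first and `B.nor i a` its second time derivative. -/
def Body.nor (i : Fin 2) (w : Config) : ℝ := dot (B.vertex i w) (B.n i)

/-- Zero-order dynamics: the acceleration of the body under the contact forces `f`, with the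
equations of motion evaluated at `q = 0`. -/
def Body.accel (f : Fin 2 → Vec) : Config :=
  ((f 0 + f 1 + B.fex).1 / B.m, (f 0 + f 1 + B.fex).2 / B.m,
    (-dot (B.p 0) (rot (f 0)) - dot (B.p 1) (rot (f 1)) + B.τex) / (B.m * B.ρ ^ 2))

/-- Velocity jump of the body under the contact impulses `g` (impulse-momentum relation,
evaluated at `q = 0`). -/
def Body.jump (g : Fin 2 → Vec) : Config :=
  ((g 0 + g 1).1 / B.m, (g 0 + g 1).2 / B.m,
    (-dot (B.p 0) (rot (g 0)) - dot (B.p 1) (rot (g 1))) / (B.m * B.ρ ^ 2))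

/-! ### Contact modes, ambiguous and persistent equilibria -/

/-- Modes of a single contact: sticking, free, positive slip, negative slip. -/
inductive Mode
  | S
  | F
  | P
  | N

/-- Kinematic admissibility of a mode at contact `i` in the state `(q, v)`. -/
def Mode.Admissible (i : Fin 2) (q v : Config) : Mode → Prop
  | .S => B.nor i q = 0 ∧ B.nor i v = 0 ∧ B.tan i v = 0
  | .F => 0 ≤ B.nor i q ∧ (B.nor i q = 0 → 0 ≤ B.nor i v)
  | .P => B.nor i q = 0 ∧ B.nor i v = 0 ∧ 0 ≤ B.tan i v
  | .N => B.nor i q = 0 ∧ B.nor i v = 0 ∧ B.tan i v ≤ 0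

/-- Equality constraints of a mode at contact `i`, for body acceleration `a` and contact force
`f` at that contact. -/
def Mode.Equalities (i : Fin 2) (a : Config) (f : Vec) : Mode → Prop
  | .S => B.nor i a = 0 ∧ B.tan i a = 0
  | .F => f = 0
  | .P => B.nor i a = 0 ∧ dot f (B.t i) = -B.μ i * dot f (B.n i)
  | .N => B.nor i a = 0 ∧ dot f (B.t i) = B.μ i * dot f (B.n i)

/-- Consistency constraints of a mode at contact `i` in the state `(q, v)`, for body acceleration
`a` and contact force `f` at that contact. -/
def Mode.Inequalities (i : Fin 2) (q v a : Config) (f : Vec) : Mode → Prop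
  | .S => |dot f (B.t i)| < B.μ i * dot f (B.n i)
  | .F => B.nor i q = 0 → B.nor i v = 0 → 0 < B.nor i a
  | .P => 0 < dot f (B.n i) ∧ (B.tan i v = 0 → 0 < B.tan i a)
  | .N => 0 < dot f (B.n i) ∧ (B.tan i v = 0 → B.tan i a < 0)

/-- The contact forces `f` solve the zero-order dynamics of the two-contact mode `c`. -/
def Body.SolvesMode (c : Fin 2 → Mode) (f : Fin 2 → Vec) : Prop :=
  ∀ i, (c i).Equalities B i (B.accel f) (f i)

/-- Contact forces that satisfy all equality and consistency constraints of mode `c`. -/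
def Body.consistentForces (c : Fin 2 → Mode) (q v : Config) : Set (Fin 2 → Vec) :=
  {f | B.SolvesMode c f ∧ ∀ i, (c i).Inequalities B i q v (B.accel f) (f i)}

/-- The static mode `SS`. -/
def modeSS : Fin 2 → Mode := ![.S, .S]

/-- The static mode `SS` is consistent: it is kinematically admissible and infinitely many contact
forces satisfy its constraints. -/
def Body.StaticConsistent (q v : Config) : Prop :=
  (∀ i, (modeSS i).Admissible B i q v) ∧ (B.consistentForces modeSS q v).Infinite

/-- A non-static mode is consistent: it is kinematically admissible and exactly one pair of
contact forces (hence one acceleration) satisfies its constraints. -/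
def Body.NonstaticConsistent (c : Fin 2 → Mode) (q v : Config) : Prop :=
  (∀ i, (c i).Admissible B i q v) ∧ ∃! f, f ∈ B.consistentForces c q v

/-- The state `q = 0` at rest is an equilibrium at which no non-static mode is consistent. -/
def Body.NonAmbiguousEquilibrium : Prop :=
  B.StaticConsistent 0 0 ∧ ∀ c, c ≠ modeSS → ¬ B.NonstaticConsistent c 0 0

/-- The zero-order dynamics of mode `c` has a unique solution, and it has the property `Q`. -/
def Body.UnderMode (c : Fin 2 → Mode) (Q : (Fin 2 → Vec) → Prop) : Prop :=
  (∃! f, B.SolvesMode c f) ∧ ∀ f, B.SolvesMode c f → Q f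

/-- Contact `i` slips. -/
def Mode.IsSlip (c : Mode) : Prop := c = .P ∨ c = .N

/-- Kinematically feasible modes with two slipping contacts: `PP` and `NN` if
`cos φ₁ cos φ₂ > 0`, and `PN` and `NP` if `cos φ₁ cos φ₂ < 0`. -/
def Body.FeasibleDoubleSlip (c : Fin 2 → Mode) : Prop :=
  (0 < Real.cos (B.φ 0) * Real.cos (B.φ 1) ∧ (c = ![.P, .P] ∨ c = ![.N, .N])) ∨
  (Real.cos (B.φ 0) * Real.cos (B.φ 1) < 0 ∧ (c = ![.P, .N] ∨ c = ![.N, .P]))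

/-- Persistent equilibria. -/
structure Body.Persistent : Prop where
  nonAmbiguous : B.NonAmbiguousEquilibrium
  /-- modes with one slipping contact `i` and one free contact `j` -/
  singleSlip : ∀ c : Fin 2 → Mode, ∀ i j, i ≠ j → (c i).IsSlip → c j = .F →
    B.UnderMode c fun f => dot (f i) (B.n i) < 0 ∨ B.nor j (B.accel f) < 0
  doubleSlip : ∀ c, B.FeasibleDoubleSlip c → B.UnderMode c fun f => ∀ i, 0 < dot (f i) (B.n i)

/-- The friction coefficients satisfy the upper bound that excludes the Painlevé paradox at a
single contact: `μ < (κ² + sin² β) / |sin β cos β|`, where `κ = ρ / ‖p‖` and `β` is the angle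
between the normal and the vector from the contact to the centre of mass. The
inequality is multiplied by `‖p‖² |sin β cos β|`, where `‖p‖ sin β = ± p ⬝ t` and
`‖p‖ cos β = - p ⬝ n`. -/
def Body.PainleveFree : Prop :=
  ∀ i, B.μ i * |dot (B.p i) (B.t i) * dot (B.p i) (B.n i)| < B.ρ ^ 2 + dot (B.p i) (B.t i) ^ 2

/-- Slippage at both contacts never proceeds at constant speed: in every kinematically feasible
mode with two slipping contacts the tangential acceleration is non-zero. -/
def Body.SlipAccelNonzero : Prop :=
  ∀ c, B.FeasibleDoubleSlip c → ∀ f, B.SolvesMode c f → B.tan 1 (B.accel f) ≠ 0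

/-! ### Hybrid trajectories of the zero-order dynamics -/

/-- Complementarity relations with Coulomb friction, for contact forces (or impulses) `f`, the
configuration `q` and the (post-impact) velocity `v`. -/
def Body.Complementarity (q v : Config) (f : Fin 2 → Vec) : Prop :=
  ∀ i,
    (0 ≤ dot (f i) (B.n i) ∧ 0 ≤ B.nor i q ∧ dot (f i) (B.n i) * B.nor i q = 0) ∧
    (B.nor i q = 0 → 0 ≤ B.nor i v ∧ dot (f i) (B.n i) * B.nor i v = 0) ∧
    (∃ s : ℝ, |s| ≤ 1 ∧ (0 < B.tan i v → s = 1) ∧ (B.tan i v < 0 → s = -1) ∧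
      dot (f i) (B.t i) = -B.μ i * s * dot (f i) (B.n i))

/-- The contact-feasible states. -/
def Body.Feasible (q v : Config) : Prop :=
  ∀ i, 0 ≤ B.nor i q ∧ (B.nor i q = 0 → 0 ≤ B.nor i v)

/-- Some contact collides: it touches its support with negative normal velocity. -/
def Body.Colliding (q v : Config) : Prop := ∃ i, B.nor i q = 0 ∧ B.nor i v < 0

/-- The contact impulses `g` and the post-impact velocity `w` solve the inelastic impact law for
the pre-impact state `(q, v)`. -/
def Body.ImpactSolution (q v w : Config) (g : Fin 2 → Vec) : Prop :=
  w = v + B.jump g ∧ B.Complementarity q w g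

/-- Single-contact impact: at most one contact impulse is non-zero. -/
def SingleImpact (g : Fin 2 → Vec) : Prop := ∃ i, g i = 0

/-- Sticking impact: every contact with a non-zero impulse has zero tangential velocity after the
impact. -/
def Body.StickingImpact (w : Config) (g : Fin 2 → Vec) : Prop := ∀ i, g i ≠ 0 → B.tan i w = 0

/-- The impact law, which takes the velocity `v` just before to the velocity `w` just after an
instant. Nothing happens unless some contact collides. If the law has several solutions, then
single-contact impacts are preferred over two-contact impacts, and, next, sticking impacts over
slipping ones. -/
def Body.Impact (q v w : Config) : Prop :=
  (¬ B.Colliding q v ∧ w = v) ∨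
  (B.Colliding q v ∧ ∃ g, B.ImpactSolution q v w g ∧
    (SingleImpact g ∨ ∀ w' g', B.ImpactSolution q v w' g' → ¬ SingleImpact g') ∧
    (B.StickingImpact w g ∨ ∀ w' g', B.ImpactSolution q v w' g' →
      (SingleImpact g' ↔ SingleImpact g) → ¬ B.StickingImpact w' g'))

/-- `t ↦ (q t, v t)` is a hybrid trajectory of the zero-order dynamics on the time interval `I`
(which is `[0, T)` or `[0, ∞)`). After each instant the body moves for some time with constant
contact forces that satisfy the complementarity relations; at each instant `t > 0` the velocity
has a left limit, and the impact law takes that limit to `v t`. Impact times may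
accumulate from the left (Zeno behaviour), and the trajectory goes on after
such an accumulation point. -/
structure Body.IsTrajectory (I : Set ℝ) (q v : ℝ → Config) : Prop where
  continuousOn : ContinuousOn q I
  motion : ∀ t ∈ I, ∃ η > 0, ∃ f : Fin 2 → Vec, ∀ s ∈ I, t ≤ s → s < t + η →
    v s = v t + (s - t) • B.accel f ∧
    q s = q t + (s - t) • v t + ((s - t) ^ 2 / 2) • B.accel f ∧
    B.Complementarity (q s) (v s) f
  impact : ∀ t ∈ I, 0 < t → ∃ w, Tendsto v (𝓝[<] t) (𝓝 w) ∧ B.Impact (q t) w (v t)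

/-! ### Poincaré map and its reductions -/

/-- The Poincaré section: pre-impact states in which contact 1 is sustained and contact 2
collides. -/
def Body.Section (q v : Config) : Prop :=
  B.nor 0 q = 0 ∧ B.nor 1 q = 0 ∧ B.nor 0 v = 0 ∧ B.nor 1 v < 0

/-- Graph of the Poincaré map: the trajectory that starts with the impact at the state `(q₀, v₀)` of
the section next crosses the section in the (pre-impact) state `(q₁, v₁)`. -/
def Body.PoincareMap (q₀ v₀ q₁ v₁ : Config) : Prop :=
  B.Section q₀ v₀ ∧ B.Section q₁ v₁ ∧
  ∃ T > 0, ∃ q v : ℝ → Config, B.IsTrajectory (Set.Ico 0 T) q v ∧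
    q 0 = q₀ ∧ B.Impact q₀ v₀ (v 0) ∧
    Tendsto q (𝓝[<] T) (𝓝 q₁) ∧ Tendsto v (𝓝[<] T) (𝓝 v₁) ∧
    ∀ t ∈ Set.Ioo 0 T, ∀ w, Tendsto v (𝓝[<] t) (𝓝 w) → ¬ B.Section (q t) w

/-- The angle `arctan (ẋ₂ / |ż₂|)` of the pre-impact velocity of contact 2 with the normal. -/
def Body.angle (v : Config) : ℝ := Real.arctan (B.tan 1 v / |B.nor 1 v|)

/-- Graph of the reduced Poincaré map: `R ϕ = ϕ'`. -/
def Body.ReducedMap (ϕ ϕ' : ℝ) : Prop :=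
  ∃ q₀ v₀ q₁ v₁, B.PoincareMap q₀ v₀ q₁ v₁ ∧ B.angle v₀ = ϕ ∧ B.angle v₁ = ϕ'

/-- Graph of the growth map: `G ϕ = g`. -/
def Body.GrowthMap (ϕ g : ℝ) : Prop :=
  ∃ q₀ v₀ q₁ v₁, B.PoincareMap q₀ v₀ q₁ v₁ ∧ B.angle v₀ = ϕ ∧ |B.nor 1 v₁| / |B.nor 1 v₀| = g

/-! ### Stability -/

/-- The distance `Δ` of a (feasible) state from the equilibrium state. -/
def Body.dist (q v : Config) : ℝ :=
  max (√(B.nor 0 q)) (max (√(B.nor 1 q)) (max (√|B.tan 1 q|)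
    (max |B.nor 0 v| (max |B.nor 1 v| |B.tan 1 v|))))

/-- Finite-time Lyapunov stability of `q = 0` under the zero-order dynamics. Every feasible initial
state close to the equilibrium has a trajectory for all times, and each such trajectory stays
close and reaches a static configuration, where it remains, in a short time. -/
def Body.FTLS : Prop :=
  ∀ ε > 0, ∃ δ > 0, ∀ q₀ v₀, B.Feasible q₀ v₀ → B.dist q₀ v₀ < δ →
    (∃ q v, B.IsTrajectory (Set.Ici 0) q v ∧ q 0 = q₀ ∧ v 0 = v₀) ∧
    ∀ q v, B.IsTrajectory (Set.Ici 0) q v → q 0 = q₀ → v 0 = v₀ →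
      (∀ t > 0, B.dist (q t) (v t) < ε) ∧
      ∃ tf, 0 ≤ tf ∧ tf < ε ∧ ∀ t ≥ tf, q t = q tf ∧ v t = 0 ∧ ∀ i, B.nor i (q t) = 0

end TwoContact

end

/-! The body is steered by three facts. First, persistence of the equilibrium controls every mode
with an open contact: whenever one contact is sustained, by any force in its friction cone, the
other one accelerates towards its support at a uniform rate (`nor_acc_le`), so it falls back after
a time proportional to its normal velocity. Second, with both contacts sustained the body
decelerates horizontally and stops (`exists_slip`, `exists_slip_flight`): at the equilibrium the
modes with two slipping contacts are inconsistent although their contact forces are positive,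
hence the slip acceleration, which does not vanish, opposes the slip. Third, contact 1 (index `0`)
cannot be left open for ever, since `z̈₁ < 0` in free flight. So a motion that does not come to
rest with both contacts sustained soon crosses the Poincaré section, and from there it alternates
impacts at contact 2 and contact 1 with flights (`Cycle`).

The hypothesis on the growth map says that a cycle decreases the normal velocity `y = |ż₂|`. The
decrease has to be uniform. A cycle is described by its initial velocity, the directions of the
impulses and forces, and the durations of the phases, and all impact and contact laws between
these data can be written as closed conditions (`isClosed_cycle`); the degenerate cycles that this
admits do not return to the section with a downward velocity (`Cycle.duration_pos`). Cycles are
invariant under the scaling of velocities (`Cycle.scale`), so `y = 1` may be assumed. If the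
horizontal velocity is large, the slip directions do not change during the cycle, and a shift of
the horizontal velocity gives a slower cycle of the same gain (`Cycle.shift`). The remaining
cycles form a compact set, on which the gain attains a maximum `γ < 1` (`exists_contraction`).

Hence `y` decreases geometrically along the successive crossings, and so do the durations of the
cycles and the changes of velocity: the impacts accumulate after a time proportional to the
initial speed, in a state with two sustained contacts, from which the body slips to rest
(`settles_section`). All other feasible states reach such a state or the section after at most
three flights (`settles_feasible`). The flights are followed by all trajectories because the
acceleration is determined by the state (`LocalForce.accel_unique`, `IsTrajectory.eqOn`); impacts
are not assumed to have a unique outcome. Since left limits exist at the end of every bounded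
trajectory, and the impact law is always solvable (`exists_impact`, a linear complementarity
problem for each slip direction combined by convexity), Zorn's lemma gives trajectories for all
times. Finally, contact forces and impulses are dissipative, so that the velocity is bounded by
its initial value and the elapsed time (`velocity_bound`).
-/

namespace TwoContact

variable {B : Body}

/-! ### Contact coordinates and the response of the body to a contact force -/

/-- Horizontal displacement (velocity, acceleration) shared by the two vertices. Together with the
two normal components it forms a coordinate system of the configuration space. -/
def Body.hor (B : Body) (w : Config) : ℝ := w.1 + B.h * w.2.2

/-- The contact force with normal component `c.1` and tangential component `c.2`. -/
noncomputable def Body.force (B : Body) (i : Fin 2) (c : ℝ × ℝ) : Vec := c.1 • B.n i + c.2 • B.t i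

/-- The velocity jump (acceleration) caused by the contact impulse (force) `B.force i c`. -/
noncomputable def Body.push (B : Body) (i : Fin 2) (c : ℝ × ℝ) : Config :=
  ((B.force i c).1 / B.m, (B.force i c).2 / B.m,
    (-dot (B.p i) (rot (B.force i c))) / (B.m * B.ρ ^ 2))

/-- Normal and tangential components of a contact force. -/
noncomputable def Body.comps (B : Body) (i : Fin 2) (F : Vec) : ℝ × ℝ :=
  (dot F (B.n i), dot F (B.t i))

@[simp] lemma nor_add (i : Fin 2) (v w : Config) : B.nor i (v + w) = B.nor i v + B.nor i w := by
  simp [Body.nor, Body.vertex, dot]; ring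

@[simp] lemma nor_sub (i : Fin 2) (v w : Config) : B.nor i (v - w) = B.nor i v - B.nor i w := by
  simp [Body.nor, Body.vertex, dot]; ring

@[simp] lemma nor_smul (i : Fin 2) (r : ℝ) (v : Config) : B.nor i (r • v) = r * B.nor i v := by
  simp [Body.nor, Body.vertex, dot]; ring

@[simp] lemma nor_zero (i : Fin 2) : B.nor i 0 = 0 := by simp [Body.nor, Body.vertex, dot]

@[simp] lemma tan_add (i : Fin 2) (v w : Config) : B.tan i (v + w) = B.tan i v + B.tan i w := by
  simp [Body.tan, Body.vertex, dot]; ring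

@[simp] lemma tan_sub (i : Fin 2) (v w : Config) : B.tan i (v - w) = B.tan i v - B.tan i w := by
  simp [Body.tan, Body.vertex, dot]; ring

@[simp] lemma tan_smul (i : Fin 2) (r : ℝ) (v : Config) : B.tan i (r • v) = r * B.tan i v := by
  simp [Body.tan, Body.vertex, dot]; ring

@[simp] lemma tan_zero (i : Fin 2) : B.tan i 0 = 0 := by simp [Body.tan, Body.vertex, dot]

@[simp] lemma hor_add (v w : Config) : B.hor (v + w) = B.hor v + B.hor w := by
  simp [Body.hor]; ring

@[simp] lemma hor_sub (v w : Config) : B.hor (v - w) = B.hor v - B.hor w := by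
  simp [Body.hor]; ring

@[simp] lemma hor_smul (r : ℝ) (v : Config) : B.hor (r • v) = r * B.hor v := by
  simp [Body.hor]; ring

@[fun_prop] lemma continuous_nor (i : Fin 2) : Continuous (B.nor i) := by
  unfold Body.nor Body.vertex dot; fun_prop

@[fun_prop] lemma continuous_tan (i : Fin 2) : Continuous (B.tan i) := by
  unfold Body.tan Body.vertex dot; fun_prop

@[fun_prop] lemma continuous_hor : Continuous B.hor := by
  unfold Body.hor; fun_prop

lemma cos_mul_tan (i : Fin 2) (w : Config) :
    Real.cos (B.φ i) * B.tan i w = B.hor w + Real.sin (B.φ i) * B.nor i w := by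
  have := Real.sin_sq_add_cos_sq (B.φ i)
  simp [Body.tan, Body.nor, Body.vertex, Body.hor, dot, rot, Body.p, Body.t, Body.n]
  linear_combination (w.1 + B.h * w.2.2) * this

lemma tan_eq_hor_div (hc : ∀ i, Real.cos (B.φ i) ≠ 0) {i : Fin 2} {w : Config}
    (h : B.nor i w = 0) : B.tan i w = B.hor w / Real.cos (B.φ i) := by
  rw [eq_div_iff (hc i), mul_comm, cos_mul_tan, h]; ring

lemma cos_mul_nor (i : Fin 2) (w : Config) :
    B.nor i w + Real.sin (B.φ i) * B.hor w = Real.cos (B.φ i) * (w.2.1 + B.l i * w.2.2) := by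
  simp [Body.nor, Body.vertex, Body.hor, dot, rot, Body.p, Body.n]
  ring

lemma config_eq_zero (hc : ∀ i, Real.cos (B.φ i) ≠ 0) {w : Config}
    (h : ∀ i, B.nor i w = 0) (hu : B.hor w = 0) : w = 0 := by
  have key : ∀ i, w.2.1 + B.l i * w.2.2 = 0 := by
    intro i
    have := cos_mul_nor (B := B) i w
    rw [h, hu] at this
    have h2 : Real.cos (B.φ i) * (w.2.1 + B.l i * w.2.2) = 0 := by linarith
    exact (mul_eq_zero.1 h2).resolve_left (hc i)
  have h3 : (B.l 0 - B.l 1) * w.2.2 = 0 := by linarith [key 0, key 1]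
  have h4 : w.2.2 = 0 := (mul_eq_zero.1 h3).resolve_left (sub_ne_zero.2 B.l_ne)
  have h5 := key 0
  rw [h4] at h5
  rw [Body.hor, h4] at hu
  refine Prod.ext (by simpa using hu) (Prod.ext (by simpa using h5) h4)

/-- The velocity of unit horizontal component that keeps both contacts closed. -/
lemma exists_horizontal (hc : ∀ i, Real.cos (B.φ i) ≠ 0) :
    ∃ e : Config, (∀ i, B.nor i e = 0) ∧ B.hor e = 1 := by
  set y : Fin 2 → ℝ := fun i => Real.sin (B.φ i) / Real.cos (B.φ i) with hy
  have hl : B.l 0 - B.l 1 ≠ 0 := sub_ne_zero.2 B.l_ne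
  set θ := (y 0 - y 1) / (B.l 0 - B.l 1) with hθ
  have hθ' : θ * (B.l 0 - B.l 1) = y 0 - y 1 := by rw [hθ]; field_simp
  have hh : B.hor (1 - B.h * θ, y 0 - B.l 0 * θ, θ) = 1 := by simp [Body.hor]
  refine ⟨(1 - B.h * θ, y 0 - B.l 0 * θ, θ), fun i => ?_, hh⟩
  have h1 := cos_mul_nor (B := B) i (1 - B.h * θ, y 0 - B.l 0 * θ, θ)
  rw [hh] at h1
  have h2 : Real.cos (B.φ i) * y i = Real.sin (B.φ i) := by
    rw [hy]; field_simp [hc i]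
  have h3 : y 0 - B.l 0 * θ + B.l i * θ = y i := by
    match i with
    | 0 => ring
    | 1 => linear_combination (-1) * hθ'
  simp only [h3, h2] at h1
  linarith

@[simp] lemma comps_force (i : Fin 2) (c : ℝ × ℝ) : B.comps i (B.force i c) = c := by
  have := Real.sin_sq_add_cos_sq (B.φ i)
  ext
  · simp [Body.comps, Body.force, dot, Body.n, Body.t]
    linear_combination c.1 * this
  · simp [Body.comps, Body.force, dot, Body.n, Body.t]
    linear_combination c.2 * this

@[simp] lemma force_comps (i : Fin 2) (F : Vec) : B.force i (B.comps i F) = F := by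
  have := Real.sin_sq_add_cos_sq (B.φ i)
  ext
  · simp [Body.comps, Body.force, dot, Body.n, Body.t]
    linear_combination F.1 * this
  · simp [Body.comps, Body.force, dot, Body.n, Body.t]
    linear_combination F.2 * this

@[simp] lemma dot_force_n (i : Fin 2) (c : ℝ × ℝ) : dot (B.force i c) (B.n i) = c.1 :=
  congrArg Prod.fst (comps_force (B := B) i c)

@[simp] lemma dot_force_t (i : Fin 2) (c : ℝ × ℝ) : dot (B.force i c) (B.t i) = c.2 :=
  congrArg Prod.snd (comps_force (B := B) i c)

@[simp] lemma comps_fst (i : Fin 2) (F : Vec) : (B.comps i F).1 = dot F (B.n i) := rfl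

@[simp] lemma comps_snd (i : Fin 2) (F : Vec) : (B.comps i F).2 = dot F (B.t i) := rfl

@[simp] lemma force_zero (i : Fin 2) : B.force i 0 = 0 := by simp [Body.force]

lemma comps_eq_zero {i : Fin 2} {F : Vec} : B.comps i F = 0 ↔ F = 0 :=
  ⟨fun h => by rw [← force_comps (B := B) i F, h, force_zero],
    fun h => by subst h; simp [Body.comps, dot]⟩

@[simp] lemma push_zero (i : Fin 2) : B.push i 0 = 0 := by simp [Body.push, rot, dot]

lemma push_add (i : Fin 2) (c d : ℝ × ℝ) : B.push i (c + d) = B.push i c + B.push i d := by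
  ext <;> simp [Body.push, Body.force, rot, dot] <;> ring

lemma push_smul (i : Fin 2) (r : ℝ) (c : ℝ × ℝ) : B.push i (r • c) = r • B.push i c := by
  ext <;> simp [Body.push, Body.force, rot, dot] <;> ring

@[fun_prop] lemma continuous_push (i : Fin 2) : Continuous (B.push i) := by
  unfold Body.push Body.force dot rot; fun_prop

lemma jump_eq (g : Fin 2 → Vec) :
    B.jump g = B.push 0 (B.comps 0 (g 0)) + B.push 1 (B.comps 1 (g 1)) := by
  rw [Body.push, Body.push, force_comps, force_comps]
  ext <;> simp [Body.jump] <;> ring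

lemma jump_eq' {i j : Fin 2} (hij : i ≠ j) (g : Fin 2 → Vec) :
    B.jump g = B.push i (B.comps i (g i)) + B.push j (B.comps j (g j)) := by
  rw [jump_eq]
  match i, j with
  | 0, 1 => rfl
  | 1, 0 => exact add_comm _ _
  | 0, 0 => exact absurd rfl hij
  | 1, 1 => exact absurd rfl hij

lemma accel_eq (f : Fin 2 → Vec) : B.accel f = B.accel 0 + B.jump f := by
  ext <;> simp [Body.accel, Body.jump, dot, rot] <;> ring

lemma accel_eq' {i j : Fin 2} (hij : i ≠ j) (f : Fin 2 → Vec) :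
    B.accel f = B.accel 0 + (B.push i (B.comps i (f i)) + B.push j (B.comps j (f j))) := by
  rw [accel_eq, jump_eq' hij]

/-- Contact inertia, normal-normal: normal response to a unit normal force. -/
noncomputable def Body.nn (B : Body) (i : Fin 2) : ℝ := B.nor i (B.push i (1, 0))

/-- Contact inertia, normal-tangential: normal response to a unit tangential force. -/
noncomputable def Body.nt (B : Body) (i : Fin 2) : ℝ := B.nor i (B.push i (0, 1))

/-- Contact inertia, tangential-tangential: tangential response to a unit tangential force. -/
noncomputable def Body.tt (B : Body) (i : Fin 2) : ℝ := B.tan i (B.push i (0, 1))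

lemma push_pair (i : Fin 2) (c : ℝ × ℝ) :
    B.push i c = c.1 • B.push i (1, 0) + c.2 • B.push i (0, 1) := by
  rw [← push_smul, ← push_smul, ← push_add]; simp

lemma nor_push (i j : Fin 2) (c : ℝ × ℝ) :
    B.nor j (B.push i c) = c.1 * B.nor j (B.push i (1, 0)) + c.2 * B.nor j (B.push i (0, 1)) := by
  rw [push_pair]; simp

lemma nor_push_self (i : Fin 2) (c : ℝ × ℝ) :
    B.nor i (B.push i c) = B.nn i * c.1 + B.nt i * c.2 := by
  rw [nor_push, Body.nn, Body.nt]; ring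

lemma nn_eq (i : Fin 2) : B.nn i = (1 + dot (B.p i) (B.t i) ^ 2 / B.ρ ^ 2) / B.m := by
  have h1 := B.m_pos.ne'
  have h2 := B.ρ_pos.ne'
  have := Real.sin_sq_add_cos_sq (B.φ i)
  simp only [Body.nn, Body.nor, Body.vertex, Body.push, Body.force, dot, rot, Body.p, Body.t,
    Body.n, Prod.smul_fst, Prod.smul_snd, Prod.fst_add, Prod.snd_add, smul_eq_mul]
  field_simp
  linear_combination (B.ρ ^ 2) * this

lemma nt_eq (i : Fin 2) :
    B.nt i = -(dot (B.p i) (B.t i) * dot (B.p i) (B.n i)) / (B.m * B.ρ ^ 2) := by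
  have h1 := B.m_pos.ne'
  have h2 := B.ρ_pos.ne'
  simp only [Body.nt, Body.nor, Body.vertex, Body.push, Body.force, dot, rot, Body.p, Body.t,
    Body.n, Prod.smul_fst, Prod.smul_snd, Prod.fst_add, Prod.snd_add, smul_eq_mul]
  field_simp
  ring

lemma tt_eq (i : Fin 2) : B.tt i = (1 + dot (B.p i) (B.n i) ^ 2 / B.ρ ^ 2) / B.m := by
  have h1 := B.m_pos.ne'
  have h2 := B.ρ_pos.ne'
  have := Real.sin_sq_add_cos_sq (B.φ i)
  simp only [Body.tt, Body.tan, Body.vertex, Body.push, Body.force, dot, rot, Body.p, Body.t,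
    Body.n, Prod.smul_fst, Prod.smul_snd, Prod.fst_add, Prod.snd_add, smul_eq_mul]
  field_simp
  linear_combination (B.ρ ^ 2) * this

lemma tan_push_normal (i : Fin 2) : B.tan i (B.push i (1, 0)) = B.nt i := by
  have h1 := B.m_pos.ne'
  have h2 := B.ρ_pos.ne'
  simp only [Body.nt, Body.nor, Body.tan, Body.vertex, Body.push, Body.force, dot, rot, Body.p,
    Body.t, Body.n, Prod.smul_fst, Prod.smul_snd, Prod.fst_add, Prod.snd_add, smul_eq_mul]
  field_simp
  ring

lemma tan_push_self (i : Fin 2) (c : ℝ × ℝ) :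
    B.tan i (B.push i c) = B.nt i * c.1 + B.tt i * c.2 := by
  rw [push_pair, tan_add, tan_smul, tan_smul, tan_push_normal, Body.tt]; ring

lemma nn_pos (i : Fin 2) : 0 < B.nn i := by
  have h1 := B.m_pos
  have h2 := B.ρ_pos
  rw [nn_eq]; positivity

lemma gram_pos (i : Fin 2) : 0 < B.nn i * B.tt i - B.nt i ^ 2 := by
  have h1 := B.m_pos
  have h2 := B.ρ_pos
  have : B.nn i * B.tt i - B.nt i ^ 2 =
      (1 + (dot (B.p i) (B.t i) ^ 2 + dot (B.p i) (B.n i) ^ 2) / B.ρ ^ 2) / B.m ^ 2 := by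
    rw [nn_eq, tt_eq, nt_eq]
    field_simp
    ring
  rw [this]; positivity

/-- Absence of the Painlevé paradox: the normal response to a force on the boundary of the friction
cone is bounded below by a positive multiple of the normal force. -/
noncomputable def Body.margin (B : Body) (i : Fin 2) : ℝ := B.nn i - B.μ i * |B.nt i|

lemma margin_pos (hp : B.PainleveFree) (i : Fin 2) : 0 < B.margin i := by
  have h1 := B.m_pos
  have h2 := B.ρ_pos
  have h := hp i
  have : B.margin i = (B.ρ ^ 2 + dot (B.p i) (B.t i) ^ 2 -
      B.μ i * |dot (B.p i) (B.t i) * dot (B.p i) (B.n i)|) / (B.m * B.ρ ^ 2) := by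
    rw [Body.margin, nn_eq, nt_eq, abs_div, abs_neg, abs_of_pos (by positivity : 0 < B.m * B.ρ ^ 2)]
    field_simp
  rw [this]
  apply div_pos (by linarith) (by positivity)

lemma margin_le (i : Fin 2) {c : ℝ × ℝ} (h : |c.2| ≤ B.μ i * c.1) :
    B.margin i * c.1 ≤ B.nor i (B.push i c) := by
  rw [nor_push_self, Body.margin]
  have h1 : |B.nt i * c.2| ≤ |B.nt i| * (B.μ i * c.1) := by
    rw [abs_mul]; gcongr
  have := neg_abs_le (B.nt i * c.2)
  nlinarith

/-! ### Coulomb friction -/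

/-- Coulomb's law for the force components `c` at a contact `i` with tangential velocity `T`,
apart from the cone condition `|c.2| ≤ μ * c.1`. -/
def Body.Coulomb (B : Body) (i : Fin 2) (c : ℝ × ℝ) (T : ℝ) : Prop :=
  c.2 * T = -(B.μ i * c.1 * |T|)

lemma coulomb_zero (i : Fin 2) (c : ℝ × ℝ) : B.Coulomb i c 0 := by simp [Body.Coulomb]

lemma coulomb_pos {i : Fin 2} {c : ℝ × ℝ} {T : ℝ} (hT : 0 < T) :
    B.Coulomb i c T ↔ c.2 = -(B.μ i * c.1) := by
  rw [Body.Coulomb, abs_of_pos hT, ← neg_mul]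
  exact mul_left_inj' hT.ne'

lemma coulomb_neg {i : Fin 2} {c : ℝ × ℝ} {T : ℝ} (hT : T < 0) :
    B.Coulomb i c T ↔ c.2 = B.μ i * c.1 := by
  rw [Body.Coulomb, abs_of_neg hT]
  constructor
  · intro h; exact mul_right_cancel₀ hT.ne (by linarith)
  · intro h; rw [h]; ring

lemma coulomb_smul {i : Fin 2} {c : ℝ × ℝ} {T r : ℝ} (hr : 0 < r) :
    B.Coulomb i c (r * T) ↔ B.Coulomb i c T := by
  rw [Body.Coulomb, Body.Coulomb, abs_mul, abs_of_pos hr]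
  constructor
  · intro h; exact mul_left_cancel₀ hr.ne' (by linarith)
  · intro h; linear_combination r * h

lemma coulomb_smul_left {i : Fin 2} {c : ℝ × ℝ} {T : ℝ} (r : ℝ) (h : B.Coulomb i c T) :
    B.Coulomb i (r • c) T := by
  simp only [Body.Coulomb, Prod.smul_fst, Prod.smul_snd, smul_eq_mul] at *
  linear_combination r * h

/-- Coulomb's law at both ends of an interval of tangential velocities holds in between. -/
lemma coulomb_between {i : Fin 2} {c : ℝ × ℝ} {T T' r s : ℝ} (hr : 0 ≤ r) (hs : 0 ≤ s)
    (h : B.Coulomb i c T) (h' : B.Coulomb i c T') : B.Coulomb i c (r * T + s * T') := by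
  rcases lt_trichotomy T 0 with hT | hT | hT <;> rcases lt_trichotomy T' 0 with hT' | hT' | hT'
  all_goals try subst hT
  all_goals try subst hT'
  all_goals simp only [Body.Coulomb] at *
  · rw [abs_of_neg hT] at h
    rw [abs_of_neg hT'] at h'
    rw [abs_of_nonpos (by nlinarith)]; linear_combination r * h + s * h'
  · rw [abs_of_neg hT] at h
    rw [abs_of_nonpos (by nlinarith)]; linear_combination r * h
  · rw [abs_of_neg hT] at h
    rw [abs_of_pos hT'] at h'
    have h1 : c.2 = B.μ i * c.1 := mul_right_cancel₀ hT.ne (by linarith)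
    have h2 : c.2 = -(B.μ i * c.1) := mul_right_cancel₀ hT'.ne' (by linarith)
    have h3 : c.2 = 0 := by linarith
    have h4 : B.μ i * c.1 = 0 := by linarith
    rw [h3, h4]; ring
  · rw [abs_of_neg hT'] at h'
    rw [abs_of_nonpos (by nlinarith)]; linear_combination s * h'
  · simp
  · rw [abs_of_pos hT'] at h'
    rw [abs_of_nonneg (by nlinarith)]; linear_combination s * h'
  · rw [abs_of_pos hT] at h
    rw [abs_of_neg hT'] at h'
    have h1 : c.2 = B.μ i * c.1 := mul_right_cancel₀ hT'.ne (by linarith)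
    have h2 : c.2 = -(B.μ i * c.1) := mul_right_cancel₀ hT.ne' (by linarith)
    have h3 : c.2 = 0 := by linarith
    have h4 : B.μ i * c.1 = 0 := by linarith
    rw [h3, h4]; ring
  · rw [abs_of_pos hT] at h
    rw [abs_of_nonneg (by nlinarith)]; linear_combination r * h
  · rw [abs_of_pos hT] at h
    rw [abs_of_pos hT'] at h'
    rw [abs_of_nonneg (by nlinarith)]; linear_combination r * h + s * h'

/-- Coulomb's law with a signed friction coefficient, in terms of force components. -/
lemma friction_iff {i : Fin 2} {a b T : ℝ} (ha : 0 ≤ a) :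
    (∃ s : ℝ, |s| ≤ 1 ∧ (0 < T → s = 1) ∧ (T < 0 → s = -1) ∧ b = -B.μ i * s * a) ↔
      |b| ≤ B.μ i * a ∧ B.Coulomb i (a, b) T := by
  have hm := B.μ_nonneg i
  constructor
  · rintro ⟨s, hs, h1, h2, rfl⟩
    refine ⟨?_, ?_⟩
    · rw [abs_mul, abs_mul, abs_neg, abs_of_nonneg hm, abs_of_nonneg ha]
      have := mul_le_mul_of_nonneg_left hs (mul_nonneg hm ha)
      linarith
    · rcases lt_trichotomy T 0 with hT | hT | hT
      · rw [coulomb_neg hT, h2 hT]; simp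
      · rw [hT]; exact coulomb_zero _ _
      · rw [coulomb_pos hT, h1 hT]; simp
  · rintro ⟨h1, h2⟩
    rcases lt_trichotomy T 0 with hT | hT | hT
    · rw [coulomb_neg hT] at h2
      exact ⟨-1, by simp, fun h => absurd h (by linarith), fun _ => rfl, by simp at h2; linarith⟩
    · rcases eq_or_lt_of_le (mul_nonneg hm ha) with h0 | h0
      · refine ⟨0, by simp, fun h => absurd h (by linarith), fun h => absurd h (by linarith), ?_⟩
        rw [← h0] at h1
        have := abs_nonpos_iff.1 h1
        simp [this]
      · refine ⟨-b / (B.μ i * a), ?_, fun h => absurd h (by linarith),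
          fun h => absurd h (by linarith), ?_⟩
        · rw [abs_div, abs_neg, abs_of_pos h0]
          exact div_le_one_of_le₀ h1 h0.le
        · have : a ≠ 0 := fun h => by simp [h] at h0
          have : B.μ i ≠ 0 := fun h => by simp [h] at h0
          field_simp
    · rw [coulomb_pos hT] at h2
      exact ⟨1, by simp, fun _ => rfl, fun h => absurd h (by linarith), by simp at h2; linarith⟩

lemma complementarity_iff {q v : Config} {f : Fin 2 → Vec} :
    B.Complementarity q v f ↔ ∀ i,
      (0 ≤ dot (f i) (B.n i) ∧ 0 ≤ B.nor i q ∧ dot (f i) (B.n i) * B.nor i q = 0) ∧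
      (B.nor i q = 0 → 0 ≤ B.nor i v ∧ dot (f i) (B.n i) * B.nor i v = 0) ∧
      |dot (f i) (B.t i)| ≤ B.μ i * dot (f i) (B.n i) ∧
      B.Coulomb i (B.comps i (f i)) (B.tan i v) := by
  refine forall_congr' fun i => ?_
  constructor
  · rintro ⟨h1, h2, h3⟩
    exact ⟨h1, h2, (friction_iff h1.1).1 h3⟩
  · rintro ⟨h1, h2, h3⟩
    exact ⟨h1, h2, (friction_iff h1.1).2 h3⟩

/-- Complementarity at a single contact with force components `c`, normal distance `z`, normal
velocity `ζ` and tangential velocity `T`. -/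
def Body.Compl (B : Body) (i : Fin 2) (c : ℝ × ℝ) (z ζ T : ℝ) : Prop :=
  0 ≤ c.1 ∧ 0 ≤ z ∧ c.1 * z = 0 ∧ (z = 0 → 0 ≤ ζ ∧ c.1 * ζ = 0) ∧ |c.2| ≤ B.μ i * c.1 ∧
    B.Coulomb i c T

lemma complementarity_iff_compl {q v : Config} {f : Fin 2 → Vec} :
    B.Complementarity q v f ↔
      ∀ i, B.Compl i (B.comps i (f i)) (B.nor i q) (B.nor i v) (B.tan i v) := by
  rw [complementarity_iff]
  refine forall_congr' fun i => ?_
  simp only [Body.Compl, comps_fst, comps_snd]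
  tauto

/-- A contact without force only has to be feasible. -/
lemma compl_zero {i : Fin 2} {z ζ T : ℝ} :
    B.Compl i 0 z ζ T ↔ 0 ≤ z ∧ (z = 0 → 0 ≤ ζ) := by
  simp [Body.Compl, Body.Coulomb]

/-! ### Contact forces that hold one contact closed -/

/-- The force components `c` lie in the friction cone of contact `i` and cause a unit normal
response there. Subtracting `B.nor i x • B.push i c` from a velocity or acceleration `x` stops the
normal motion of contact `i`. -/
def Body.UnitCone (B : Body) (i : Fin 2) (c : ℝ × ℝ) : Prop :=
  B.nor i (B.push i c) = 1 ∧ |c.2| ≤ B.μ i * c.1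

/-- The element of `B.UnitCone i` on the edge of the friction cone given by the sign `s`. -/
noncomputable def Body.edge (B : Body) (i : Fin 2) (s : ℝ) : ℝ × ℝ :=
  (1 / (B.nn i + s * B.μ i * B.nt i)) • (1, s * B.μ i)

/-- The free acceleration. -/
noncomputable def Body.free (B : Body) : Config := B.accel 0

/-- Acceleration in which contact `i` is held closed by a force in the direction `c`, if the
free acceleration presses it against its support. -/
noncomputable def Body.acc (B : Body) (i : Fin 2) (c : ℝ × ℝ) : Config :=
  B.free - min (B.nor i B.free) 0 • B.push i c

/-- The hypotheses on the body under which stability is decided by the growth map. -/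
structure Body.Regular (B : Body) : Prop where
  cos_ne : ∀ i, Real.cos (B.φ i) ≠ 0
  painleve : B.PainleveFree
  free_neg : B.nor 0 B.free < 0
  persistent : B.Persistent
  slip : B.SlipAccelNonzero

lemma Body.UnitCone.fst_pos (hp : B.PainleveFree) {i : Fin 2} {c : ℝ × ℝ} (h : B.UnitCone i c) :
    0 < c.1 := by
  have h1 : B.nn i * c.1 + B.nt i * c.2 = 1 := by rw [← nor_push_self]; exact h.1
  have hm := margin_pos hp i
  rw [Body.margin] at hm
  by_contra hc
  push Not at hc
  have h2 : B.μ i * c.1 ≤ 0 := mul_nonpos_of_nonneg_of_nonpos (B.μ_nonneg i) hc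
  have h3 : c.2 = 0 := abs_nonpos_iff.1 (h.2.trans h2)
  rw [h3] at h1
  nlinarith [nn_pos (B := B) i]

lemma unitCone_norm_le (hp : B.PainleveFree) :
    ∃ C > 0, ∀ i c, B.UnitCone i c → ‖c‖ ≤ C ∧ ‖B.push i c‖ ≤ C := by
  have key : ∀ i, ∃ C > 0, ∀ c, B.UnitCone i c → ‖c‖ ≤ C ∧ ‖B.push i c‖ ≤ C := by
    intro i
    have hm := margin_pos hp i
    have hμ := B.μ_nonneg i
    set K := (1 + B.μ i) / B.margin i with hK
    have hKp : 0 < K := by positivity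
    have hc : ∀ c, B.UnitCone i c → ‖c‖ ≤ K := by
      intro c h
      have h1 := margin_le i h.2
      rw [h.1] at h1
      have h2 := h.fst_pos hp
      have h3 : c.1 ≤ 1 / B.margin i := by rw [le_div_iff₀ hm]; linarith
      have h4 : B.μ i * c.1 ≤ B.μ i * (1 / B.margin i) := by gcongr
      have h5 : K = 1 / B.margin i + B.μ i * (1 / B.margin i) := by rw [hK]; ring
      have h6 : 0 < 1 / B.margin i := by positivity
      have h7 : 0 ≤ B.μ i * (1 / B.margin i) := by positivity
      rw [Prod.norm_def, Real.norm_eq_abs, Real.norm_eq_abs, abs_of_pos h2]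
      exact max_le (by linarith) (by linarith [h.2])
    refine ⟨K + K * (‖B.push i (1, 0)‖ + ‖B.push i (0, 1)‖), by positivity, fun c h => ?_⟩
    have h1 := hc c h
    have h0 : 0 ≤ K * (‖B.push i (1, 0)‖ + ‖B.push i (0, 1)‖) := by positivity
    refine ⟨by linarith, ?_⟩
    rw [push_pair]
    refine (norm_add_le _ _).trans ?_
    rw [norm_smul, norm_smul]
    have h2 : ‖c.1‖ ≤ K := (norm_fst_le c).trans h1
    have h3 : ‖c.2‖ ≤ K := (norm_snd_le c).trans h1
    nlinarith [mul_le_mul_of_nonneg_right h2 (norm_nonneg (B.push i (1, 0))),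
      mul_le_mul_of_nonneg_right h3 (norm_nonneg (B.push i (0, 1)))]
  choose C hC h using key
  refine ⟨max (C 0) (C 1), lt_max_of_lt_left (hC 0), fun i c hc => ?_⟩
  have h1 := h i c hc
  have : C i ≤ max (C 0) (C 1) := by
    match i with
    | 0 => exact le_max_left _ _
    | 1 => exact le_max_right _ _
  exact ⟨h1.1.trans this, h1.2.trans this⟩

lemma edge_den_pos (hp : B.PainleveFree) (i : Fin 2) {s : ℝ} (hs : s = 1 ∨ s = -1) :
    0 < B.nn i + s * B.μ i * B.nt i := by
  have hm := margin_pos hp i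
  rw [Body.margin] at hm
  have hμ := B.μ_nonneg i
  rcases hs with rfl | rfl
  · nlinarith [neg_abs_le (B.nt i)]
  · nlinarith [le_abs_self (B.nt i)]

lemma edge_snd (i : Fin 2) (s : ℝ) : (B.edge i s).2 = s * (B.μ i * (B.edge i s).1) := by
  simp only [Body.edge, Prod.smul_fst, Prod.smul_snd, smul_eq_mul]; ring

lemma unitCone_edge (hp : B.PainleveFree) (i : Fin 2) {s : ℝ} (hs : s = 1 ∨ s = -1) :
    B.UnitCone i (B.edge i s) := by
  have hd := edge_den_pos hp i hs
  have hμ := B.μ_nonneg i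
  refine ⟨?_, ?_⟩
  · rw [Body.edge, push_smul, nor_smul, nor_push_self]
    field_simp
  · simp only [Body.edge, Prod.smul_fst, Prod.smul_snd, smul_eq_mul, mul_one]
    have : |s| = 1 := by rcases hs with h | h <;> simp [h]
    rw [abs_mul, abs_mul, this, abs_of_nonneg hμ, abs_of_pos (by positivity)]
    apply le_of_eq; ring

lemma Body.UnitCone.combo {i : Fin 2} {c d : ℝ × ℝ} {θ : ℝ} (hθ : θ ∈ Set.Icc (0 : ℝ) 1)
    (hc : B.UnitCone i c) (hd : B.UnitCone i d) : B.UnitCone i ((1 - θ) • c + θ • d) := by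
  obtain ⟨h0, h1⟩ := hθ
  refine ⟨?_, ?_⟩
  · rw [push_add, push_smul, push_smul, nor_add, nor_smul, nor_smul, hc.1, hd.1]; ring
  · simp only [Prod.fst_add, Prod.snd_add, Prod.smul_fst, Prod.smul_snd, smul_eq_mul]
    have := abs_add_le ((1 - θ) * c.2) (θ * d.2)
    rw [abs_mul, abs_mul, abs_of_nonneg h0, abs_of_nonneg (sub_nonneg.2 h1)] at this
    nlinarith [mul_le_mul_of_nonneg_left hc.2 (sub_nonneg.2 h1), mul_le_mul_of_nonneg_left hd.2 h0]

/-- The unit cone is the segment between its two edges. -/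
lemma Body.UnitCone.exists_combo (hp : B.PainleveFree) {i : Fin 2} {c : ℝ × ℝ} (hc : B.UnitCone i c) :
    ∃ θ ∈ Set.Icc (0 : ℝ) 1, c = (1 - θ) • B.edge i (-1) + θ • B.edge i 1 := by
  have h1 := edge_den_pos hp i (Or.inl rfl)
  have h2 := edge_den_pos hp i (Or.inr rfl)
  have hn : B.nn i * c.1 + B.nt i * c.2 = 1 := by rw [← nor_push_self]; exact hc.1
  have hcc := abs_le.1 hc.2
  rcases eq_or_lt_of_le (B.μ_nonneg i) with h0 | h0
  · refine ⟨0, by simp, ?_⟩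
    have h3 : c.2 = 0 := by
      have := hc.2
      rw [← h0, zero_mul] at this
      exact abs_nonpos_iff.1 this
    rw [h3] at hn
    have h4 := (nn_pos (B := B) i).ne'
    ext
    · simp [Body.edge, ← h0]; field_simp; linarith
    · simp [Body.edge, ← h0, h3]
  · set D := B.nn i + 1 * B.μ i * B.nt i with hD
    set E := B.nn i + (-1) * B.μ i * B.nt i with hE
    have h5 : 1 - D * (c.1 + c.2 / B.μ i) / 2 = E * (c.1 - c.2 / B.μ i) / 2 := by
      rw [hD, hE]; field_simp; linear_combination (-2 * B.μ i) * hn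
    have h6 : 0 ≤ c.1 + c.2 / B.μ i := by
      rw [← mul_le_mul_iff_right₀ h0]; field_simp; linarith
    have h7 : 0 ≤ c.1 - c.2 / B.μ i := by
      rw [← mul_le_mul_iff_right₀ h0]; field_simp; linarith
    refine ⟨D * (c.1 + c.2 / B.μ i) / 2, ⟨by positivity, ?_⟩, ?_⟩
    · have : 0 ≤ E * (c.1 - c.2 / B.μ i) / 2 := by positivity
      linarith
    · rw [h5]
      ext
      · simp only [Body.edge, ← hD, ← hE, Prod.fst_add, Prod.smul_fst, smul_eq_mul]
        field_simp; ring
      · simp only [Body.edge, ← hD, ← hE, Prod.snd_add, Prod.smul_snd, smul_eq_mul]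
        field_simp; ring

/-- The friction problem at a single contact has a solution. -/
lemma exists_unitCone_coulomb (hp : B.PainleveFree) (i : Fin 2) (x : Config) :
    ∃ c, B.UnitCone i c ∧ B.Coulomb i c (B.tan i (x - B.nor i x • B.push i c)) := by
  set T : ℝ × ℝ → ℝ := fun c => B.tan i (x - B.nor i x • B.push i c) with hT
  have hm := unitCone_edge hp i (s := -1) (Or.inr rfl)
  have hpl := unitCone_edge hp i (s := 1) (Or.inl rfl)
  rcases le_or_gt 0 (T (B.edge i (-1))) with h | h
  · refine ⟨_, hm, ?_⟩
    change B.Coulomb i _ (T (B.edge i (-1)))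
    rw [Body.Coulomb, abs_of_nonneg h, edge_snd]
    ring
  rcases le_or_gt (T (B.edge i 1)) 0 with h' | h'
  · refine ⟨_, hpl, ?_⟩
    change B.Coulomb i _ (T (B.edge i 1))
    rw [Body.Coulomb, abs_of_nonpos h', edge_snd]
    ring
  set a := T (B.edge i (-1)) with ha
  set b := T (B.edge i 1) with hb
  have hd : 0 < b - a := by linarith
  have hθ : -a / (b - a) ∈ Set.Icc (0 : ℝ) 1 :=
    ⟨div_nonneg (by linarith) hd.le, (div_le_one hd).2 (by linarith)⟩
  refine ⟨_, hm.combo hθ hpl, ?_⟩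
  have hlin : ∀ θ : ℝ, T ((1 - θ) • B.edge i (-1) + θ • B.edge i 1) = (1 - θ) * a + θ * b := by
    intro θ
    simp only [ha, hb, hT, push_add, push_smul, tan_sub, tan_smul, tan_add]
    ring
  change B.Coulomb i _ (T _)
  rw [hlin]
  have : (1 - -a / (b - a)) * a + -a / (b - a) * b = 0 := by field_simp; ring
  rw [this]
  exact coulomb_zero _ _

/-- The friction problem at a single contact has at most one solution: the tangential response is
strictly increasing along the unit cone, while Coulomb's law is decreasing. -/
lemma unitCone_coulomb_unique (hp : B.PainleveFree) {i : Fin 2} {x : Config} (hx : B.nor i x < 0)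
    {c d : ℝ × ℝ} (hc : B.UnitCone i c) (hd : B.UnitCone i d)
    (hcc : B.Coulomb i c (B.tan i (x - B.nor i x • B.push i c)))
    (hdc : B.Coulomb i d (B.tan i (x - B.nor i x • B.push i d))) : c = d := by
  have hn : ∀ c, B.UnitCone i c → B.nn i * c.1 + B.nt i * c.2 = 1 := fun c hc => by
    rw [← nor_push_self]; exact hc.1
  have key : ∀ c d, B.UnitCone i c → B.UnitCone i d →
      B.Coulomb i c (B.tan i (x - B.nor i x • B.push i c)) →
      B.Coulomb i d (B.tan i (x - B.nor i x • B.push i d)) → ¬ d.2 < c.2 := by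
    intro c d hc hd hcc hdc hlt
    have h1 := hn c hc
    have h2 := hn d hd
    have hnn := nn_pos (B := B) i
    have hgr := gram_pos (B := B) i
    have hm := margin_pos hp i
    rw [Body.margin] at hm
    have hT : 0 < B.nn i * (B.tan i (x - B.nor i x • B.push i c) -
        B.tan i (x - B.nor i x • B.push i d)) := by
      have : B.nn i * (B.tan i (x - B.nor i x • B.push i c) -
        B.tan i (x - B.nor i x • B.push i d)) =
        -B.nor i x * ((c.2 - d.2) * (B.nn i * B.tt i - B.nt i ^ 2)) := by
        simp only [tan_sub, tan_smul, tan_push_self]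
        linear_combination (-B.nor i x * B.nt i) * (h1 - h2)
      rw [this]
      exact mul_pos (by linarith) (mul_pos (by linarith) hgr)
    have hT' := pos_of_mul_pos_right hT hnn.le
    have hΔ : B.nn i * (c.1 - d.1) = -B.nt i * (c.2 - d.2) := by linarith
    have hμ := B.μ_nonneg i
    have hab1 : 0 ≤ (c.2 - d.2) * (|B.nt i| - B.nt i) :=
      mul_nonneg (by linarith) (by linarith [le_abs_self (B.nt i)])
    have hab2 : 0 ≤ (c.2 - d.2) * (|B.nt i| + B.nt i) :=
      mul_nonneg (by linarith) (by linarith [neg_abs_le (B.nt i)])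
    have hpos : 0 < (c.2 - d.2) * (B.nn i - B.μ i * |B.nt i|) := mul_pos (by linarith) hm
    rcases le_or_gt (B.tan i (x - B.nor i x • B.push i c)) 0 with h | h
    · rw [coulomb_neg (by linarith)] at hdc
      have h3 := (abs_le.1 hc.2).2
      have h4 : c.2 - d.2 ≤ B.μ i * (c.1 - d.1) := by linarith
      nlinarith [mul_le_mul_of_nonneg_left h4 hnn.le, mul_nonneg hμ hab2]
    · rw [coulomb_pos h] at hcc
      have h3 := (abs_le.1 hd.2).1
      have h4 : c.2 - d.2 ≤ -B.μ i * (c.1 - d.1) := by linarith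
      nlinarith [mul_le_mul_of_nonneg_left h4 hnn.le, mul_nonneg hμ hab1]
  have h2 : c.2 = d.2 :=
    le_antisymm (not_lt.1 (key c d hc hd hcc hdc)) (not_lt.1 (key d c hd hc hdc hcc))
  refine Prod.ext ?_ h2
  have := hn c hc
  have := hn d hd
  rw [h2] at *
  exact mul_left_cancel₀ (nn_pos (B := B) i).ne' (by linarith)

/-! ### Consequences of persistence -/

/-- Slip at contact `i` pulls the free contact `j` down: the force at `i` is not negative, so that the
other alternative of persistence holds. -/
lemma nor_edge_neg (H : B.Regular) {i j : Fin 2} (hij : i ≠ j) (hi : B.nor i B.free ≤ 0)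
    {s : ℝ} (hs : s = 1 ∨ s = -1) :
    B.nor j (B.free - B.nor i B.free • B.push i (B.edge i s)) < 0 := by
  set b := B.nor i B.free with hb
  have hd := edge_den_pos H.painleve i hs
  set m : Mode := if s = 1 then Mode.N else Mode.P with hm
  set c : Fin 2 → Mode := fun k => if k = i then m else Mode.F with hc
  have hci : c i = m := by simp [hc]
  have hcj : c j = .F := by simp [hc, hij.symm]
  have hslip : (c i).IsSlip := by
    rw [hci, hm]; split_ifs
    · exact Or.inr rfl
    · exact Or.inl rfl
  set f : Fin 2 → Vec := fun k => if k = i then B.force i (-b • B.edge i s) else 0 with hf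
  have hfi : f i = B.force i (-b • B.edge i s) := by simp [hf]
  have hfj : f j = 0 := by simp [hf, hij.symm]
  have hacc : B.accel f = B.free - b • B.push i (B.edge i s) := by
    rw [accel_eq' hij, hfi, hfj, comps_force, comps_eq_zero.2 rfl, push_zero, push_smul, Body.free]
    simp [sub_eq_add_neg]
  have hsol : B.SolvesMode c f := by
    have hnor : B.nor i (B.accel f) = 0 := by
      rw [hacc, nor_sub, nor_smul, (unitCone_edge H.painleve i hs).1, ← hb]; ring
    intro k
    rcases eq_or_ne k i with rfl | hk
    · rw [hci, hm]
      rcases hs with rfl | rfl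
      · rw [if_pos rfl]
        refine ⟨hnor, ?_⟩
        rw [hfi, dot_force_t, dot_force_n]
        simp [Body.edge]; ring
      · rw [if_neg (by norm_num)]
        refine ⟨hnor, ?_⟩
        rw [hfi, dot_force_t, dot_force_n]
        simp [Body.edge]; ring
    · have : c k = .F := by simp [hc, hk]
      rw [this]
      change f k = 0
      simp [hf, hk]
  rcases (H.persistent.singleSlip c i j hij hslip hcj).2 f hsol with h | h
  · exfalso
    rw [hfi, dot_force_n] at h
    have : 0 ≤ (-b • B.edge i s).1 := by
      simp only [Body.edge, Prod.smul_fst, smul_eq_mul]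
      have : 0 ≤ -b := by linarith
      positivity
    linarith
  · rwa [hacc] at h

/-- Whichever contact is closed, the other one accelerates towards its support, uniformly in the
friction force. -/
lemma nor_acc_le (H : B.Regular) :
    ∃ β > 0, ∀ i j, i ≠ j → ∀ c, B.UnitCone i c → B.nor j (B.acc i c) ≤ -β := by
  have key : ∀ i j, i ≠ j → ∃ β > 0, ∀ c, B.UnitCone i c → B.nor j (B.acc i c) ≤ -β := by
    intro i j hij
    rcases le_or_gt (B.nor i B.free) 0 with hi | hi
    · -- the acceleration is affine on the unit cone, hence bounded by its values at the two edges
      have h1 := nor_edge_neg H hij hi (s := 1) (Or.inl rfl)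
      have h2 := nor_edge_neg H hij hi (s := -1) (Or.inr rfl)
      set x := B.nor j (B.free - B.nor i B.free • B.push i (B.edge i 1)) with hx
      set y := B.nor j (B.free - B.nor i B.free • B.push i (B.edge i (-1))) with hy
      refine ⟨min (-x) (-y), lt_min (by linarith) (by linarith), fun c hc => ?_⟩
      obtain ⟨θ, ⟨h0, h1'⟩, rfl⟩ := hc.exists_combo H.painleve
      have : B.nor j (B.acc i ((1 - θ) • B.edge i (-1) + θ • B.edge i 1)) =
          (1 - θ) * y + θ * x := by
        simp only [Body.acc, min_eq_left hi, hx, hy, push_add, push_smul, nor_sub, nor_smul,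
          nor_add]
        ring
      rw [this]
      have hmx := min_le_left (-x) (-y)
      have hmy := min_le_right (-x) (-y)
      nlinarith [mul_nonneg h0 (sub_nonneg.2 hmx), mul_nonneg (sub_nonneg.2 h1') (sub_nonneg.2 hmy)]
    · -- contact `i` lifts off without any force, which only contact 2 can do
      have hi1 : i = 1 := by
        match i with
        | 0 => exact absurd H.free_neg (not_lt.2 hi.le)
        | 1 => rfl
      have hj0 : j = 0 := by
        match j with
        | 0 => rfl
        | 1 => exact absurd hi1 hij
      refine ⟨-B.nor 0 B.free, by linarith [H.free_neg], fun c _ => ?_⟩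
      rw [Body.acc, min_eq_right hi.le, zero_smul, sub_zero, hj0]
      linarith
  obtain ⟨β, hβ, h⟩ := key 0 1 (by decide)
  obtain ⟨γ, hγ, h'⟩ := key 1 0 (by decide)
  refine ⟨min β γ, lt_min hβ hγ, fun i j hij c hc => ?_⟩
  match i, j with
  | 0, 1 => linarith [h c hc, min_le_left β γ]
  | 1, 0 => linarith [h' c hc, min_le_right β γ]
  | 0, 0 => exact absurd rfl hij
  | 1, 1 => exact absurd rfl hij

lemma nor_acc_neg (H : B.Regular) {i j : Fin 2} (hij : i ≠ j) {c : ℝ × ℝ} (hc : B.UnitCone i c) :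
    B.nor j (B.acc i c) < 0 := by
  obtain ⟨β, hβ, h⟩ := nor_acc_le H
  linarith [h i j hij c hc]

lemma nor_acc_self {i : Fin 2} {c : ℝ × ℝ} (hc : B.UnitCone i c) :
    B.nor i (B.acc i c) = max (B.nor i B.free) 0 := by
  rw [Body.acc, nor_sub, nor_smul, hc.1]
  have := min_add_max (B.nor i B.free) 0
  linarith

lemma acc_norm_le (hp : B.PainleveFree) : ∃ C > 0, ∀ i c, B.UnitCone i c → ‖B.acc i c‖ ≤ C := by
  obtain ⟨C, hC, h⟩ := unitCone_norm_le hp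
  refine ⟨‖B.free‖ + (|min (B.nor 0 B.free) 0| + |min (B.nor 1 B.free) 0|) * C + 1, by positivity,
    fun i c hc => ?_⟩
  have h1 := (h i c hc).2
  have h2 : ‖B.acc i c‖ ≤ ‖B.free‖ + |min (B.nor i B.free) 0| * C := by
    refine (norm_sub_le _ _).trans ?_
    rw [norm_smul, Real.norm_eq_abs]
    gcongr
  have h3 : |min (B.nor i B.free) 0| ≤ |min (B.nor 0 B.free) 0| + |min (B.nor 1 B.free) 0| := by
    match i with
    | 0 => linarith [abs_nonneg (min (B.nor 1 B.free) 0)]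
    | 1 => linarith [abs_nonneg (min (B.nor 0 B.free) 0)]
  nlinarith [mul_le_mul_of_nonneg_right h3 hC.le]

/-! ### Slip at both contacts -/

/-- The sign of `cos φᵢ`: whether contact `i` slips in the same sense as the body. -/
noncomputable def Body.dir (B : Body) (i : Fin 2) : ℝ := if 0 < Real.cos (B.φ i) then 1 else -1

/-- Direction of the slipping friction force at contact `i` while both contacts are closed and
the body moves in the horizontal direction `σ = ±1`. -/
noncomputable def Body.slipRay (B : Body) (i : Fin 2) (σ : ℝ) : ℝ × ℝ :=
  (1, -(σ * B.dir i) * B.μ i)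

/-- The total acceleration under slipping forces of normal components `l`. -/
noncomputable def Body.slipAcc (B : Body) (σ : ℝ) (l : Fin 2 → ℝ) : Config :=
  B.free + (B.push 0 (l 0 • B.slipRay 0 σ) + B.push 1 (l 1 • B.slipRay 1 σ))

lemma dir_sign (i : Fin 2) : B.dir i = 1 ∨ B.dir i = -1 := by
  rw [Body.dir]; split_ifs <;> simp

lemma dir_mul_cos_pos (hc : ∀ i, Real.cos (B.φ i) ≠ 0) (i : Fin 2) :
    0 < B.dir i * Real.cos (B.φ i) := by
  rw [Body.dir]
  split_ifs with h
  · simpa using h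
  · have := lt_of_le_of_ne (not_lt.1 h) (hc i)
    linarith

lemma neg_mul_dir_sign {σ : ℝ} (hσ : σ = 1 ∨ σ = -1) (i : Fin 2) :
    -(σ * B.dir i) = 1 ∨ -(σ * B.dir i) = -1 := by
  rcases hσ with rfl | rfl <;> rcases dir_sign (B := B) i with h | h <;> rw [h] <;> norm_num

lemma edge_eq_slipRay (i : Fin 2) (σ : ℝ) :
    B.edge i (-(σ * B.dir i)) =
      (1 / (B.nn i + -(σ * B.dir i) * B.μ i * B.nt i)) • B.slipRay i σ := rfl

lemma slipRay_cone {σ : ℝ} (hσ : σ = 1 ∨ σ = -1) (i : Fin 2) {r : ℝ} (hr : 0 ≤ r) :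
    |(r • B.slipRay i σ).2| ≤ B.μ i * (r • B.slipRay i σ).1 := by
  have : |-(σ * B.dir i)| = 1 := by
    rcases neg_mul_dir_sign (B := B) hσ i with h | h <;> rw [h] <;> simp
  simp only [Body.slipRay, Prod.smul_fst, Prod.smul_snd, smul_eq_mul, mul_one]
  rw [abs_mul, abs_mul, this, abs_of_nonneg hr, abs_of_nonneg (B.μ_nonneg i)]
  apply le_of_eq; ring

lemma coulomb_slipRay (hc : ∀ i, Real.cos (B.φ i) ≠ 0) {σ : ℝ} (hσ : σ = 1 ∨ σ = -1)
    (i : Fin 2) (r : ℝ) {u : ℝ} (hu : 0 ≤ σ * u) :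
    B.Coulomb i (r • B.slipRay i σ) (u / Real.cos (B.φ i)) := by
  have h1 := dir_mul_cos_pos hc i
  rcases eq_or_lt_of_le hu with h0 | h0
  · have : u = 0 := by rcases hσ with rfl | rfl <;> linarith
    rw [this, zero_div]; exact coulomb_zero _ _
  · have h2 : u / Real.cos (B.φ i) = (σ * B.dir i) *
        (σ * u / (B.dir i * Real.cos (B.φ i))) := by
      have := hc i
      rcases hσ with rfl | rfl <;> rcases dir_sign (B := B) i with h | h <;> rw [h] <;> field_simp
    have h3 : 0 < σ * u / (B.dir i * Real.cos (B.φ i)) := div_pos h0 h1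
    rw [h2]
    rcases neg_mul_dir_sign (B := B) hσ i with h | h
    · have h4 : σ * B.dir i = -1 := by linarith
      rw [coulomb_neg (by rw [h4]; linarith)]
      simp [Body.slipRay, h4]; ring
    · have h4 : σ * B.dir i = 1 := by linarith
      rw [coulomb_pos (by rw [h4]; linarith)]
      simp [Body.slipRay, h4]; ring

lemma eq_slipRay_of_coulomb (hc : ∀ i, Real.cos (B.φ i) ≠ 0) {σ : ℝ} (hσ : σ = 1 ∨ σ = -1)
    {i : Fin 2} {c : ℝ × ℝ} {u : ℝ} (hu : 0 < σ * u)
    (h : B.Coulomb i c (u / Real.cos (B.φ i))) : c = c.1 • B.slipRay i σ := by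
  have h1 := dir_mul_cos_pos hc i
  have h2 : u / Real.cos (B.φ i) = (σ * B.dir i) *
      (σ * u / (B.dir i * Real.cos (B.φ i))) := by
    have := hc i
    rcases hσ with rfl | rfl <;> rcases dir_sign (B := B) i with h | h <;> rw [h] <;> field_simp
  have h3 : 0 < σ * u / (B.dir i * Real.cos (B.φ i)) := div_pos hu h1
  rw [h2] at h
  rcases neg_mul_dir_sign (B := B) hσ i with h' | h'
  · have h4 : σ * B.dir i = -1 := by linarith
    rw [coulomb_neg (by rw [h4]; linarith)] at h
    ext <;> simp [Body.slipRay, h4, h]; ring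
  · have h4 : σ * B.dir i = 1 := by linarith
    rw [coulomb_pos (by rw [h4]; linarith)] at h
    ext <;> simp [Body.slipRay, h4, h]; ring

lemma nor_slipAcc (σ : ℝ) (l : Fin 2 → ℝ) (i : Fin 2) :
    B.nor i (B.slipAcc σ l) = B.nor i B.free +
      (l 0 * B.nor i (B.push 0 (B.slipRay 0 σ)) + l 1 * B.nor i (B.push 1 (B.slipRay 1 σ))) := by
  simp only [Body.slipAcc, nor_add, push_smul, nor_smul]

lemma slipRay_self_pos (hp : B.PainleveFree) {σ : ℝ} (hσ : σ = 1 ∨ σ = -1) (i : Fin 2) :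
    0 < B.nor i (B.push i (B.slipRay i σ)) := by
  have := edge_den_pos hp i (neg_mul_dir_sign (B := B) hσ i)
  rw [nor_push_self]
  simp only [Body.slipRay]
  linarith

/-- The mode in which both contacts slip, in the horizontal direction `σ`. -/
noncomputable def Body.slipMode (B : Body) (σ : ℝ) (i : Fin 2) : Mode :=
  if σ * B.dir i = 1 then .P else .N

lemma slipMode_feasible (hc : ∀ i, Real.cos (B.φ i) ≠ 0) {σ : ℝ} (hσ : σ = 1 ∨ σ = -1) :
    B.FeasibleDoubleSlip (B.slipMode σ) := by
  have key : ∀ m : Fin 2 → Mode, m = ![m 0, m 1] := fun m => by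
    ext i; match i with
    | 0 => rfl
    | 1 => rfl
  rw [key (B.slipMode σ)]
  unfold Body.FeasibleDoubleSlip Body.slipMode Body.dir
  rcases lt_or_gt_of_ne (hc 0) with h0 | h0 <;> rcases lt_or_gt_of_ne (hc 1) with h1 | h1
  · left; refine ⟨mul_pos_of_neg_of_neg h0 h1, ?_⟩
    rw [if_neg h0.not_gt, if_neg h1.not_gt]
    rcases hσ with rfl | rfl <;> norm_num
  · right; refine ⟨mul_neg_of_neg_of_pos h0 h1, ?_⟩
    rw [if_neg h0.not_gt, if_pos h1]
    rcases hσ with rfl | rfl <;> norm_num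
  · right; refine ⟨mul_neg_of_pos_of_neg h0 h1, ?_⟩
    rw [if_pos h0, if_neg h1.not_gt]
    rcases hσ with rfl | rfl <;> norm_num
  · left; refine ⟨mul_pos h0 h1, ?_⟩
    rw [if_pos h0, if_pos h1]
    rcases hσ with rfl | rfl <;> norm_num

lemma solvesMode_slip {σ : ℝ} (hσ : σ = 1 ∨ σ = -1) {f : Fin 2 → Vec} :
    B.SolvesMode (B.slipMode σ) f ↔ ∀ i, B.nor i (B.accel f) = 0 ∧
      B.comps i (f i) = (B.comps i (f i)).1 • B.slipRay i σ := by
  refine forall_congr' fun i => ?_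
  rw [Body.slipMode]
  split_ifs with h
  · simp only [Mode.Equalities, Body.slipRay, h]
    refine and_congr_right fun _ => ⟨fun h' => Prod.ext (by simp) (by simp [h']; ring), fun h' => ?_⟩
    have := congrArg Prod.snd h'
    simp at this; linarith
  · have h : σ * B.dir i = -1 := by
      rcases neg_mul_dir_sign (B := B) hσ i with h' | h'
      · linarith
      · exact absurd (by linarith) h
    simp only [Mode.Equalities, Body.slipRay, h]
    refine and_congr_right fun _ => ⟨fun h' => Prod.ext (by simp) (by simp [h']; ring), fun h' => ?_⟩
    have := congrArg Prod.snd h'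
    simp at this; linarith

/-- With both contacts slipping, the contact forces are positive and the body decelerates. -/
lemma exists_slip (H : B.Regular) {σ : ℝ} (hσ : σ = 1 ∨ σ = -1) :
    ∃ l : Fin 2 → ℝ, (∀ i, 0 < l i) ∧ (∀ i, B.nor i (B.slipAcc σ l) = 0) ∧
      σ * B.hor (B.slipAcc σ l) < 0 := by
  have hfeas := slipMode_feasible H.cos_ne hσ
  obtain ⟨⟨f, hf, hfu⟩, hpos⟩ := H.persistent.doubleSlip _ hfeas
  have hfp := hpos f hf
  have hf' := (solvesMode_slip hσ).1 hf
  set l : Fin 2 → ℝ := fun i => (B.comps i (f i)).1 with hl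
  have hacc : B.accel f = B.slipAcc σ l := by
    rw [accel_eq, jump_eq, (hf' 0).2, (hf' 1).2]; rfl
  have hnor : ∀ i, B.nor i (B.slipAcc σ l) = 0 := fun i => by rw [← hacc]; exact (hf' i).1
  refine ⟨l, hfp, hnor, ?_⟩
  set a := B.slipAcc σ l with ha
  have htan : ∀ i, B.tan i a = B.hor a / Real.cos (B.φ i) := fun i =>
    tan_eq_hor_div H.cos_ne (hnor i)
  have hne : B.hor a ≠ 0 := by
    intro h0
    have := H.slip _ hfeas f hf
    rw [hacc, htan, h0, zero_div] at this
    exact this rfl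
  -- otherwise the slip accelerates, and the mode would be consistent at the equilibrium
  by_contra hcon
  push Not at hcon
  have hgt : 0 < σ * B.hor a := lt_of_le_of_ne hcon (by
    intro h; rcases hσ with rfl | rfl <;> exact hne (by linarith))
  refine H.persistent.nonAmbiguous.2 (B.slipMode σ) ?_ ⟨?_, f, ⟨hf, ?_⟩, fun f' hf' => hfu f' hf'.1⟩
  · intro h
    have := congrFun h 0
    simp only [Body.slipMode, modeSS] at this
    split_ifs at this <;> simp at this
  · intro i
    rw [Body.slipMode]
    split_ifs <;> simp [Mode.Admissible]
  · intro i
    have hd := dir_mul_cos_pos H.cos_ne i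
    have hq : 0 < σ * B.hor a / (B.dir i * Real.cos (B.φ i)) := div_pos hgt hd
    have h2 : B.hor a / Real.cos (B.φ i) = (σ * B.dir i) *
        (σ * B.hor a / (B.dir i * Real.cos (B.φ i))) := by
      have := H.cos_ne i
      rcases hσ with rfl | rfl <;> rcases dir_sign (B := B) i with h | h <;> rw [h] <;> field_simp
    rw [hacc, Body.slipMode]
    split_ifs with h
    · refine ⟨hfp i, fun _ => ?_⟩
      rw [htan, h2, h]; linarith
    · have h : σ * B.dir i = -1 := by
        rcases neg_mul_dir_sign (B := B) hσ i with h' | h'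
        · linarith
        · exact absurd (by linarith) h
      refine ⟨hfp i, fun _ => ?_⟩
      rw [htan, h2, h]; linarith

/-- The matrix of normal responses to slipping forces is a `P`-matrix: the determinant is positive
because positive forces `l` close both contacts while the force at contact 1 alone pulls contact 2
down. -/
lemma slip_det_pos (H : B.Regular) {σ : ℝ} (hσ : σ = 1 ∨ σ = -1) :
    0 < B.nor 0 (B.push 0 (B.slipRay 0 σ)) * B.nor 1 (B.push 1 (B.slipRay 1 σ)) -
      B.nor 0 (B.push 1 (B.slipRay 1 σ)) * B.nor 1 (B.push 0 (B.slipRay 0 σ)) := by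
  obtain ⟨l, hl, hn, -⟩ := exists_slip H hσ
  have h0 := hn 0
  have h1 := hn 1
  rw [nor_slipAcc] at h0 h1
  have hA := slipRay_self_pos H.painleve hσ 0
  have hE := nor_edge_neg H (i := 0) (j := 1) (by decide) H.free_neg.le
    (neg_mul_dir_sign (B := B) hσ 0)
  have hA' : B.nor 0 (B.push 0 (B.slipRay 0 σ)) = B.nn 0 + -(σ * B.dir 0) * B.μ 0 * B.nt 0 := by
    rw [nor_push_self]; simp only [Body.slipRay]; ring
  rw [edge_eq_slipRay, ← hA', push_smul, nor_sub, nor_smul, nor_smul] at hE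
  set A := B.nor 0 (B.push 0 (B.slipRay 0 σ))
  set b := B.nor 0 (B.push 1 (B.slipRay 1 σ))
  set c := B.nor 1 (B.push 0 (B.slipRay 0 σ))
  set d := B.nor 1 (B.push 1 (B.slipRay 1 σ))
  set g := B.nor 0 B.free
  set k := B.nor 1 B.free
  have h2 : l 1 * (A * d - b * c) = -(A * (k - g * (1 / A * c))) := by
    field_simp
    linear_combination A * h1 - c * h0
  have h3 : 0 < l 1 * (A * d - b * c) := by
    rw [h2]; nlinarith
  exact pos_of_mul_pos_right h3 (hl 1).le

/-- The forces with which both contacts slip and remain closed are unique. -/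
lemma slipAcc_unique (H : B.Regular) {σ : ℝ} (hσ : σ = 1 ∨ σ = -1) {l l' : Fin 2 → ℝ}
    (h : ∀ i, B.nor i (B.slipAcc σ l) = 0) (h' : ∀ i, B.nor i (B.slipAcc σ l') = 0) : l = l' := by
  have hd := slip_det_pos H hσ
  have e0 := h 0
  have e1 := h 1
  have e0' := h' 0
  have e1' := h' 1
  rw [nor_slipAcc] at e0 e1 e0' e1'
  set A := B.nor 0 (B.push 0 (B.slipRay 0 σ))
  set b := B.nor 0 (B.push 1 (B.slipRay 1 σ))
  set c := B.nor 1 (B.push 0 (B.slipRay 0 σ))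
  set d := B.nor 1 (B.push 1 (B.slipRay 1 σ))
  ext i
  match i with
  | 0 =>
    have : (A * d - b * c) * (l 0 - l' 0) = 0 := by
      linear_combination d * (e0 - e0') - b * (e1 - e1')
    exact sub_eq_zero.1 ((mul_eq_zero.1 this).resolve_left hd.ne')
  | 1 =>
    have : (A * d - b * c) * (l 1 - l' 1) = 0 := by
      linear_combination A * (e1 - e1') - c * (e0 - e0')
    exact sub_eq_zero.1 ((mul_eq_zero.1 this).resolve_left hd.ne')

/-- Static contact forces exist. -/
lemma exists_static (H : B.Regular) :
    ∃ f, B.accel f = 0 ∧ ∀ i, 0 ≤ (B.comps i (f i)).1 ∧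
      |(B.comps i (f i)).2| ≤ B.μ i * (B.comps i (f i)).1 := by
  obtain ⟨f, hf, hf'⟩ := H.persistent.nonAmbiguous.1.2.nonempty
  refine ⟨f, ?_, fun i => ?_⟩
  · have key : ∀ i, B.nor i (B.accel f) = 0 ∧ B.tan i (B.accel f) = 0 := fun i => by
      have := hf i
      match i with
      | 0 => exact this
      | 1 => exact this
    refine config_eq_zero H.cos_ne (fun i => (key i).1) ?_
    have := cos_mul_tan (B := B) 0 (B.accel f)
    rw [(key 0).1, (key 0).2] at this
    linarith
  · have h : |(B.comps i (f i)).2| < B.μ i * (B.comps i (f i)).1 := by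
      have := hf' i
      match i with
      | 0 => exact this
      | 1 => exact this
    refine ⟨?_, h.le⟩
    by_contra hc
    push Not at hc
    have := mul_nonpos_of_nonneg_of_nonpos (B.μ_nonneg i) hc.le
    linarith [abs_nonneg (B.comps i (f i)).2]

/-! ### The acceleration is determined by the state -/

/-- The constant contact forces `f` comply with the contact laws for some time after the state
`(q, v)`. -/
def Body.LocalForce (B : Body) (q v : Config) (f : Fin 2 → Vec) : Prop :=
  ∃ η > (0 : ℝ), ∀ s : ℝ, 0 ≤ s → s < η →
    B.Complementarity (q + s • v + (s ^ 2 / 2) • B.accel f) (v + s • B.accel f) f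

lemma Body.LocalForce.compl {q v : Config} {f : Fin 2 → Vec} (h : B.LocalForce q v f) :
    ∃ η > (0 : ℝ), ∀ (i : Fin 2) (s : ℝ), 0 ≤ s → s < η → B.Compl i (B.comps i (f i))
      (B.nor i q + s * B.nor i v + s ^ 2 / 2 * B.nor i (B.accel f))
      (B.nor i v + s * B.nor i (B.accel f)) (B.tan i v + s * B.tan i (B.accel f)) := by
  obtain ⟨η, hη, h⟩ := h
  refine ⟨η, hη, fun i s h0 h1 => ?_⟩
  have := complementarity_iff_compl.1 (h s h0 h1) i
  simpa only [nor_add, nor_smul, tan_add, tan_smul] using this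

lemma Body.LocalForce.cone {q v : Config} {f : Fin 2 → Vec} (h : B.LocalForce q v f) (i : Fin 2) :
    0 ≤ (B.comps i (f i)).1 ∧ |(B.comps i (f i)).2| ≤ B.μ i * (B.comps i (f i)).1 ∧
    B.Coulomb i (B.comps i (f i)) (B.tan i v) ∧
    (B.tan i v = 0 → B.Coulomb i (B.comps i (f i)) (B.tan i (B.accel f))) := by
  obtain ⟨η, hη, h⟩ := h.compl
  have h0 := h i 0 le_rfl hη
  refine ⟨h0.1, h0.2.2.2.2.1, by simpa using h0.2.2.2.2.2, fun hT => ?_⟩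
  have h1 := (h i (η / 2) (by linarith) (by linarith)).2.2.2.2.2
  rw [hT, zero_add, coulomb_smul (by linarith)] at h1
  exact h1

lemma Body.LocalForce.feasible {q v : Config} {f : Fin 2 → Vec} (h : B.LocalForce q v f) :
    B.Feasible q v := by
  obtain ⟨η, hη, h⟩ := h.compl
  intro i
  have h0 := h i 0 le_rfl hη
  simp at h0
  exact ⟨h0.2.1, fun hz => (h0.2.2.2.1 hz).1⟩

lemma Body.LocalForce.open_contact {q v : Config} {f : Fin 2 → Vec} (h : B.LocalForce q v f)
    {i : Fin 2} (ho : 0 < B.nor i q ∨ 0 < B.nor i v) : B.comps i (f i) = 0 := by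
  have hcone := h.cone i
  have hfe := h.feasible i
  obtain ⟨η, hη, h⟩ := h.compl
  suffices h1 : (B.comps i (f i)).1 = 0 by
    rw [h1, mul_zero] at hcone
    exact Prod.ext h1 (abs_nonpos_iff.1 hcone.2.1)
  rcases eq_or_lt_of_le hfe.1 with hz | hz
  · have hv : 0 < B.nor i v := ho.resolve_left (by rw [← hz]; exact lt_irrefl _)
    set a := B.nor i (B.accel f)
    set s := min (η / 2) (B.nor i v / (|a| + 1)) with hs
    have hs0 : 0 < s := lt_min (by linarith) (by positivity)
    have h1 := (h i s hs0.le ((min_le_left _ _).trans_lt (by linarith))).2.2.1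
    rw [← hz] at h1
    have h2 : s * (|a| + 1) ≤ B.nor i v := by
      rw [← le_div_iff₀ (by positivity)]; exact min_le_right _ _
    have h3 : 0 < B.nor i v + s / 2 * a := by nlinarith [neg_abs_le a]
    have h4 : 0 < 0 + s * B.nor i v + s ^ 2 / 2 * a := by
      have := mul_pos hs0 h3
      nlinarith
    exact (mul_eq_zero.1 h1).resolve_right h4.ne'
  · have := (h i 0 le_rfl hη).2.2.1
    simp at this
    exact this.resolve_right hz.ne'

lemma Body.LocalForce.closed_contact {q v : Config} {f : Fin 2 → Vec} (h : B.LocalForce q v f)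
    {i : Fin 2} (hq : B.nor i q = 0) (hv : B.nor i v = 0) :
    0 ≤ B.nor i (B.accel f) ∧ (B.comps i (f i)).1 * B.nor i (B.accel f) = 0 := by
  obtain ⟨η, hη, h⟩ := h.compl
  have h1 := h i (η / 2) (by linarith) (by linarith)
  rw [hq, hv] at h1
  have hp : 0 < (η / 2) ^ 2 / 2 := by positivity
  have h2 := h1.2.1
  have h3 := h1.2.2.1
  simp only [mul_zero, add_zero, zero_add] at h2 h3
  refine ⟨nonneg_of_mul_nonneg_right h2 hp, ?_⟩
  have : (η / 2) ^ 2 / 2 * ((B.comps i (f i)).1 * B.nor i (B.accel f)) = 0 := by linarith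
  exact (mul_eq_zero.1 this).resolve_left hp.ne'

lemma unitCone_eq_of_coulomb (hp : B.PainleveFree) {i : Fin 2} {T : ℝ} (hT : T ≠ 0) {c d : ℝ × ℝ}
    (hc : B.UnitCone i c) (hd : B.UnitCone i d) (hcc : B.Coulomb i c T) (hdc : B.Coulomb i d T) :
    c = d := by
  have h1 : B.nn i * c.1 + B.nt i * c.2 = 1 := by rw [← nor_push_self]; exact hc.1
  have h2 : B.nn i * d.1 + B.nt i * d.2 = 1 := by rw [← nor_push_self]; exact hd.1
  rcases lt_or_gt_of_ne hT with h | h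
  · rw [coulomb_neg h] at hcc hdc
    have hD := edge_den_pos hp i (s := 1) (Or.inl rfl)
    rw [hcc] at h1; rw [hdc] at h2
    have : c.1 = d.1 := mul_left_cancel₀ hD.ne' (by linarith)
    exact Prod.ext this (by rw [hcc, hdc, this])
  · rw [coulomb_pos h] at hcc hdc
    have hD := edge_den_pos hp i (s := -1) (Or.inr rfl)
    rw [hcc] at h1; rw [hdc] at h2
    have : c.1 = d.1 := mul_left_cancel₀ hD.ne' (by linarith)
    exact Prod.ext this (by rw [hcc, hdc, this])

/-- With a closed contact `i` and no force at the other one, the acceleration is `B.acc i c`. -/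
lemma Body.LocalForce.single (H : B.Regular) {q v : Config} {f : Fin 2 → Vec}
    (h : B.LocalForce q v f) {i j : Fin 2} (hij : i ≠ j) (hq : B.nor i q = 0) (hv : B.nor i v = 0)
    (hj : B.comps j (f j) = 0) :
    ∃ c, B.UnitCone i c ∧ B.accel f = B.acc i c ∧ (B.nor i B.free < 0 →
      B.Coulomb i c (B.tan i v) ∧ (B.tan i v = 0 → B.Coulomb i c (B.tan i (B.accel f)))) := by
  obtain ⟨h1, h2, h3, h4⟩ := h.cone i
  obtain ⟨h5, h6⟩ := h.closed_contact hq hv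
  have hacc : B.accel f = B.free + B.push i (B.comps i (f i)) := by
    rw [accel_eq' hij, hj, push_zero, add_zero]; rfl
  set c := B.comps i (f i) with hc
  have hm := margin_pos H.painleve i
  have hle := margin_le i h2
  have hnor : B.nor i (B.accel f) = B.nor i B.free + B.nor i (B.push i c) := by
    rw [hacc, nor_add]
  rcases le_or_gt 0 (B.nor i B.free) with hg | hg
  · have hc1 : c.1 = 0 := by
      by_contra hne
      have hpos : 0 < c.1 := lt_of_le_of_ne h1 (Ne.symm hne)
      have := (mul_eq_zero.1 h6).resolve_left hne
      nlinarith [mul_pos hm hpos]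
    have hc0 : c = 0 := Prod.ext hc1 (by rw [hc1, mul_zero] at h2; exact abs_nonpos_iff.1 h2)
    refine ⟨B.edge i 1, unitCone_edge H.painleve i (Or.inl rfl), ?_, fun h => absurd h hg.not_gt⟩
    rw [hacc, hc0, push_zero, add_zero, Body.acc, min_eq_right hg, zero_smul, sub_zero]
  · have hc1 : c.1 ≠ 0 := by
      intro h0
      have hc0 : c = 0 := Prod.ext h0 (by rw [h0, mul_zero] at h2; exact abs_nonpos_iff.1 h2)
      rw [hnor, hc0, push_zero, nor_zero] at h5
      linarith
    have h7 := (mul_eq_zero.1 h6).resolve_left hc1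
    have h8 : B.nor i (B.push i c) = -B.nor i B.free := by linarith
    have hr : 0 < -B.nor i B.free := by linarith
    set r := -B.nor i B.free with hrdef
    have hcr : c = r • (r⁻¹ • c) := by rw [smul_smul, mul_inv_cancel₀ hr.ne', one_smul]
    refine ⟨r⁻¹ • c, ⟨?_, ?_⟩, ?_, fun _ => ⟨coulomb_smul_left _ h3, fun hT =>
      coulomb_smul_left _ (h4 hT)⟩⟩
    · rw [push_smul, nor_smul, h8, inv_mul_cancel₀ hr.ne']
    · simp only [Prod.smul_fst, Prod.smul_snd, smul_eq_mul]
      rw [abs_mul, abs_of_pos (inv_pos.2 hr)]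
      nlinarith [mul_le_mul_of_nonneg_left h2 (inv_pos.2 hr).le]
    · rw [hacc, Body.acc, min_eq_left hg.le]
      conv_lhs => rw [hcr, push_smul]
      rw [hrdef, neg_smul, sub_eq_add_neg]

/-- With both contacts closed, the body stays at rest or slips at both contacts. -/
lemma Body.LocalForce.double (H : B.Regular) {q v : Config} {f : Fin 2 → Vec}
    (h : B.LocalForce q v f) (hq : ∀ i, B.nor i q = 0) (hv : ∀ i, B.nor i v = 0) :
    (B.hor v = 0 → B.accel f = 0) ∧ ∀ σ : ℝ, (σ = 1 ∨ σ = -1) → 0 < σ * B.hor v →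
      ∃ l : Fin 2 → ℝ, B.accel f = B.slipAcc σ l ∧ ∀ i, B.nor i (B.slipAcc σ l) = 0 := by
  have hnor : ∀ i, B.nor i (B.accel f) = 0 := by
    have key : ∀ i j, i ≠ j → B.nor i (B.accel f) = 0 := by
      intro i j hij
      obtain ⟨h5, h6⟩ := h.closed_contact (hq i) (hv i)
      by_contra hne
      have hc1 := (mul_eq_zero.1 h6).resolve_right hne
      have h2 := (h.cone i).2.1
      have hc0 : B.comps i (f i) = 0 :=
        Prod.ext hc1 (by rw [hc1, mul_zero] at h2; exact abs_nonpos_iff.1 h2)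
      obtain ⟨c, hc, hacc, -⟩ := h.single H hij.symm (hq j) (hv j) hc0
      have := nor_acc_neg H hij.symm hc
      rw [← hacc] at this
      linarith
    intro i
    match i with
    | 0 => exact key 0 1 (by decide)
    | 1 => exact key 1 0 (by decide)
  have hslip : ∀ σ : ℝ, (∀ i, B.comps i (f i) = (B.comps i (f i)).1 • B.slipRay i σ) →
      B.accel f = B.slipAcc σ fun i => (B.comps i (f i)).1 := by
    intro σ hi
    rw [accel_eq, jump_eq, hi 0, hi 1]
    rfl
  refine ⟨fun hu => ?_, fun σ hσ hu => ⟨fun i => (B.comps i (f i)).1, ?_⟩⟩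
  · have hT : ∀ i, B.tan i v = 0 := fun i => by
      rw [tan_eq_hor_div H.cos_ne (hv i), hu, zero_div]
    -- a body that started to slip would decelerate
    by_contra hne
    have hua : B.hor (B.accel f) ≠ 0 := fun h0 => hne (config_eq_zero H.cos_ne hnor h0)
    obtain ⟨σ, hσ, hpos⟩ : ∃ σ : ℝ, (σ = 1 ∨ σ = -1) ∧ 0 < σ * B.hor (B.accel f) := by
      rcases lt_or_gt_of_ne hua with h0 | h0
      · exact ⟨-1, Or.inr rfl, by linarith⟩
      · exact ⟨1, Or.inl rfl, by linarith⟩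
    have hacc := hslip σ fun i => eq_slipRay_of_coulomb H.cos_ne hσ hpos (by
      rw [← tan_eq_hor_div H.cos_ne (hnor i)]
      exact (h.cone i).2.2.2 (hT i))
    obtain ⟨l, -, hl, hdec⟩ := exists_slip H hσ
    have hn := hnor
    rw [hacc] at hn hpos
    rw [slipAcc_unique H hσ hn hl] at hpos
    linarith
  · have hacc := hslip σ fun i => eq_slipRay_of_coulomb H.cos_ne hσ hu (by
      rw [← tan_eq_hor_div H.cos_ne (hv i)]
      exact (h.cone i).2.2.1)
    exact ⟨hacc, fun i => by rw [← hacc]; exact hnor i⟩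

/-- The contact laws determine the acceleration, although not the contact forces. -/
lemma Body.LocalForce.accel_unique (H : B.Regular) {q v : Config} {f f' : Fin 2 → Vec}
    (h : B.LocalForce q v f) (h' : B.LocalForce q v f') : B.accel f = B.accel f' := by
  have hcase : ∀ i, (0 < B.nor i q ∨ 0 < B.nor i v) ∨ (B.nor i q = 0 ∧ B.nor i v = 0) := by
    intro i
    obtain ⟨h1, h2⟩ := h.feasible i
    rcases eq_or_lt_of_le h1 with h3 | h3
    · rcases eq_or_lt_of_le (h2 h3.symm) with h4 | h4
      · exact Or.inr ⟨h3.symm, h4.symm⟩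
      · exact Or.inl (Or.inr h4)
    · exact Or.inl (Or.inl h3)
  have hsingle : ∀ i j, i ≠ j → B.nor i q = 0 → B.nor i v = 0 →
      (0 < B.nor j q ∨ 0 < B.nor j v) → B.accel f = B.accel f' := by
    intro i j hij hq hv hj
    obtain ⟨c, hc, hacc, hcc⟩ := h.single H hij hq hv (h.open_contact hj)
    obtain ⟨d, hd, hacc', hdc⟩ := h'.single H hij hq hv (h'.open_contact hj)
    rcases le_or_gt 0 (B.nor i B.free) with hg | hg
    · rw [hacc, hacc', Body.acc, Body.acc, min_eq_right hg, zero_smul, zero_smul]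
    · obtain ⟨h1, h2⟩ := hcc hg
      obtain ⟨h3, h4⟩ := hdc hg
      rcases eq_or_ne (B.tan i v) 0 with hT | hT
      · have e1 := h2 hT
        have e2 := h4 hT
        rw [hacc, Body.acc, min_eq_left hg.le] at e1
        rw [hacc', Body.acc, min_eq_left hg.le] at e2
        rw [hacc, hacc', unitCone_coulomb_unique H.painleve hg hc hd e1 e2]
      · rw [hacc, hacc', unitCone_eq_of_coulomb H.painleve hT hc hd h1 h3]
  rcases hcase 0 with h0 | ⟨h0, h0'⟩ <;> rcases hcase 1 with h1 | ⟨h1, h1'⟩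
  · rw [accel_eq, accel_eq f', jump_eq, jump_eq, h.open_contact h0, h.open_contact h1,
      h'.open_contact h0, h'.open_contact h1]
  · exact hsingle 1 0 (by decide) h1 h1' h0
  · exact hsingle 0 1 (by decide) h0 h0' h1
  · have hq : ∀ i, B.nor i q = 0 := fun i => by match i with | 0 => exact h0 | 1 => exact h1
    have hv : ∀ i, B.nor i v = 0 := fun i => by match i with | 0 => exact h0' | 1 => exact h1'
    obtain ⟨e1, e2⟩ := h.double H hq hv
    obtain ⟨e1', e2'⟩ := h'.double H hq hv
    rcases lt_trichotomy (B.hor v) 0 with hu | hu | hu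
    · obtain ⟨l, hl, hn⟩ := e2 (-1) (Or.inr rfl) (by linarith)
      obtain ⟨l', hl', hn'⟩ := e2' (-1) (Or.inr rfl) (by linarith)
      rw [hl, hl', slipAcc_unique H (Or.inr rfl) hn hn']
    · rw [e1 hu, e1' hu]
    · obtain ⟨l, hl, hn⟩ := e2 1 (Or.inl rfl) (by linarith)
      obtain ⟨l', hl', hn'⟩ := e2' 1 (Or.inl rfl) (by linarith)
      rw [hl, hl', slipAcc_unique H (Or.inl rfl) hn hn']

/-! ### Restriction, shift and concatenation of trajectories -/

/-- Induction over `[0, T)`: the property goes on for some time after each instant, and holds at each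
instant before which it always holds. -/
lemma real_induction {P : ℝ → Prop} {T : ℝ} (h0 : P 0)
    (hstep : ∀ t, 0 ≤ t → t < T → P t → ∃ η > 0, ∀ s, t ≤ s → s < t + η → s < T → P s)
    (hlim : ∀ t, 0 < t → t < T → (∀ s, 0 ≤ s → s < t → P s) → P t) :
    ∀ t, 0 ≤ t → t < T → P t := by
  by_contra hcon
  push Not at hcon
  obtain ⟨b, hb0, hbT, hb⟩ := hcon
  set S : Set ℝ := {t | 0 ≤ t ∧ t < T ∧ ¬ P t} with hS
  have hne : S.Nonempty := ⟨b, hb0, hbT, hb⟩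
  have hbdd : BddBelow S := ⟨0, fun t ht => ht.1⟩
  set a := sInf S with ha
  have ha0 : 0 ≤ a := le_csInf hne fun t ht => ht.1
  have hab : a ≤ b := csInf_le hbdd ⟨hb0, hbT, hb⟩
  have hlt : ∀ s, 0 ≤ s → s < a → P s := by
    intro s hs0 hsa
    by_contra hP
    exact absurd (csInf_le hbdd ⟨hs0, by linarith, hP⟩) (not_le.2 hsa)
  have hPa : P a := by
    rcases eq_or_lt_of_le ha0 with h | h
    · rw [← h]; exact h0
    · exact hlim a h (by linarith) hlt
  obtain ⟨η, hη, hη'⟩ := hstep a ha0 (by linarith) hPa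
  obtain ⟨s, hs, hsa⟩ := exists_lt_of_csInf_lt hne (show sInf S < a + η by linarith)
  exact hs.2.2 (hη' s (csInf_le hbdd hs) hsa hs.2.1)

lemma Body.IsTrajectory.mono {I I' : Set ℝ} {q v : ℝ → Config} (h : B.IsTrajectory I q v)
    (hI : I' ⊆ I) : B.IsTrajectory I' q v where
  continuousOn := h.continuousOn.mono hI
  motion t ht := by
    obtain ⟨η, hη, f, hf⟩ := h.motion t (hI ht)
    exact ⟨η, hη, f, fun s hs => hf s (hI hs)⟩
  impact t ht := h.impact t (hI ht)

lemma tendsto_shift {v : ℝ → Config} {t₀ t : ℝ} {w : Config} :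
    Tendsto (fun s => v (t₀ + s)) (𝓝[<] t) (𝓝 w) ↔ Tendsto v (𝓝[<] (t₀ + t)) (𝓝 w) := by
  have : map (fun s => t₀ + s) (𝓝[<] t) = 𝓝[<] (t₀ + t) := by simp
  rw [← this, tendsto_map'_iff]
  rfl

lemma Body.IsTrajectory.shift {T t₀ : ℝ} {q v : ℝ → Config}
    (h : B.IsTrajectory (Set.Ico 0 T) q v) (h0 : 0 ≤ t₀) :
    B.IsTrajectory (Set.Ico 0 (T - t₀)) (fun s => q (t₀ + s)) (fun s => v (t₀ + s)) where
  continuousOn := by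
    refine h.continuousOn.comp (by fun_prop) fun s hs => ?_
    exact ⟨by linarith [hs.1], by linarith [hs.2]⟩
  motion t ht := by
    obtain ⟨η, hη, f, hf⟩ := h.motion (t₀ + t) ⟨by linarith [ht.1], by linarith [ht.2]⟩
    refine ⟨η, hη, f, fun s hs h1 h2 => ?_⟩
    have := hf (t₀ + s) ⟨by linarith [hs.1], by linarith [hs.2]⟩ (by linarith) (by linarith)
    rwa [add_sub_add_left_eq_sub] at this
  impact t ht htp := by
    obtain ⟨w, hw, hi⟩ := h.impact (t₀ + t) ⟨by linarith [ht.1], by linarith [ht.2]⟩ (by linarith)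
    exact ⟨w, tendsto_shift.2 hw, hi⟩

lemma Body.IsTrajectory.localForce {T t : ℝ} {q v : ℝ → Config}
    (h : B.IsTrajectory (Set.Ico 0 T) q v) (ht : t ∈ Set.Ico 0 T) :
    ∃ η > 0, ∃ f, B.LocalForce (q t) (v t) f ∧ ∀ s, t ≤ s → s < t + η → s < T →
      v s = v t + (s - t) • B.accel f ∧
      q s = q t + (s - t) • v t + ((s - t) ^ 2 / 2) • B.accel f := by
  obtain ⟨η, hη, f, hf⟩ := h.motion t ht
  refine ⟨η, hη, f, ⟨min η (T - t), lt_min hη (by linarith [ht.2]), fun s h0 h1 => ?_⟩,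
    fun s h1 h2 h3 => ?_⟩
  · have h2 := h1.trans_le (min_le_left _ _)
    have h3 := h1.trans_le (min_le_right _ _)
    obtain ⟨e1, e2, e3⟩ := hf (t + s) ⟨by linarith [ht.1], by linarith⟩ (by linarith) (by linarith)
    rw [e1, e2, add_sub_cancel_left] at e3
    exact e3
  · obtain ⟨e1, e2, -⟩ := hf s ⟨by linarith [ht.1], h3⟩ h1 h2
    exact ⟨e1, e2⟩

lemma Body.IsTrajectory.feasible {T t : ℝ} {q v : ℝ → Config}
    (h : B.IsTrajectory (Set.Ico 0 T) q v) (ht : t ∈ Set.Ico 0 T) : B.Feasible (q t) (v t) := by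
  obtain ⟨_, _, _, hf, -⟩ := h.localForce ht
  exact hf.feasible

lemma feasible_iff_not_colliding {q v : Config} (hq : ∀ i, 0 ≤ B.nor i q) :
    B.Feasible q v ↔ ¬ B.Colliding q v := by
  simp only [Body.Feasible, Body.Colliding, not_exists, not_and, not_lt]
  exact ⟨fun h i => (h i).2, fun h i => ⟨hq i, h i⟩⟩

lemma Body.Impact.eq_of_feasible {q v w : Config} (h : B.Impact q v w) (hf : B.Feasible q v) :
    w = v := by
  rcases h with h | h
  · exact h.2
  · exact absurd h.1 ((feasible_iff_not_colliding fun i => (hf i).1).1 hf)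

lemma impact_self {q v : Config} (hf : B.Feasible q v) : B.Impact q v v :=
  Or.inl ⟨(feasible_iff_not_colliding fun i => (hf i).1).1 hf, rfl⟩

lemma Body.Impact.feasible {q v w : Config} (h : B.Impact q v w) (hq : ∀ i, 0 ≤ B.nor i q) :
    B.Feasible q w := by
  rcases h with ⟨h, rfl⟩ | ⟨-, g, hg, -⟩
  · exact (feasible_iff_not_colliding hq).2 h
  · exact fun i => ⟨hq i, fun h0 => ((hg.2 i).2.1 h0).1⟩

/-- The function that follows `f` before the time `T` and `g`, started afresh, from then on. -/
noncomputable def glue (T : ℝ) (f g : ℝ → Config) (t : ℝ) : Config :=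
  if t < T then f t else g (t - T)

lemma glue_of_lt {T t : ℝ} {f g : ℝ → Config} (h : t < T) : glue T f g t = f t := if_pos h

lemma glue_of_le {T t : ℝ} {f g : ℝ → Config} (h : T ≤ t) : glue T f g t = g (t - T) :=
  if_neg (not_lt.2 h)

lemma tendsto_glue_left {T t : ℝ} {f g : ℝ → Config} {l : Filter Config} (h : t ≤ T) :
    Tendsto (glue T f g) (𝓝[<] t) l ↔ Tendsto f (𝓝[<] t) l := by
  refine tendsto_congr' ?_
  filter_upwards [self_mem_nhdsWithin] with s hs
  exact glue_of_lt (lt_of_lt_of_le hs h)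

lemma tendsto_glue_right {T t : ℝ} {f g : ℝ → Config} {w : Config} (h : T < t) :
    Tendsto (glue T f g) (𝓝[<] t) (𝓝 w) ↔ Tendsto g (𝓝[<] (t - T)) (𝓝 w) := by
  have h1 : Tendsto (glue T f g) (𝓝[<] t) (𝓝 w) ↔
      Tendsto (fun s => glue T f g (T + s)) (𝓝[<] (t - T)) (𝓝 w) := by
    rw [tendsto_shift]; simp
  rw [h1]
  refine tendsto_congr' ?_
  filter_upwards [Ioo_mem_nhdsLT (show 0 < t - T by linarith)] with s hs
  rw [glue_of_le (by linarith [hs.1])]; simp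

/-- Trajectories can be joined by an impact. -/
lemma Body.IsTrajectory.glue {T : ℝ} (hT : 0 < T) {q v q' v' : ℝ → Config} {w : Config}
    {I' : Set ℝ} (hI : ∀ t ∈ I', 0 ≤ t)
    (h : B.IsTrajectory (Set.Ico 0 T) q v) (h' : B.IsTrajectory I' q' v')
    (hq : Tendsto q (𝓝[<] T) (𝓝 (q' 0))) (hv : Tendsto v (𝓝[<] T) (𝓝 w))
    (hi : B.Impact (q' 0) w (v' 0)) :
    B.IsTrajectory {t | 0 ≤ t ∧ (t < T ∨ t - T ∈ I')} (glue T q q') (glue T v v') where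
  continuousOn := by
    rintro t ⟨h0, ht⟩
    rcases lt_trichotomy t T with htT | rfl | htT
    · have hc := h.continuousOn t ⟨h0, htT⟩
      have hm : Set.Iio T ∈ 𝓝 t := Iio_mem_nhds htT
      have hmem : Set.Ico 0 T ∈ 𝓝[{t | 0 ≤ t ∧ (t < T ∨ t - T ∈ I')}] t := by
        filter_upwards [mem_nhdsWithin_of_mem_nhds hm, self_mem_nhdsWithin] with s hs hs'
        exact ⟨hs'.1, hs⟩
      refine (hc.mono_of_mem_nhdsWithin hmem).congr_of_eventuallyEq ?_ (glue_of_lt htT)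
      filter_upwards [mem_nhdsWithin_of_mem_nhds hm] with s hs
      exact glue_of_lt hs
    · have ht0 : (0 : ℝ) ∈ I' := by simpa using ht
      have hval : TwoContact.glue t q q' t = q' 0 := by rw [glue_of_le le_rfl, sub_self]
      have hsub : {s | 0 ≤ s ∧ (s < t ∨ s - t ∈ I')} ⊆ Set.Iio t ∪ {s | s - t ∈ I'} := by
        rintro s ⟨-, hs⟩; exact hs
      refine ContinuousWithinAt.mono (ContinuousWithinAt.union ?_ ?_) hsub
      · rw [ContinuousWithinAt, hval]
        exact (tendsto_glue_left le_rfl).2 hq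
      · have hc : ContinuousWithinAt (fun s => q' (s - t)) {s | s - t ∈ I'} t := by
          refine ContinuousWithinAt.comp (t := I') ?_ (by fun_prop) fun s hs => hs
          rw [sub_self]; exact h'.continuousOn 0 ht0
        refine hc.congr (fun s hs => ?_) (glue_of_le le_rfl)
        exact glue_of_le (by linarith [hI _ hs])
    · have ht' : t - T ∈ I' := ht.resolve_left htT.not_gt
      have hm : Set.Ioi T ∈ 𝓝 t := Ioi_mem_nhds htT
      have hc : ContinuousWithinAt (fun s => q' (s - T)) {s | s - T ∈ I'} t :=
        ContinuousWithinAt.comp (t := I') (h'.continuousOn _ ht') (by fun_prop) fun s hs => hs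
      have hmem : {s | s - T ∈ I'} ∈ 𝓝[{t | 0 ≤ t ∧ (t < T ∨ t - T ∈ I')}] t := by
        filter_upwards [mem_nhdsWithin_of_mem_nhds hm, self_mem_nhdsWithin] with s hs hs'
        exact hs'.2.resolve_left (not_lt.2 (le_of_lt hs))
      refine (hc.mono_of_mem_nhdsWithin hmem).congr_of_eventuallyEq ?_ (glue_of_le htT.le)
      filter_upwards [mem_nhdsWithin_of_mem_nhds hm] with s hs
      exact glue_of_le (le_of_lt hs)
  motion t ht := by
    rcases lt_or_ge t T with htT | htT
    · obtain ⟨η, hη, f, hf⟩ := h.motion t ⟨ht.1, htT⟩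
      refine ⟨min η (T - t), lt_min hη (by linarith), f, fun s hs h1 h2 => ?_⟩
      have h3 := h2.trans_le (add_le_add_right (min_le_left η (T - t)) t)
      have h4 := h2.trans_le (add_le_add_right (min_le_right η (T - t)) t)
      rw [glue_of_lt htT, glue_of_lt htT, glue_of_lt (by linarith), glue_of_lt (by linarith)]
      exact hf s ⟨hs.1, by linarith⟩ h1 h3
    · have ht' : t - T ∈ I' := ht.2.resolve_left (not_lt.2 htT)
      obtain ⟨η, hη, f, hf⟩ := h'.motion _ ht'
      refine ⟨η, hη, f, fun s hs h1 h2 => ?_⟩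
      rw [glue_of_le htT, glue_of_le htT, glue_of_le (by linarith), glue_of_le (by linarith)]
      have := hf (s - T) (hs.2.resolve_left (by linarith)) (by linarith) (by linarith)
      rwa [sub_sub_sub_cancel_right] at this
  impact t ht h0 := by
    rcases lt_trichotomy t T with htT | rfl | htT
    · obtain ⟨w', hw', hi'⟩ := h.impact t ⟨ht.1, htT⟩ h0
      refine ⟨w', (tendsto_glue_left htT.le).2 hw', ?_⟩
      rwa [glue_of_lt htT, glue_of_lt htT]
    · refine ⟨w, (tendsto_glue_left le_rfl).2 hv, ?_⟩
      rwa [glue_of_le le_rfl, glue_of_le le_rfl, sub_self]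
    · have ht' : t - T ∈ I' := ht.2.resolve_left htT.not_gt
      obtain ⟨w', hw', hi'⟩ := h'.impact _ ht' (by linarith)
      refine ⟨w', (tendsto_glue_right htT).2 hw', ?_⟩
      rwa [glue_of_le htT.le, glue_of_le htT.le]

lemma glue_domain {T T' : ℝ} (hT' : 0 ≤ T') :
    {t | 0 ≤ t ∧ (t < T ∨ t - T ∈ Set.Ico 0 T')} = Set.Ico 0 (T + T') := by
  ext t
  simp only [Set.mem_ofPred_eq, Set.mem_Ico]
  constructor
  · rintro ⟨h0, h | h⟩
    · exact ⟨h0, by linarith⟩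
    · exact ⟨h0, by linarith⟩
  · rintro ⟨h0, h⟩
    rcases lt_or_ge t T with h1 | h1
    · exact ⟨h0, Or.inl h1⟩
    · exact ⟨h0, Or.inr ⟨by linarith, by linarith⟩⟩

/-! ### Flights: motion without collisions -/

/-- A motion of duration `T > 0` without jumps of the velocity, which leads from the state
`(q₀, v₀)` to the state `(q₁, v₁)`, possibly a colliding one. `A` bounds the acceleration. -/
def Body.ProperFlight (B : Body) (A T : ℝ) (q₀ v₀ q₁ v₁ : Config) : Prop :=
  0 < T ∧ ∃ q v : ℝ → Config, B.IsTrajectory (Set.Ico 0 T) q v ∧ ContinuousOn v (Set.Ico 0 T) ∧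
    q 0 = q₀ ∧ v 0 = v₀ ∧ Tendsto q (𝓝[<] T) (𝓝 q₁) ∧ Tendsto v (𝓝[<] T) (𝓝 v₁) ∧
    ∀ t ∈ Set.Ico 0 T, ‖v t - v₀‖ ≤ A * t

/-- A flight of duration `T ≥ 0`. -/
def Body.Flight (B : Body) (A T : ℝ) (q₀ v₀ q₁ v₁ : Config) : Prop :=
  (T = 0 ∧ q₁ = q₀ ∧ v₁ = v₀) ∨ B.ProperFlight A T q₀ v₀ q₁ v₁

lemma Body.Flight.proper {A T : ℝ} {q₀ v₀ q₁ v₁ : Config} (h : B.Flight A T q₀ v₀ q₁ v₁)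
    (hT : 0 < T) : B.ProperFlight A T q₀ v₀ q₁ v₁ :=
  h.resolve_left fun h => hT.ne' h.1

/-- Motion under constant contact forces. -/
lemma flight_const {A T : ℝ} {q₀ v₀ : Config} (f : Fin 2 → Vec) (hT : 0 ≤ T)
    (hA : ‖B.accel f‖ ≤ A)
    (hf : ∀ s, 0 ≤ s → s < T →
      B.Complementarity (q₀ + s • v₀ + (s ^ 2 / 2) • B.accel f) (v₀ + s • B.accel f) f) :
    B.Flight A T q₀ v₀ (q₀ + T • v₀ + (T ^ 2 / 2) • B.accel f) (v₀ + T • B.accel f) := by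
  rcases eq_or_lt_of_le hT with rfl | hT
  · exact Or.inl ⟨rfl, by simp, by simp⟩
  set a := B.accel f with ha
  have hcq : Continuous fun s : ℝ => q₀ + s • v₀ + (s ^ 2 / 2) • a := by fun_prop
  have hcv : Continuous fun s : ℝ => v₀ + s • a := by fun_prop
  refine Or.inr ⟨hT, fun s => q₀ + s • v₀ + (s ^ 2 / 2) • a, fun s => v₀ + s • a, ?_,
    hcv.continuousOn, by simp, by simp, (hcq.tendsto T).mono_left nhdsWithin_le_nhds,
    (hcv.tendsto T).mono_left nhdsWithin_le_nhds, fun t ht => ?_⟩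
  · refine ⟨hcq.continuousOn, fun t ht => ⟨1, one_pos, f, fun s hs h1 h2 => ⟨?_, ?_, ?_⟩⟩,
      fun t ht h0 => ⟨_, (hcv.tendsto t).mono_left nhdsWithin_le_nhds, ?_⟩⟩
    · rw [← ha]; module
    · rw [← ha]; module
    · exact hf s hs.1 hs.2
    · refine impact_self fun i => ?_
      have := hf t ht.1 ht.2 i
      exact ⟨this.1.2.1, fun h => (this.2.1 h).1⟩
  · rw [add_sub_cancel_left, norm_smul, Real.norm_eq_abs, abs_of_nonneg ht.1, mul_comm]
    exact mul_le_mul_of_nonneg_right hA ht.1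

lemma Body.Flight.trans {A T T' : ℝ} {q₀ v₀ q₁ v₁ q₂ v₂ : Config}
    (h : B.Flight A T q₀ v₀ q₁ v₁) (h' : B.Flight A T' q₁ v₁ q₂ v₂) :
    B.Flight A (T + T') q₀ v₀ q₂ v₂ := by
  rcases h with ⟨rfl, rfl, rfl⟩ | h
  · rwa [zero_add]
  rcases h' with ⟨rfl, rfl, rfl⟩ | h'
  · rw [add_zero]; exact Or.inr h
  obtain ⟨hT, q, v, htr, hcv, hq0, hv0, hq1, hv1, hsp⟩ := h
  obtain ⟨hT', q', v', htr', hcv', hq0', hv0', hq1', hv1', hsp'⟩ := h'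
  subst hq0' hv0'
  have hfe := htr'.feasible (t := 0) ⟨le_rfl, hT'⟩
  have hgl := htr.glue hT (fun t ht => ht.1) htr' hq1 hv1 (impact_self hfe)
  rw [glue_domain hT'.le] at hgl
  have hv1n : ‖v' 0 - v₀‖ ≤ A * T := by
    have h1 : Tendsto (fun t => ‖v t - v₀‖) (𝓝[<] T) (𝓝 ‖v' 0 - v₀‖) :=
      (hv1.sub_const v₀).norm
    have h2 : Tendsto (fun t : ℝ => A * t) (𝓝[<] T) (𝓝 (A * T)) :=
      (tendsto_id.const_mul A).mono_left nhdsWithin_le_nhds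
    refine le_of_tendsto_of_tendsto h1 h2 ?_
    filter_upwards [Ioo_mem_nhdsLT hT] with t ht
    exact hsp t ⟨ht.1.le, ht.2⟩
  refine Or.inr ⟨by linarith, _, _, hgl, ?_, ?_, ?_, ?_, ?_, ?_⟩
  · -- the velocity is continuous: at the junction its left limit is the new initial value
    intro t ht
    rcases lt_trichotomy t T with htT | rfl | htT
    · have hm : Set.Iio T ∈ 𝓝 t := Iio_mem_nhds htT
      have hmem : Set.Ico 0 T ∈ 𝓝[Set.Ico 0 (T + T')] t := by
        filter_upwards [mem_nhdsWithin_of_mem_nhds hm, self_mem_nhdsWithin] with s hs hs'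
        exact ⟨hs'.1, hs⟩
      refine ((hcv t ⟨ht.1, htT⟩).mono_of_mem_nhdsWithin hmem).congr_of_eventuallyEq ?_
        (glue_of_lt htT)
      filter_upwards [mem_nhdsWithin_of_mem_nhds hm] with s hs
      exact glue_of_lt hs
    · have hval : glue t v v' t = v' 0 := by rw [glue_of_le le_rfl, sub_self]
      have hsub : Set.Ico 0 (t + T') ⊆ Set.Iio t ∪ Set.Ico t (t + T') := by
        intro s hs
        rcases lt_or_ge s t with h | h
        · exact Or.inl h
        · exact Or.inr ⟨h, hs.2⟩
      refine ContinuousWithinAt.mono (ContinuousWithinAt.union ?_ ?_) hsub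
      · rw [ContinuousWithinAt, hval]
        exact (tendsto_glue_left le_rfl).2 hv1
      · have hc : ContinuousWithinAt (fun s => v' (s - t)) (Set.Ico t (t + T')) t := by
          refine ContinuousWithinAt.comp (t := Set.Ico 0 T') ?_ (by fun_prop) fun s hs =>
            ⟨by linarith [hs.1], by linarith [hs.2]⟩
          rw [sub_self]; exact hcv' 0 ⟨le_rfl, hT'⟩
        exact hc.congr (fun s hs => glue_of_le hs.1) (glue_of_le le_rfl)
    · have hm : Set.Ioi T ∈ 𝓝 t := Ioi_mem_nhds htT
      have hc : ContinuousWithinAt (fun s => v' (s - T)) (Set.Ico T (T + T')) t :=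
        ContinuousWithinAt.comp (t := Set.Ico 0 T')
          (hcv' _ ⟨by linarith, by linarith [ht.2]⟩) (by fun_prop) fun s hs =>
            ⟨by linarith [hs.1], by linarith [hs.2]⟩
      have hmem : Set.Ico T (T + T') ∈ 𝓝[Set.Ico 0 (T + T')] t := by
        filter_upwards [mem_nhdsWithin_of_mem_nhds hm, self_mem_nhdsWithin] with s hs hs'
        exact ⟨le_of_lt hs, hs'.2⟩
      refine (hc.mono_of_mem_nhdsWithin hmem).congr_of_eventuallyEq ?_ (glue_of_le htT.le)
      filter_upwards [mem_nhdsWithin_of_mem_nhds hm] with s hs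
      exact glue_of_le (le_of_lt hs)
  · rw [glue_of_lt hT, hq0]
  · rw [glue_of_lt hT, hv0]
  · rw [tendsto_glue_right (by linarith), add_sub_cancel_left]; exact hq1'
  · rw [tendsto_glue_right (by linarith), add_sub_cancel_left]; exact hv1'
  · intro t ht
    rcases lt_or_ge t T with h | h
    · rw [glue_of_lt h]; exact hsp t ⟨ht.1, h⟩
    · rw [glue_of_le h]
      have h1 := hsp' (t - T) ⟨by linarith, by linarith [ht.2]⟩
      have h2 := norm_add_le (v' (t - T) - v' 0) (v' 0 - v₀)
      rw [sub_add_sub_cancel] at h2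
      linarith

/-- Flights are deterministic: a trajectory follows the flight from its initial state. -/
lemma Body.IsTrajectory.eqOn (H : B.Regular) {T T' : ℝ} {q v Q V : ℝ → Config}
    (h : B.IsTrajectory (Set.Ico 0 T') q v) (hF : B.IsTrajectory (Set.Ico 0 T) Q V)
    (hV : ContinuousOn V (Set.Ico 0 T)) (hq0 : q 0 = Q 0) (hv0 : v 0 = V 0) :
    ∀ t, 0 ≤ t → t < min T T' → q t = Q t ∧ v t = V t := by
  refine real_induction ⟨hq0, hv0⟩ ?_ ?_
  · rintro t h0 hlt ⟨hqt, hvt⟩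
    have h1 := hlt.trans_le (min_le_left _ _)
    have h2 := hlt.trans_le (min_le_right _ _)
    obtain ⟨η, hη, f, hf, hm⟩ := h.localForce ⟨h0, h2⟩
    obtain ⟨η', hη', f', hf', hm'⟩ := hF.localForce ⟨h0, h1⟩
    rw [hqt, hvt] at hf
    have hacc := hf.accel_unique H hf'
    refine ⟨min η η', lt_min hη hη', fun s h3 h4 h5 => ?_⟩
    have h6 := min_le_left η η'
    have h7 := min_le_right η η'
    obtain ⟨e1, e2⟩ := hm s h3 (by linarith) (h5.trans_le (min_le_right _ _))
    obtain ⟨e1', e2'⟩ := hm' s h3 (by linarith) (h5.trans_le (min_le_left _ _))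
    rw [e1, e2, e1', e2', hqt, hvt, hacc]
    exact ⟨rfl, rfl⟩
  · intro t h0 hlt hs
    have h1 := hlt.trans_le (min_le_left _ _)
    have h2 := hlt.trans_le (min_le_right _ _)
    have hev : ∀ᶠ s in 𝓝[<] t, q s = Q s ∧ v s = V s := by
      filter_upwards [Ioo_mem_nhdsLT h0] with s hs'
      exact hs s hs'.1.le hs'.2
    have hle : 𝓝[<] t ≤ 𝓝[Set.Ico 0 T'] t :=
      nhdsWithin_le_of_mem (mem_of_superset (Ioo_mem_nhdsLT h0)
        fun s hs => ⟨hs.1.le, hs.2.trans h2⟩)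
    have hle' : 𝓝[<] t ≤ 𝓝[Set.Ico 0 T] t :=
      nhdsWithin_le_of_mem (mem_of_superset (Ioo_mem_nhdsLT h0)
        fun s hs => ⟨hs.1.le, hs.2.trans h1⟩)
    have hqq : q t = Q t := by
      have e1 : Tendsto q (𝓝[<] t) (𝓝 (q t)) := (h.continuousOn t ⟨h0.le, h2⟩).mono_left hle
      have e2 : Tendsto Q (𝓝[<] t) (𝓝 (Q t)) := (hF.continuousOn t ⟨h0.le, h1⟩).mono_left hle'
      exact tendsto_nhds_unique (e1.congr' (hev.mono fun s hs => hs.1)) e2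
    refine ⟨hqq, ?_⟩
    obtain ⟨w, hw, hi⟩ := h.impact t ⟨h0.le, h2⟩ h0
    have e2 : Tendsto V (𝓝[<] t) (𝓝 (V t)) := (hV t ⟨h0.le, h1⟩).mono_left hle'
    have hwV : w = V t := tendsto_nhds_unique (hw.congr' (hev.mono fun s hs => hs.2)) e2
    rw [hwV, hqq] at hi
    exact hi.eq_of_feasible (hF.feasible ⟨h0.le, h1⟩)

/-! ### Flights on one contact and free flights -/

lemma coulomb_edge (i : Fin 2) {s T : ℝ} (hs : s = 1 ∨ s = -1) (hT : s * T ≤ 0) :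
    B.Coulomb i (B.edge i s) T := by
  rw [Body.Coulomb, edge_snd]
  rcases hs with rfl | rfl
  · rw [abs_of_nonpos (by linarith)]; ring
  · rw [abs_of_nonneg (by linarith)]; ring

/-- Motion with contact `i` sustained (or contact `i` lifting, if the free acceleration takes it
away from its support) and the other contact `j` free. -/
lemma flight_phase (H : B.Regular) {i j : Fin 2} (hij : i ≠ j) {A t : ℝ} {q w : Config}
    {c : ℝ × ℝ} (hc : B.UnitCone i c) (ht : 0 ≤ t) (hA : ‖B.acc i c‖ ≤ A)
    (hneg : B.nor i B.free < 0 → B.nor i q = 0 ∧ B.nor i w = 0 ∧ B.Coulomb i c (B.tan i w) ∧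
      B.Coulomb i c (B.tan i (w + t • B.acc i c)))
    (hpos : 0 ≤ B.nor i B.free → 0 ≤ B.nor i q ∧ 0 ≤ B.nor i w)
    (hj : 0 ≤ B.nor j q) (hj' : B.nor j q = 0 → 0 ≤ B.nor j w)
    (hje : 0 ≤ B.nor j (q + t • w + (t ^ 2 / 2) • B.acc i c)) :
    B.Flight A t q w (q + t • w + (t ^ 2 / 2) • B.acc i c) (w + t • B.acc i c) := by
  set m := min (B.nor i B.free) 0 with hm
  set f : Fin 2 → Vec := fun k => if k = i then B.force i (-m • c) else 0 with hf
  have hfi : B.comps i (f i) = -m • c := by simp [hf]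
  have hfj : B.comps j (f j) = 0 := by rw [comps_eq_zero]; simp [hf, hij.symm]
  have hacc : B.accel f = B.acc i c := by
    rw [accel_eq' hij, hfi, hfj, push_zero, push_smul, Body.acc, Body.free]
    simp [sub_eq_add_neg, hm, Body.free]
  rw [← hacc]
  refine flight_const f ht (by rwa [hacc]) fun s h0 hst => ?_
  have ht0 : 0 < t := by linarith
  rw [complementarity_iff_compl, hacc]
  have hci : B.Compl i (B.comps i (f i)) (B.nor i (q + s • w + (s ^ 2 / 2) • B.acc i c))
      (B.nor i (w + s • B.acc i c)) (B.tan i (w + s • B.acc i c)) := by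
    rw [hfi]
    simp only [nor_add, nor_smul, nor_acc_self hc]
    rcases lt_or_ge (B.nor i B.free) 0 with hg | hg
    · obtain ⟨e1, e2, e3, e4⟩ := hneg hg
      rw [e1, e2, max_eq_right hg.le]
      have hm0 : 0 ≤ -m := by rw [hm, min_eq_left hg.le]; linarith
      refine ⟨?_, by simp, by simp, fun _ => by simp, ?_, coulomb_smul_left _ ?_⟩
      · exact mul_nonneg hm0 (hc.fst_pos H.painleve).le
      · simp only [Prod.smul_fst, Prod.smul_snd, smul_eq_mul]
        rw [abs_mul, abs_of_nonneg hm0]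
        nlinarith [mul_le_mul_of_nonneg_left hc.2 hm0]
      · have := coulomb_between (i := i) (c := c) (r := 1 - s / t) (s := s / t)
          (by rw [sub_nonneg, div_le_one ht0]; linarith) (by positivity) e3 e4
        convert this using 1
        simp only [tan_add, tan_smul]
        field_simp
        ring
    · obtain ⟨e1, e2⟩ := hpos hg
      rw [hm, min_eq_right hg, neg_zero, zero_smul, compl_zero, max_eq_left hg]
      exact ⟨by positivity, fun _ => by positivity⟩
  have hcj : B.Compl j (B.comps j (f j)) (B.nor j (q + s • w + (s ^ 2 / 2) • B.acc i c))
      (B.nor j (w + s • B.acc i c)) (B.tan j (w + s • B.acc i c)) := by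
    have ha := nor_acc_neg H hij hc
    rw [hfj, compl_zero]
    simp only [nor_add, nor_smul] at hje ⊢
    set a := B.nor j (B.acc i c)
    set z := B.nor j q
    set ζ := B.nor j w
    rcases eq_or_lt_of_le h0 with h | h
    · rw [← h]; simp; exact ⟨hj, hj'⟩
    · -- the normal distance is strictly concave and non-negative at both ends
      have hgap : 0 < z + s * ζ + s ^ 2 / 2 * a := by
        have h1 : t * (z + s * ζ + s ^ 2 / 2 * a) = (t - s) * z +
            s * (z + t * ζ + t ^ 2 / 2 * a) + (-a) / 2 * (t * s * (t - s)) := by ring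
        have h2 : 0 ≤ (t - s) * z := mul_nonneg (by linarith) hj
        have h3 : 0 ≤ s * (z + t * ζ + t ^ 2 / 2 * a) := mul_nonneg h0 hje
        have h4 : 0 < (-a) / 2 * (t * s * (t - s)) :=
          mul_pos (by linarith) (mul_pos (by positivity) (by linarith))
        exact pos_of_mul_pos_right (by linarith) ht0.le
      exact ⟨hgap.le, fun h => absurd h hgap.ne'⟩
  intro k
  by_cases hk : k = i
  · rw [hk]; exact hci
  · have : k = j := by omega
    rw [this]; exact hcj

/-- Velocity after two phases of durations `t` and `t'`, with contact `i` held by forces in the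
directions `c` and `c'`. -/
noncomputable def Body.legVel (B : Body) (i : Fin 2) (w : Config) (c c' : ℝ × ℝ) (t t' : ℝ) :
    Config :=
  w + t • B.acc i c + t' • B.acc i c'

/-- Configuration after the first phase. -/
noncomputable def Body.legMid (B : Body) (i : Fin 2) (q w : Config) (c : ℝ × ℝ) (t : ℝ) : Config :=
  q + t • w + (t ^ 2 / 2) • B.acc i c

/-- Configuration after both phases. -/
noncomputable def Body.legPos (B : Body) (i : Fin 2) (q w : Config) (c c' : ℝ × ℝ) (t t' : ℝ) :
    Config :=
  B.legMid i q w c t + t' • (w + t • B.acc i c) + (t' ^ 2 / 2) • B.acc i c'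

/-- A flight of contact `j` from the state `(q, w)` until it returns to its support, while contact
`i` is sustained and the friction force at `i` changes at most once. All conditions are closed:
this is what makes the set of cycles of the body compact. -/
structure Body.Leg (B : Body) (i j : Fin 2) (q w : Config) (c c' : ℝ × ℝ) (t t' : ℝ) : Prop where
  nonneg : 0 ≤ t
  nonneg' : 0 ≤ t'
  cone : B.UnitCone i c
  cone' : B.UnitCone i c'
  coulomb : B.nor i B.free < 0 → B.Coulomb i c (B.tan i w) ∧
    B.Coulomb i c (B.tan i (w + t • B.acc i c)) ∧ B.Coulomb i c' (B.tan i (w + t • B.acc i c)) ∧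
    B.Coulomb i c' (B.tan i (B.legVel i w c c' t t'))
  mid : 0 ≤ B.nor j (B.legMid i q w c t)
  land : B.nor j (B.legPos i q w c c' t t') = 0

lemma legMid_nor (i j : Fin 2) (q w : Config) (c : ℝ × ℝ) (t : ℝ) :
    B.nor j (B.legMid i q w c t) = B.nor j q + t * B.nor j w + t ^ 2 / 2 * B.nor j (B.acc i c) := by
  simp [Body.legMid]

lemma legPos_nor (i j : Fin 2) (q w : Config) (c c' : ℝ × ℝ) (t t' : ℝ) :
    B.nor j (B.legPos i q w c c' t t') = B.nor j (B.legMid i q w c t) +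
      t' * (B.nor j w + t * B.nor j (B.acc i c)) + t' ^ 2 / 2 * B.nor j (B.acc i c') := by
  simp [Body.legPos]; ring

lemma legVel_nor (i j : Fin 2) (w : Config) (c c' : ℝ × ℝ) (t t' : ℝ) :
    B.nor j (B.legVel i w c c' t t') =
      B.nor j w + t * B.nor j (B.acc i c) + t' * B.nor j (B.acc i c') := by
  simp [Body.legVel]

section Leg

variable {i j : Fin 2} {q w : Config} {c c' : ℝ × ℝ} {t t' : ℝ}

lemma Body.Leg.flight (H : B.Regular) (h : B.Leg i j q w c c' t t') (hij : i ≠ j) {A : ℝ}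
    (hA : ∀ c, B.UnitCone i c → ‖B.acc i c‖ ≤ A)
    (hiq : B.nor i q = 0) (hiw : B.nor i w = 0)
    (hj : 0 ≤ B.nor j q) (hj' : B.nor j q = 0 → 0 ≤ B.nor j w) :
    B.Flight A (t + t') q w (B.legPos i q w c c' t t') (B.legVel i w c c' t t') := by
  have ht := h.nonneg
  have ht' := h.nonneg'
  have h1 : B.Flight A t q w (B.legMid i q w c t) (w + t • B.acc i c) :=
    flight_phase H hij h.cone h.nonneg (hA c h.cone)
      (fun hg => ⟨hiq, hiw, (h.coulomb hg).1, (h.coulomb hg).2.1⟩)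
      (fun _ => ⟨hiq.ge, hiw.ge⟩) hj hj' h.mid
  refine h1.trans ?_
  rcases eq_or_lt_of_le h.nonneg' with h0 | h0
  · exact Or.inl ⟨h0.symm, by simp [Body.legPos, ← h0], by simp [Body.legVel, ← h0]⟩
  refine flight_phase H hij h.cone' h.nonneg' (hA c' h.cone') (fun hg => ⟨?_, ?_,
    (h.coulomb hg).2.2.1, (h.coulomb hg).2.2.2⟩) (fun hg => ⟨?_, ?_⟩) h.mid (fun hm => ?_) h.land.ge
  · rw [legMid_nor, hiq, hiw, nor_acc_self h.cone, max_eq_right hg.le]; ring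
  · rw [nor_add, nor_smul, hiw, nor_acc_self h.cone, max_eq_right hg.le]; ring
  · rw [legMid_nor, hiq, hiw, nor_acc_self h.cone, max_eq_left hg]; positivity
  · rw [nor_add, nor_smul, hiw, nor_acc_self h.cone, max_eq_left hg]; positivity
  · have hl := h.land
    rw [legPos_nor, hm, zero_add] at hl
    have ha := nor_acc_neg H hij h.cone'
    rw [nor_add, nor_smul]
    by_contra hcon
    push Not at hcon
    nlinarith [mul_pos h0 (neg_pos.2 hcon), mul_pos (pow_pos h0 2) (neg_pos.2 ha)]

lemma Body.Leg.duration_le (h : B.Leg i j q w c c' t t') {β : ℝ}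
    (hβ : ∀ c, B.UnitCone i c → B.nor j (B.acc i c) ≤ -β) :
    β / 2 * (t + t') ^ 2 ≤ B.nor j q + (t + t') * B.nor j w := by
  have hl := h.land
  have ht := h.nonneg
  have ht' := h.nonneg'
  rw [legPos_nor, legMid_nor] at hl
  have h1 := hβ c h.cone
  have h2 := hβ c' h.cone'
  nlinarith [mul_le_mul_of_nonneg_left h1 (by positivity : 0 ≤ t ^ 2 / 2 + t * t'),
    mul_le_mul_of_nonneg_left h2 (by positivity : 0 ≤ t' ^ 2 / 2)]

/-- The free contact lands with a negative normal velocity. -/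
lemma Body.Leg.land_neg (H : B.Regular) (h : B.Leg i j q w c c' t t') (hij : i ≠ j)
    (hT : 0 < t + t') (hj : 0 ≤ B.nor j q) : B.nor j (B.legVel i w c c' t t') < 0 := by
  have hl := h.land
  have hm := h.mid
  have ht := h.nonneg
  have ht' := h.nonneg'
  have h1 := nor_acc_neg H hij h.cone
  have h2 := nor_acc_neg H hij h.cone'
  rw [legPos_nor] at hl
  rw [legVel_nor]
  set a := B.nor j (B.acc i c)
  set a' := B.nor j (B.acc i c')
  rcases eq_or_lt_of_le ht' with h0 | h0
  · rw [← h0] at hl hT ⊢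
    rw [legMid_nor] at hl
    have ht0 : 0 < t := by linarith
    by_contra hcon
    push Not at hcon
    nlinarith [mul_nonneg ht hcon, mul_pos (pow_pos ht0 2) (neg_pos.2 h1)]
  · by_contra hcon
    push Not at hcon
    nlinarith [mul_nonneg ht' hcon, mul_pos (pow_pos h0 2) (neg_pos.2 h2)]

/-- A contact that starts from its support has to leave it with a positive velocity. -/
lemma Body.Leg.start_pos (H : B.Regular) (h : B.Leg i j q w c c' t t') (hij : i ≠ j)
    (hT : 0 < t + t') (hj : B.nor j q = 0) : 0 < B.nor j w := by
  obtain ⟨β, hβ, hle⟩ := nor_acc_le H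
  have := h.duration_le (β := β) fun c hc => hle i j hij c hc
  rw [hj, zero_add] at this
  exact pos_of_mul_pos_right (lt_of_lt_of_le (by positivity) this) hT.le

lemma Body.Leg.nor_self (h : B.Leg i j q w c c' t t') (hiq : B.nor i q = 0) (hiw : B.nor i w = 0) :
    B.nor i (B.legPos i q w c c' t t') = (t + t') ^ 2 / 2 * max (B.nor i B.free) 0 ∧
    B.nor i (B.legVel i w c c' t t') = (t + t') * max (B.nor i B.free) 0 := by
  rw [legPos_nor, legMid_nor, legVel_nor, hiq, hiw, nor_acc_self h.cone, nor_acc_self h.cone']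
  constructor <;> ring

/-- Legs are invariant under the scaling of velocities and durations. Only the normal distance of the
free contact matters of the configuration. -/
lemma Body.Leg.scale (h : B.Leg i j q w c c' t t') {r : ℝ} (hr : 0 < r) {q' : Config}
    (hq : B.nor j q' = r ^ 2 * B.nor j q) :
    B.Leg i j q' (r • w) c c' (r * t) (r * t') where
  nonneg := mul_nonneg hr.le h.nonneg
  nonneg' := mul_nonneg hr.le h.nonneg'
  cone := h.cone
  cone' := h.cone'
  coulomb hg := by
    obtain ⟨h1, h2, h3, h4⟩ := h.coulomb hg
    have e1 : r • w + (r * t) • B.acc i c = r • (w + t • B.acc i c) := by module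
    have e2 : B.legVel i (r • w) c c' (r * t) (r * t') = r • B.legVel i w c c' t t' := by
      simp only [Body.legVel]; module
    rw [e1, e2]
    simp only [tan_smul, coulomb_smul hr]
    exact ⟨h1, h2, h3, h4⟩
  mid := by
    have : B.nor j (B.legMid i q' (r • w) c (r * t)) = r ^ 2 * B.nor j (B.legMid i q w c t) := by
      rw [legMid_nor, legMid_nor, hq, nor_smul]; ring
    rw [this]; exact mul_nonneg (by positivity) h.mid
  land := by
    have : B.nor j (B.legPos i q' (r • w) c c' (r * t) (r * t')) =
        r ^ 2 * B.nor j (B.legPos i q w c c' t t') := by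
      rw [legPos_nor, legPos_nor, legMid_nor, legMid_nor, hq, nor_smul]; ring
    rw [this, h.land, mul_zero]

end Leg

/-- A strictly concave quadratic that starts upwards or from a positive value returns to zero. -/
lemma exists_root_of_neg {z v a : ℝ} (ha : a < 0) (hz : 0 ≤ z) (h : 0 < z ∨ 0 < v) :
    ∃ s > 0, z + s * v + s ^ 2 / 2 * a = 0 ∧ v + s * a < 0 ∧
      ∀ r, 0 < r → r < s → 0 < z + r * v + r ^ 2 / 2 * a := by
  have haz : 0 ≤ -a * z := mul_nonneg (by linarith) hz
  set D := v ^ 2 - 2 * a * z with hD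
  have hD0 : 0 < D := by
    rcases eq_or_lt_of_le hz with h0 | h0
    · have hv : 0 < v := h.resolve_left (by rw [← h0]; exact lt_irrefl _)
      rw [hD, ← h0]; nlinarith [pow_pos hv 2]
    · nlinarith [mul_pos (neg_pos.2 ha) h0, sq_nonneg v]
  have hsq : √D ^ 2 = D := Real.sq_sqrt hD0.le
  have hs0 : 0 < √D := Real.sqrt_pos.2 hD0
  set s := (v + √D) / (-a) with hs
  have hsa : s * a = -(v + √D) := by rw [hs]; have := ha.ne; field_simp
  have hnum : 0 < v + √D := by
    rcases eq_or_lt_of_le hz with h0 | h0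
    · have hv : 0 < v := h.resolve_left (by rw [← h0]; exact lt_irrefl _)
      linarith
    · have : v ^ 2 < √D ^ 2 := by rw [hsq]; nlinarith [mul_pos (neg_pos.2 ha) h0]
      have := abs_lt_of_sq_lt_sq this hs0.le
      linarith [(abs_lt.1 this).1]
  have hsp : 0 < s := div_pos hnum (by linarith)
  have hroot : z + s * v + s ^ 2 / 2 * a = 0 := by
    have h1 : 2 * a * (z + s * v + s ^ 2 / 2 * a) = (s * a + v) ^ 2 - D := by rw [hD]; ring
    rw [hsa] at h1
    have h2 : a * (z + s * v + s ^ 2 / 2 * a) = 0 := by nlinarith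
    exact (mul_eq_zero.1 h2).resolve_left ha.ne
  refine ⟨s, hsp, hroot, by rw [hsa]; linarith, fun r hr hrs => ?_⟩
  have h1 : s * (z + r * v + r ^ 2 / 2 * a) = (s - r) * z + r * (z + s * v + s ^ 2 / 2 * a) +
      (-a) / 2 * (s * r * (s - r)) := by ring
  rw [hroot, mul_zero, add_zero] at h1
  have h2 : 0 ≤ (s - r) * z := mul_nonneg (by linarith) hz
  have h3 : 0 < (-a) / 2 * (s * r * (s - r)) :=
    mul_pos (by linarith) (mul_pos (by positivity) (by linarith))
  exact pos_of_mul_pos_right (by linarith) hsp.le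

/-- With contact `i` sustained and contact `j` open, contact `j` returns to its support. -/
lemma exists_leg (H : B.Regular) {i j : Fin 2} (hij : i ≠ j) {q w : Config}
    (hj : 0 ≤ B.nor j q) (ho : 0 < B.nor j q ∨ 0 < B.nor j w) :
    ∃ c c' t t', B.Leg i j q w c c' t t' ∧ 0 < t + t' := by
  have single : ∀ c s, B.UnitCone i c → 0 < s →
      B.nor j q + s * B.nor j w + s ^ 2 / 2 * B.nor j (B.acc i c) = 0 →
      (B.nor i B.free < 0 → B.Coulomb i c (B.tan i w) ∧
        B.Coulomb i c (B.tan i (w + s • B.acc i c))) →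
      ∃ c c' t t', B.Leg i j q w c c' t t' ∧ 0 < t + t' := by
    intro c s hc hs h0 hcc
    refine ⟨c, c, s, 0, ⟨hs.le, le_rfl, hc, hc, fun hg => ?_, ?_, ?_⟩, by linarith⟩
    · obtain ⟨h1, h2⟩ := hcc hg
      exact ⟨h1, h2, h2, by simpa [Body.legVel] using h2⟩
    · rw [legMid_nor, h0]
    · rw [legPos_nor, legMid_nor, h0]; ring
  rcases le_or_gt 0 (B.nor i B.free) with hg | hg
  · have hc := unitCone_edge H.painleve i (s := 1) (Or.inl rfl)
    obtain ⟨s, hs, h0, -, -⟩ := exists_root_of_neg (nor_acc_neg H hij hc) hj ho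
    exact single _ s hc hs h0 fun h => absurd h hg.not_gt
  obtain ⟨d, hd, hdc⟩ := exists_unitCone_coulomb H.painleve i B.free
  have hda : B.Coulomb i d (B.tan i (B.acc i d)) := by
    rw [Body.acc, min_eq_left hg.le]; exact hdc
  rcases eq_or_ne (B.tan i w) 0 with hT | hT
  · obtain ⟨s, hs, h0, -, -⟩ := exists_root_of_neg (nor_acc_neg H hij hd) hj ho
    refine single d s hd hs h0 fun _ => ⟨by rw [hT]; exact coulomb_zero _ _, ?_⟩
    rw [tan_add, tan_smul, hT, zero_add, coulomb_smul hs]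
    exact hda
  obtain ⟨σ, hσ, hσT⟩ : ∃ σ : ℝ, (σ = 1 ∨ σ = -1) ∧ σ * B.tan i w < 0 := by
    rcases lt_or_gt_of_ne hT with h | h
    · exact ⟨1, Or.inl rfl, by linarith⟩
    · exact ⟨-1, Or.inr rfl, by linarith⟩
  set c := B.edge i σ with hcdef
  have hc : B.UnitCone i c := unitCone_edge H.painleve i hσ
  obtain ⟨s, hs, h0, -, hpos⟩ := exists_root_of_neg (nor_acc_neg H hij hc) hj ho
  rcases le_or_gt (σ * B.tan i (w + s • B.acc i c)) 0 with hend | hend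
  · exact single c s hc hs h0 fun _ => ⟨coulomb_edge i hσ hσT.le, coulomb_edge i hσ hend⟩
  · -- the contact stops slipping at the time `r`, before the other one lands
    set a := B.tan i (B.acc i c) with ha
    rw [tan_add, tan_smul, ← ha] at hend
    have hσa : 0 < σ * a := by
      have : 0 < s * (σ * a) := by nlinarith
      exact pos_of_mul_pos_right this hs.le
    have ha0 : a ≠ 0 := fun h => by simp [h] at hσa
    set r := -(σ * B.tan i w) / (σ * a) with hr
    have hr0 : 0 < r := div_pos (by linarith) hσa
    have hrs : r < s := by rw [hr, div_lt_iff₀ hσa]; nlinarith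
    have hrel : B.tan i (w + r • B.acc i c) = 0 := by
      have hσ0 : σ ≠ 0 := by rcases hσ with rfl | rfl <;> norm_num
      rw [tan_add, tan_smul, ← ha, hr]
      field_simp
      ring
    have hmid := hpos r hr0 hrs
    rw [← legMid_nor] at hmid
    obtain ⟨s', hs', h0', -, -⟩ := exists_root_of_neg (nor_acc_neg H hij hd) hmid.le
      (v := B.nor j (w + r • B.acc i c)) (Or.inl hmid)
    refine ⟨c, d, r, s', ⟨hr0.le, hs'.le, hc, hd, fun _ => ⟨coulomb_edge i hσ hσT.le, ?_, ?_, ?_⟩,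
      hmid.le, ?_⟩, by linarith⟩
    · rw [hrel]; exact coulomb_zero _ _
    · rw [hrel]; exact coulomb_zero _ _
    · rw [Body.legVel, tan_add, hrel, zero_add, tan_smul, coulomb_smul hs']
      exact hda
    · rw [legPos_nor, ← h0', nor_add, nor_smul]

/-- A quadratic that starts feasibly either remains so forever, or until it hits zero from above. -/
lemma quadratic_collision {z v a : ℝ} (hz : 0 ≤ z) (ho : 0 < z ∨ 0 < v) :
    (∀ r, 0 ≤ r → 0 ≤ z + r * v + r ^ 2 / 2 * a ∧
      (z + r * v + r ^ 2 / 2 * a = 0 → 0 ≤ v + r * a)) ∨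
    ∃ s > 0, z + s * v + s ^ 2 / 2 * a = 0 ∧ v + s * a < 0 ∧
      ∀ r, 0 ≤ r → r < s → 0 ≤ z + r * v + r ^ 2 / 2 * a ∧
        (z + r * v + r ^ 2 / 2 * a = 0 → 0 ≤ v + r * a) := by
  have hv0 : z = 0 → 0 < v := fun h => ho.resolve_left (by rw [h]; exact lt_irrefl _)
  rcases lt_or_ge a 0 with ha | ha
  · right
    obtain ⟨s, hs, h0, h1, h2⟩ := exists_root_of_neg ha hz ho
    refine ⟨s, hs, h0, h1, fun r hr hrs => ?_⟩
    rcases eq_or_lt_of_le hr with h | h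
    · rw [← h]; simpa using ⟨hz, fun h => (hv0 h).le⟩
    · exact ⟨(h2 r h hrs).le, fun h' => absurd h' (h2 r h hrs).ne'⟩
  rcases le_or_gt 0 v with hv | hv
  · left
    exact fun r hr => ⟨by positivity, fun _ => by positivity⟩
  have hzp : 0 < z := ho.resolve_right hv.not_gt
  set D := v ^ 2 - 2 * a * z with hD
  rcases le_or_gt D 0 with hD0 | hD0
  · left
    have ha0 : 0 < a := by
      rcases eq_or_lt_of_le ha with h | h
      · rw [← h] at hD; nlinarith [pow_pos (neg_pos.2 hv) 2]
      · exact h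
    intro r hr
    have hid : 2 * a * (z + r * v + r ^ 2 / 2 * a) = (v + r * a) ^ 2 - D := by rw [hD]; ring
    refine ⟨?_, fun h => ?_⟩
    · have : 0 ≤ 2 * a * (z + r * v + r ^ 2 / 2 * a) := by rw [hid]; nlinarith [sq_nonneg (v + r * a)]
      exact nonneg_of_mul_nonneg_right this (by linarith)
    · rw [h, mul_zero] at hid
      have : (v + r * a) ^ 2 = 0 := le_antisymm (by linarith) (sq_nonneg _)
      rw [pow_eq_zero_iff (by norm_num)] at this
      exact this.ge
  · right
    have hsq : √D ^ 2 = D := Real.sq_sqrt hD0.le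
    have hs0 : 0 < √D := Real.sqrt_pos.2 hD0
    set s := 2 * z / (√D - v) with hs
    have hden : 0 < √D - v := by linarith
    have hsp : 0 < s := by positivity
    have hsv : s * (√D - v) = 2 * z := by rw [hs]; field_simp
    have hsa : s * a = -√D - v := by
      have h1 : (√D - v) * (s * a) = (√D - v) * (-√D - v) := by
        have : (√D - v) * (s * a) = 2 * z * a := by rw [← hsv]; ring
        rw [this]; nlinarith
      exact mul_left_cancel₀ hden.ne' h1
    have hroot : z + s * v + s ^ 2 / 2 * a = 0 := by
      have : s ^ 2 / 2 * a = s / 2 * (s * a) := by ring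
      rw [this, hsa]; linarith
    refine ⟨s, hsp, hroot, by rw [hsa]; linarith, fun r hr hrs => ?_⟩
    have hpos : 0 < z + r * v + r ^ 2 / 2 * a := by
      have h1 : z + r * v + r ^ 2 / 2 * a = (s - r) * (-(v + (s + r) / 2 * a)) := by
        linear_combination hroot
      rw [h1]
      refine mul_pos (by linarith) ?_
      have : (s + r) / 2 * a ≤ s * a := mul_le_mul_of_nonneg_right (by linarith) ha
      linarith
    exact ⟨hpos.le, fun h => absurd h hpos.ne'⟩

/-- With both contacts open, the body flies freely until some contact collides. -/
lemma exists_free_flight (H : B.Regular) {A : ℝ} (hA : ‖B.free‖ ≤ A) {q v : Config}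
    (hq : ∀ i, 0 ≤ B.nor i q) (ho : ∀ i, 0 < B.nor i q ∨ 0 < B.nor i v) :
    ∃ T q₁ v₁, 0 < T ∧ B.Flight A T q v q₁ v₁ ∧ (∀ i, 0 ≤ B.nor i q₁) ∧ B.Colliding q₁ v₁ ∧
      0 ≤ B.nor 0 q + T * B.nor 0 v + T ^ 2 / 2 * B.nor 0 B.free := by
  have hacc : B.accel 0 = B.free := rfl
  obtain ⟨s, hs, h0, h1, h2⟩ := exists_root_of_neg H.free_neg (hq 0) (ho 0)
  have hfly : ∀ T, 0 < T → (∀ i r, 0 ≤ r → r < T →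
      0 ≤ B.nor i q + r * B.nor i v + r ^ 2 / 2 * B.nor i B.free ∧
      (B.nor i q + r * B.nor i v + r ^ 2 / 2 * B.nor i B.free = 0 →
        0 ≤ B.nor i v + r * B.nor i B.free)) →
      B.Flight A T q v (q + T • v + (T ^ 2 / 2) • B.free) (v + T • B.free) := by
    intro T hT hr
    refine flight_const 0 hT.le hA fun r h0 h1 => ?_
    rw [complementarity_iff_compl]
    intro i
    have : B.comps i ((0 : Fin 2 → Vec) i) = 0 := comps_eq_zero.2 rfl
    rw [this, compl_zero, hacc]
    simpa only [nor_add, nor_smul] using hr i r h0 h1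
  have h0s : ∀ r, 0 ≤ r → r < s →
      0 ≤ B.nor 0 q + r * B.nor 0 v + r ^ 2 / 2 * B.nor 0 B.free ∧
      (B.nor 0 q + r * B.nor 0 v + r ^ 2 / 2 * B.nor 0 B.free = 0 →
        0 ≤ B.nor 0 v + r * B.nor 0 B.free) := by
    intro r hr hrs
    rcases eq_or_lt_of_le hr with h | h
    · rw [← h]
      simp only [zero_mul, add_zero, ne_eq, OfNat.ofNat_ne_zero, not_false_eq_true, zero_pow,
        zero_div]
      exact ⟨hq 0, fun h => ((ho 0).resolve_left (by rw [h]; exact lt_irrefl _)).le⟩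
    · exact ⟨(h2 r h hrs).le, fun h' => absurd h' (h2 r h hrs).ne'⟩
  have fin : ∀ T, 0 < T → T ≤ s → (∀ r, 0 ≤ r → r < T →
      0 ≤ B.nor 1 q + r * B.nor 1 v + r ^ 2 / 2 * B.nor 1 B.free ∧
      (B.nor 1 q + r * B.nor 1 v + r ^ 2 / 2 * B.nor 1 B.free = 0 →
        0 ≤ B.nor 1 v + r * B.nor 1 B.free)) →
      0 ≤ B.nor 1 q + T * B.nor 1 v + T ^ 2 / 2 * B.nor 1 B.free →
      B.Colliding (q + T • v + (T ^ 2 / 2) • B.free) (v + T • B.free) →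
      ∃ T q₁ v₁, 0 < T ∧ B.Flight A T q v q₁ v₁ ∧ (∀ i, 0 ≤ B.nor i q₁) ∧ B.Colliding q₁ v₁ ∧
      0 ≤ B.nor 0 q + T * B.nor 0 v + T ^ 2 / 2 * B.nor 0 B.free := by
    intro T hT hTs hr hend hcol
    have hz0 : 0 ≤ B.nor 0 q + T * B.nor 0 v + T ^ 2 / 2 * B.nor 0 B.free := by
      rcases eq_or_lt_of_le hTs with h | h
      · rw [h]; exact h0.ge
      · exact (h2 T hT h).le
    refine ⟨T, _, _, hT, hfly T hT fun i r hr0 hrT => ?_, fun i => ?_, hcol, hz0⟩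
    · match i with
      | 0 => exact h0s r hr0 (by linarith)
      | 1 => exact hr r hr0 hrT
    · simp only [nor_add, nor_smul]
      match i with
      | 0 => exact hz0
      | 1 => exact hend
  rcases quadratic_collision (a := B.nor 1 B.free) (hq 1) (ho 1) with h | ⟨s', hs', e0, e1, e2⟩
  · exact fin s hs le_rfl (fun r hr _ => h r hr) (h s hs.le).1
      ⟨0, by simpa only [nor_add, nor_smul] using h0, by simpa only [nor_add, nor_smul] using h1⟩
  · rcases le_or_gt s s' with hle | hlt
    · refine fin s hs le_rfl (fun r hr hrs => e2 r hr (by linarith)) ?_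
        ⟨0, by simpa only [nor_add, nor_smul] using h0, by simpa only [nor_add, nor_smul] using h1⟩
      rcases eq_or_lt_of_le hle with h | h
      · rw [h]; exact e0.ge
      · exact (e2 s hs.le h).1
    · exact fin s' hs' hlt.le e2 e0.ge
        ⟨1, by simpa only [nor_add, nor_smul] using e0, by simpa only [nor_add, nor_smul] using e1⟩

/-! ### Impacts -/

/-- An impulse in the direction `c` stops the normal motion of contact `i` and takes the velocity
`v` to `w` in agreement with Coulomb's law. -/
def Body.Hit (B : Body) (i : Fin 2) (v : Config) (c : ℝ × ℝ) (w : Config) : Prop :=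
  B.UnitCone i c ∧ w = v - B.nor i v • B.push i c ∧ B.Coulomb i c (B.tan i w)

lemma exists_hit (hp : B.PainleveFree) (i : Fin 2) (v : Config) : ∃ c w, B.Hit i v c w := by
  obtain ⟨c, hc, h⟩ := exists_unitCone_coulomb hp i v
  exact ⟨c, _, hc, rfl, h⟩

lemma Body.Hit.nor_eq {i : Fin 2} {v w : Config} {c : ℝ × ℝ} (h : B.Hit i v c w) :
    B.nor i w = 0 := by
  rw [h.2.1, nor_sub, nor_smul, h.1.1]; ring

lemma Body.Hit.unique (hp : B.PainleveFree) {i : Fin 2} {v w w' : Config} {c c' : ℝ × ℝ}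
    (hv : B.nor i v < 0) (h : B.Hit i v c w) (h' : B.Hit i v c' w') : c = c' ∧ w = w' := by
  obtain ⟨h1, rfl, h2⟩ := h
  obtain ⟨h1', rfl, h2'⟩ := h'
  have := unitCone_coulomb_unique hp hv h1 h1' h2 h2'
  exact ⟨this, by rw [this]⟩

lemma impactSolution_iff {q v w : Config} {g : Fin 2 → Vec} :
    B.ImpactSolution q v w g ↔
      w = v + (B.push 0 (B.comps 0 (g 0)) + B.push 1 (B.comps 1 (g 1))) ∧
      ∀ i, B.Compl i (B.comps i (g i)) (B.nor i q) (B.nor i w) (B.tan i w) := by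
  rw [Body.ImpactSolution, complementarity_iff_compl, jump_eq]

lemma Body.Compl.eq_zero {i : Fin 2} {c : ℝ × ℝ} {z ζ T : ℝ} (h : B.Compl i c z ζ T)
    (h0 : c.1 = 0) : c = 0 := by
  have := h.2.2.2.2.1
  rw [h0, mul_zero] at this
  exact Prod.ext h0 (abs_nonpos_iff.1 this)

/-- A non-zero impulse acts only at a closed contact, which does not separate afterwards. -/
lemma Body.Compl.closed {i : Fin 2} {c : ℝ × ℝ} {z ζ T : ℝ} (h : B.Compl i c z ζ T)
    (h0 : c ≠ 0) : 0 < c.1 ∧ z = 0 ∧ ζ = 0 := by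
  have h1 : c.1 ≠ 0 := fun h1 => h0 (h.eq_zero h1)
  have h2 : z = 0 := (mul_eq_zero.1 h.2.2.1).resolve_left h1
  exact ⟨lt_of_le_of_ne h.1 (Ne.symm h1), h2, (mul_eq_zero.1 (h.2.2.2.1 h2).2).resolve_left h1⟩

lemma Body.ImpactSolution.eq_add {q v w : Config} {g : Fin 2 → Vec}
    (h : B.ImpactSolution q v w g) {i j : Fin 2} (hij : i ≠ j) (hj : B.comps j (g j) = 0) :
    w = v + B.push i (B.comps i (g i)) := by
  rw [h.1, jump_eq' hij, hj, push_zero, add_zero]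

/-- A contact that is not colliding takes no impulse if the other one takes none. -/
lemma Body.ImpactSolution.comps_eq_zero_of_nonneg (hp : B.PainleveFree) {q v w : Config}
    {g : Fin 2 → Vec} (h : B.ImpactSolution q v w g) {i j : Fin 2} (hij : i ≠ j)
    (hj : B.comps j (g j) = 0) (hi : 0 < B.nor i q ∨ 0 ≤ B.nor i v) : B.comps i (g i) = 0 := by
  by_contra hne
  have hc := (impactSolution_iff.1 h).2 i
  obtain ⟨h1, h2, h3⟩ := hc.closed hne
  rcases hi with hi | hi
  · exact hi.ne' h2
  · have h4 := margin_le i hc.2.2.2.2.1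
    have h5 := mul_pos (margin_pos hp i) h1
    rw [h.eq_add hij hj, nor_add] at h3
    linarith

lemma Body.ImpactSolution.hit {q v w : Config} {g : Fin 2 → Vec}
    (h : B.ImpactSolution q v w g) {i j : Fin 2} (hij : i ≠ j) (hj : B.comps j (g j) = 0)
    (hq : B.nor i q = 0) (hv : B.nor i v < 0) : ∃ c, B.Hit i v c w := by
  have hc := (impactSolution_iff.1 h).2 i
  have hw := h.eq_add hij hj
  have hne : B.comps i (g i) ≠ 0 := by
    intro h0
    rw [h0, push_zero, add_zero] at hw
    have := (hc.2.2.2.1 hq).1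
    rw [hw] at this
    linarith
  obtain ⟨h1, -, h3⟩ := hc.closed hne
  set c := B.comps i (g i)
  have hr : 0 < -B.nor i v := by linarith
  have h4 : B.nor i (B.push i c) = -B.nor i v := by rw [hw, nor_add] at h3; linarith
  refine ⟨(-B.nor i v)⁻¹ • c, ⟨?_, ?_⟩, ?_, coulomb_smul_left _ hc.2.2.2.2.2⟩
  · rw [push_smul, nor_smul, h4, inv_mul_cancel₀ hr.ne']
  · simp only [Prod.smul_fst, Prod.smul_snd, smul_eq_mul]
    rw [abs_mul, abs_of_pos (inv_pos.2 hr)]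
    nlinarith [mul_le_mul_of_nonneg_left hc.2.2.2.2.1 (inv_pos.2 hr).le]
  · rw [hw, push_smul, smul_smul, inv_neg, mul_neg, mul_inv_cancel₀ hv.ne, neg_smul, one_smul,
      sub_neg_eq_add]

lemma Body.Hit.solution (hp : B.PainleveFree) {q v w : Config} {c : ℝ × ℝ} {i j : Fin 2}
    (hij : i ≠ j) (h : B.Hit i v c w) (hq : B.nor i q = 0) (hv : B.nor i v ≤ 0)
    (hj : 0 ≤ B.nor j q) (hj' : B.nor j q = 0 → 0 ≤ B.nor j w) :
    ∃ g, B.ImpactSolution q v w g ∧ B.comps j (g j) = 0 := by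
  set g : Fin 2 → Vec := fun k => if k = i then B.force i (-B.nor i v • c) else 0 with hg
  have hgi : B.comps i (g i) = -B.nor i v • c := by simp [hg]
  have hgj : B.comps j (g j) = 0 := by rw [comps_eq_zero]; simp [hg, hij.symm]
  refine ⟨g, ⟨?_, complementarity_iff_compl.2 fun k => ?_⟩, hgj⟩
  · rw [jump_eq' hij, hgi, hgj, push_zero, add_zero, h.2.1, push_smul, neg_smul, sub_eq_add_neg]
  · by_cases hk : k = i
    · subst hk
      have hr : 0 ≤ -B.nor k v := by linarith
      rw [hgi, hq, h.nor_eq]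
      refine ⟨mul_nonneg hr (h.1.fst_pos hp).le, le_rfl, by simp, fun _ => by simp, ?_,
        coulomb_smul_left _ h.2.2⟩
      simp only [Prod.smul_fst, Prod.smul_snd, smul_eq_mul]
      rw [abs_mul, abs_of_nonneg hr]
      nlinarith [mul_le_mul_of_nonneg_left h.1.2 hr]
    · have : k = j := by omega
      subst this
      rw [hgj, compl_zero]
      exact ⟨hj, hj'⟩

/-- A feasible single-contact impact is the one that the impact law selects. -/
lemma Body.Hit.impact (hp : B.PainleveFree) {q v w : Config} {c : ℝ × ℝ} {i j : Fin 2}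
    (hij : i ≠ j) (h : B.Hit i v c w) (hq : B.nor i q = 0) (hv : B.nor i v < 0)
    (hj : 0 ≤ B.nor j q) (hjv : 0 < B.nor j q ∨ 0 ≤ B.nor j v)
    (hj' : B.nor j q = 0 → 0 ≤ B.nor j w) : B.Impact q v w := by
  obtain ⟨g, hg, hgj⟩ := h.solution hp hij hq hv.le hj hj'
  refine Or.inr ⟨⟨i, hq, hv⟩, g, hg, Or.inl ⟨j, comps_eq_zero.1 hgj⟩, ?_⟩
  by_cases hst : B.StickingImpact w g
  · exact Or.inl hst
  refine Or.inr fun w' g' hg' hiff hst' => hst ?_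
  have hs : SingleImpact g' := hiff.2 ⟨j, comps_eq_zero.1 hgj⟩
  have hgj' : B.comps j (g' j) = 0 := by
    obtain ⟨k, hk⟩ := hs
    by_cases hkj : k = j
    · rw [← hkj, hk]; exact comps_eq_zero.2 rfl
    · have : k = i := by omega
      subst this
      exact hg'.comps_eq_zero_of_nonneg hp hij.symm (comps_eq_zero.2 hk) hjv
  obtain ⟨c', hc'⟩ := hg'.hit hij hgj' hq hv
  have hw : w' = w := (hc'.unique hp hv h).2
  intro k hk
  by_cases hki : k = i
  · subst hki
    have hk' : g' k ≠ 0 := by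
      intro h0
      have := hg'.eq_add hij hgj'
      rw [comps_eq_zero.2 h0, push_zero, add_zero] at this
      have h2 := hc'.nor_eq
      rw [this] at h2
      linarith
    rw [← hw]
    exact hst' k hk'
  · have : k = j := by omega
    subst this
    exact absurd (comps_eq_zero.1 hgj) hk

/-- Outcomes of a collision at contact `i` while the other contact `j` is not colliding. -/
lemma Body.Impact.cases (hp : B.PainleveFree) {q v w : Config} {i j : Fin 2} (hij : i ≠ j)
    (h : B.Impact q v w) (hq : B.nor i q = 0) (hv : B.nor i v < 0)
    (hjv : 0 < B.nor j q ∨ 0 ≤ B.nor j v) :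
    B.nor i w = 0 ∧ ((B.nor j q = 0 ∧ B.nor j w = 0) ∨ ∃ c, B.Hit i v c w) := by
  rcases h with h | ⟨-, g, hg, -⟩
  · exact absurd ⟨i, hq, hv⟩ h.1
  by_cases hj : B.comps j (g j) = 0
  · obtain ⟨c, hc⟩ := hg.hit hij hj hq hv
    exact ⟨hc.nor_eq, Or.inr ⟨c, hc⟩⟩
  · have hi : B.comps i (g i) ≠ 0 := fun h0 =>
      hj (hg.comps_eq_zero_of_nonneg hp hij.symm h0 hjv)
    have hc := (impactSolution_iff.1 hg).2
    exact ⟨((hc i).closed hi).2.2, Or.inl ((hc j).closed hj).2⟩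

/-- After a collision some contact is closed and does not separate. -/
lemma Body.Impact.exists_closed {q v w : Config} (h : B.Impact q v w) (hcol : B.Colliding q v) :
    ∃ i, B.nor i q = 0 ∧ B.nor i w = 0 := by
  rcases h with h | ⟨-, g, hg, -⟩
  · exact absurd hcol h.1
  obtain ⟨hw, hc⟩ := impactSolution_iff.1 hg
  by_contra hcon
  push Not at hcon
  have hz : ∀ i, B.comps i (g i) = 0 := fun i => by
    by_contra hne
    exact hcon i ((hc i).closed hne).2.1 ((hc i).closed hne).2.2
  rw [hz 0, hz 1, push_zero, push_zero, add_zero, add_zero] at hw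
  obtain ⟨i, hi, hi'⟩ := hcol
  have := ((hc i).2.2.2.1 hi).1
  rw [hw] at this
  linarith

/-- The linear complementarity problem of a `P`-matrix of order two has a solution. -/
lemma exists_lcp {a b c d p q : ℝ} (ha : 0 < a) (hd : 0 < d) (hdet : 0 < a * d - b * c) :
    ∃ x y, 0 ≤ x ∧ 0 ≤ y ∧ 0 ≤ p + (x * a + y * b) ∧ 0 ≤ q + (x * c + y * d) ∧
      x * (p + (x * a + y * b)) = 0 ∧ y * (q + (x * c + y * d)) = 0 := by
  by_cases h1 : 0 ≤ p ∧ 0 ≤ q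
  · exact ⟨0, 0, le_rfl, le_rfl, by simpa using h1.1, by simpa using h1.2, by simp, by simp⟩
  by_cases h2 : p < 0 ∧ 0 ≤ q * a - p * c
  · refine ⟨-p / a, 0, div_nonneg (by linarith) ha.le, le_rfl, ?_, ?_, ?_, by simp⟩
    · apply le_of_eq; field_simp; ring
    · have : q + (-p / a * c + 0 * d) = (q * a - p * c) / a := by field_simp; ring
      rw [this]; exact div_nonneg h2.2 ha.le
    · have : p + (-p / a * a + 0 * b) = 0 := by field_simp; ring
      rw [this, mul_zero]
  by_cases h3 : q < 0 ∧ 0 ≤ p * d - q * b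
  · refine ⟨0, -q / d, le_rfl, div_nonneg (by linarith) hd.le, ?_, ?_, by simp, ?_⟩
    · have : p + (0 * a + -q / d * b) = (p * d - q * b) / d := by field_simp; ring
      rw [this]; exact div_nonneg h3.2 hd.le
    · apply le_of_eq; field_simp; ring
    · have : q + (0 * c + -q / d * d) = 0 := by field_simp; ring
      rw [this, mul_zero]
  have hx : 0 ≤ -p * d + q * b ∧ 0 ≤ -q * a + p * c := by
    rcases lt_or_ge p 0 with hp | hp
    · have e1 : q * a - p * c < 0 := not_le.1 fun h => h2 ⟨hp, h⟩
      rcases lt_or_ge q 0 with hq | hq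
      · have e2 : p * d - q * b < 0 := not_le.1 fun h => h3 ⟨hq, h⟩
        exact ⟨by linarith, by linarith⟩
      · refine ⟨?_, by linarith⟩
        rcases le_or_gt 0 b with hb | hb
        · nlinarith [mul_nonneg hq hb, mul_pos (neg_pos.2 hp) hd]
        · have : 0 < a * (-p * d + q * b) := by
            nlinarith [mul_pos (neg_pos.2 hb) (neg_pos.2 e1), mul_pos (neg_pos.2 hp) hdet]
          exact (pos_of_mul_pos_right this ha.le).le
    · have hq : q < 0 := not_le.1 fun h => h1 ⟨hp, h⟩
      have e2 : p * d - q * b < 0 := not_le.1 fun h => h3 ⟨hq, h⟩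
      refine ⟨by linarith, ?_⟩
      rcases le_or_gt 0 c with hc | hc
      · nlinarith [mul_nonneg hp hc, mul_pos (neg_pos.2 hq) ha]
      · have : 0 < d * (-q * a + p * c) := by
          nlinarith [mul_pos (neg_pos.2 hc) (neg_pos.2 e2), mul_pos (neg_pos.2 hq) hdet]
        exact (pos_of_mul_pos_right this hd.le).le
  set D := a * d - b * c with hD
  have e1 : p + ((-p * d + q * b) / D * a + (-q * a + p * c) / D * b) = 0 := by
    field_simp; rw [hD]; ring
  have e2 : q + ((-p * d + q * b) / D * c + (-q * a + p * c) / D * d) = 0 := by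
    field_simp; rw [hD]; ring
  exact ⟨(-p * d + q * b) / D, (-q * a + p * c) / D, div_nonneg hx.1 hdet.le,
    div_nonneg hx.2 hdet.le, e1.ge, e2.ge, by rw [e1, mul_zero], by rw [e2, mul_zero]⟩

/-- Either the impact law has a solution, or two closed contacts can be stopped by impulses in the
friction cones after which the body does not move in the horizontal direction `σ`. -/
lemma impact_alternative (H : B.Regular) {q v : Config} (hq : ∀ i, B.nor i q = 0)
    (hcol : B.Colliding q v) {σ : ℝ} (hσ : σ = 1 ∨ σ = -1) :
    (∃ w g, B.ImpactSolution q v w g) ∨ ∃ C : Fin 2 → ℝ × ℝ,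
      (∀ i, 0 ≤ (C i).1 ∧ |(C i).2| ≤ B.μ i * (C i).1) ∧
      (∀ i, B.nor i (v + (B.push 0 (C 0) + B.push 1 (C 1))) = 0) ∧
      σ * B.hor (v + (B.push 0 (C 0) + B.push 1 (C 1))) ≤ 0 := by
  obtain ⟨x, y, hx, hy, hr0, hr1, hxr, hyr⟩ := exists_lcp (p := B.nor 0 v) (q := B.nor 1 v)
    (slipRay_self_pos H.painleve hσ 0) (slipRay_self_pos H.painleve hσ 1) (slip_det_pos H hσ)
  set l : Fin 2 → ℝ := ![x, y] with hl
  set C : Fin 2 → ℝ × ℝ := fun i => l i • B.slipRay i σ with hC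
  set w := v + (B.push 0 (C 0) + B.push 1 (C 1)) with hw
  have hnw : ∀ i, B.nor i w = B.nor i v + (x * B.nor i (B.push 0 (B.slipRay 0 σ)) +
      y * B.nor i (B.push 1 (B.slipRay 1 σ))) := fun i => by
    simp [hw, hC, hl, push_smul]
  have hl0 : ∀ i, 0 ≤ l i := fun i => by match i with | 0 => exact hx | 1 => exact hy
  have hrn : ∀ i, 0 ≤ B.nor i w := fun i => by
    match i with
    | 0 => rw [hnw]; exact hr0
    | 1 => rw [hnw]; exact hr1
  have hlr : ∀ i, l i * B.nor i w = 0 := fun i => by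
    match i with
    | 0 => rw [hnw]; exact hxr
    | 1 => rw [hnw]; exact hyr
  have hC1 : ∀ i, (C i).1 = l i := fun i => by simp [hC, Body.slipRay]
  rcases le_or_gt 0 (σ * B.hor w) with hu | hu
  · left
    refine ⟨w, fun i => B.force i (C i), impactSolution_iff.2 ⟨by simp [hw], fun i => ?_⟩⟩
    rw [comps_force, hq i]
    refine ⟨by rw [hC1]; exact hl0 i, le_rfl, by simp, fun _ => ⟨hrn i, by rw [hC1]; exact hlr i⟩,
      slipRay_cone hσ i (hl0 i), ?_⟩
    rcases mul_eq_zero.1 (hlr i) with h | h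
    · simp [hC, h, Body.Coulomb]
    · rw [tan_eq_hor_div H.cos_ne h]
      exact coulomb_slipRay H.cos_ne hσ i _ hu
  by_cases hall : ∀ i, B.nor i w = 0
  · exact Or.inr ⟨C, fun i => ⟨by rw [hC1]; exact hl0 i, slipRay_cone hσ i (hl0 i)⟩, hall, hu.le⟩
  -- Only one contact `i` takes an impulse. Compare with the single-contact impact `w'` at `i`.
  push Not at hall
  obtain ⟨j, hj⟩ := hall
  obtain ⟨i, hij⟩ : ∃ i : Fin 2, i ≠ j := by
    match j with
    | 0 => exact ⟨1, by decide⟩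
    | 1 => exact ⟨0, by decide⟩
  have hlj : l j = 0 := (mul_eq_zero.1 (hlr j)).resolve_right hj
  have hjpos : 0 < B.nor j w := lt_of_le_of_ne (hrn j) (Ne.symm hj)
  have hsum : ∀ D : Fin 2 → ℝ × ℝ, B.push 0 (D 0) + B.push 1 (D 1) =
      B.push i (D i) + B.push j (D j) := fun D => by
    match i, j with
    | 0, 1 => rfl
    | 1, 0 => exact add_comm _ _
    | 0, 0 => exact absurd rfl hij
    | 1, 1 => exact absurd rfl hij
  have hCj : C j = 0 := by simp [hC, hlj]
  have hwi : w = v + B.push i (C i) := by rw [hw, hsum, hCj, push_zero, add_zero]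
  have hli : l i ≠ 0 := by
    intro h
    have hCi : C i = 0 := by simp [hC, h]
    rw [hCi, push_zero, add_zero] at hwi
    obtain ⟨k, -, hk⟩ := hcol
    have := hrn k
    rw [hwi] at this
    linarith
  have hiw : B.nor i w = 0 := (mul_eq_zero.1 (hlr i)).resolve_left hli
  have hpush : B.nor i (B.push i (C i)) = -B.nor i v := by
    rw [hwi, nor_add] at hiw; linarith
  have hlpos : 0 < l i := lt_of_le_of_ne (hl0 i) (Ne.symm hli)
  have hiv : B.nor i v < 0 := by
    have h1 := margin_le i (slipRay_cone (B := B) hσ i (hl0 i))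
    have h2 := mul_pos (margin_pos H.painleve i) hlpos
    change B.margin i * (C i).1 ≤ B.nor i (B.push i (C i)) at h1
    rw [hC1] at h1
    linarith
  obtain ⟨c, w', hhit⟩ := exists_hit H.painleve i v
  rcases le_or_gt 0 (B.nor j w') with hjw | hjw
  · left
    obtain ⟨g, hg, -⟩ := hhit.solution H.painleve hij (hq i) hiv.le (hq j).ge fun _ => hjw
    exact ⟨w', g, hg⟩
  right
  set d := -B.nor i v • c with hd
  have hr : 0 < -B.nor i v := by linarith
  have hw' : w' = v + B.push i d := by rw [hhit.2.1, hd, push_smul, neg_smul, sub_eq_add_neg]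
  have hu' : σ * B.hor w' ≤ 0 := by
    by_contra hcon
    push Not at hcon
    have hcou := hhit.2.2
    rw [tan_eq_hor_div H.cos_ne hhit.nor_eq] at hcou
    have hcs := eq_slipRay_of_coulomb H.cos_ne hσ hcon hcou
    have h1 := hhit.1.1
    rw [hcs, push_smul, nor_smul] at h1
    have h2 : l i * B.nor i (B.push i (B.slipRay i σ)) = -B.nor i v := by
      rw [← hpush, ← nor_smul, ← push_smul]
    have h3 : C i = d := by
      have h4 : l i = -B.nor i v * c.1 := by
        have hs := slipRay_self_pos H.painleve hσ i
        apply mul_right_cancel₀ hs.ne'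
        rw [h2, mul_assoc, h1, mul_one]
      rw [hd, hcs, smul_smul, hC]
      simp only [h4]
    rw [hwi, h3, ← hw'] at hjpos
    linarith
  have hdcone : 0 ≤ d.1 ∧ |d.2| ≤ B.μ i * d.1 := by
    refine ⟨mul_nonneg hr.le (hhit.1.fst_pos H.painleve).le, ?_⟩
    simp only [hd, Prod.smul_fst, Prod.smul_snd, smul_eq_mul]
    rw [abs_mul, abs_of_pos hr]
    nlinarith [mul_le_mul_of_nonneg_left hhit.1.2 hr.le]
  have hCcone := slipRay_cone (B := B) hσ i (hl0 i)
  have hCcone' : |(C i).2| ≤ B.μ i * (C i).1 := hCcone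
  have hgap : 0 < B.nor j w - B.nor j w' := by linarith
  set θ := B.nor j w / (B.nor j w - B.nor j w') with hθ
  have hθ0 : 0 ≤ θ := div_nonneg hjpos.le hgap.le
  have hθ1 : 0 ≤ 1 - θ := by
    rw [hθ, sub_nonneg, div_le_one hgap]; linarith
  set E : ℝ × ℝ := (1 - θ) • C i + θ • d with hE
  have hwE : v + B.push i E = (1 - θ) • w + θ • w' := by
    have key : ∀ (θ : ℝ) (x y : Config),
        v + ((1 - θ) • x + θ • y) = (1 - θ) • (v + x) + θ • (v + y) := fun θ x y => by module
    rw [hE, push_add, push_smul i (1 - θ), push_smul i θ, hwi, hw', key]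
  refine ⟨fun k => if k = i then E else 0, fun k => ?_, ?_⟩
  · by_cases hk : k = i
    · subst hk
      simp only [if_true]
      simp only [hE, Prod.fst_add, Prod.snd_add, Prod.smul_fst, Prod.smul_snd, smul_eq_mul]
      refine ⟨add_nonneg (mul_nonneg hθ1 (by rw [hC1]; exact hl0 k))
        (mul_nonneg hθ0 hdcone.1), ?_⟩
      have := abs_add_le ((1 - θ) * (C k).2) (θ * d.2)
      rw [abs_mul, abs_mul, abs_of_nonneg hθ0, abs_of_nonneg hθ1] at this
      nlinarith [mul_le_mul_of_nonneg_left hCcone' hθ1,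
        mul_le_mul_of_nonneg_left hdcone.2 hθ0]
    · simp [hk]
  · rw [hsum (fun k => if k = i then E else 0)]
    simp only [if_true, hij.symm, if_false, push_zero, add_zero]
    rw [hwE]
    refine ⟨fun k => ?_, ?_⟩
    · rw [nor_add, nor_smul, nor_smul]
      by_cases hk : k = i
      · rw [hk, hiw, hhit.nor_eq]; ring
      · have : k = j := by omega
        rw [this, hθ]; field_simp; ring
    · rw [hor_add, hor_smul, hor_smul]
      nlinarith [mul_nonneg hθ1 (by linarith : 0 ≤ -(σ * B.hor w)),
        mul_nonneg hθ0 (by linarith : 0 ≤ -(σ * B.hor w'))]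

lemma exists_impactSolution (H : B.Regular) {q v : Config} (hq : ∀ i, 0 ≤ B.nor i q)
    (hcol : B.Colliding q v) : ∃ w g, B.ImpactSolution q v w g := by
  by_cases hall : ∀ i, B.nor i q = 0
  · rcases impact_alternative H hall hcol (σ := 1) (Or.inl rfl) with h | ⟨C, hC, hn, hu⟩
    · exact h
    rcases impact_alternative H hall hcol (σ := -1) (Or.inr rfl) with h | ⟨D, hD, hn', hu'⟩
    · exact h
    -- A convex combination of the two pairs of impulses brings the body to rest.
    set w := v + (B.push 0 (C 0) + B.push 1 (C 1)) with hw
    set w' := v + (B.push 0 (D 0) + B.push 1 (D 1)) with hw'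
    obtain ⟨θ, h0, h1, hθ⟩ : ∃ θ : ℝ, 0 ≤ θ ∧ 0 ≤ 1 - θ ∧
        (1 - θ) * B.hor w + θ * B.hor w' = 0 := by
      rcases eq_or_ne (B.hor w) 0 with h | h
      · exact ⟨0, le_rfl, by norm_num, by rw [h]; ring⟩
      · have hlt : B.hor w < 0 := lt_of_le_of_ne (by linarith) h
        have hgap : 0 < B.hor w' - B.hor w := by linarith
        refine ⟨-B.hor w / (B.hor w' - B.hor w), div_nonneg (by linarith) hgap.le, ?_, ?_⟩
        · rw [sub_nonneg, div_le_one hgap]; linarith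
        · field_simp; ring
    set E : Fin 2 → ℝ × ℝ := fun i => (1 - θ) • C i + θ • D i with hE
    have hsum : v + (B.push 0 (E 0) + B.push 1 (E 1)) = (1 - θ) • w + θ • w' := by
      simp only [hE, push_add, push_smul, hw, hw']; module
    have hzero : v + (B.push 0 (E 0) + B.push 1 (E 1)) = 0 := by
      rw [hsum]
      refine config_eq_zero H.cos_ne (fun i => ?_) ?_
      · rw [nor_add, nor_smul, nor_smul, hn, hn']; ring
      · rw [hor_add, hor_smul, hor_smul, hθ]
    refine ⟨0, fun i => B.force i (E i), impactSolution_iff.2 ⟨by simp [hzero], fun i => ?_⟩⟩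
    rw [comps_force, hall i, nor_zero, tan_zero]
    refine ⟨?_, le_rfl, by simp, fun _ => by simp, ?_, coulomb_zero _ _⟩
    · simp only [hE, Prod.fst_add, Prod.smul_fst, smul_eq_mul]
      exact add_nonneg (mul_nonneg h1 (hC i).1) (mul_nonneg h0 (hD i).1)
    · simp only [hE, Prod.fst_add, Prod.snd_add, Prod.smul_fst, Prod.smul_snd, smul_eq_mul]
      have := abs_add_le ((1 - θ) * (C i).2) (θ * (D i).2)
      rw [abs_mul, abs_mul, abs_of_nonneg h0, abs_of_nonneg h1] at this
      nlinarith [mul_le_mul_of_nonneg_left (hC i).2 h1, mul_le_mul_of_nonneg_left (hD i).2 h0]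
  · push Not at hall
    obtain ⟨j, hj⟩ := hall
    obtain ⟨i, hi, hv⟩ := hcol
    have hij : i ≠ j := fun h => hj (by rw [← h]; exact hi)
    obtain ⟨c, w, hhit⟩ := exists_hit H.painleve i v
    obtain ⟨g, hg, -⟩ := hhit.solution H.painleve hij hi hv.le (hq j) fun h => absurd h hj
    exact ⟨w, g, hg⟩

lemma exists_impact (H : B.Regular) {q : Config} (v : Config) (hq : ∀ i, 0 ≤ B.nor i q) :
    ∃ w, B.Impact q v w := by
  by_cases hcol : B.Colliding q v
  swap
  · exact ⟨v, Or.inl ⟨hcol, rfl⟩⟩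
  set K : Config → (Fin 2 → Vec) → Prop := fun w g => B.ImpactSolution q v w g ∧
    (SingleImpact g ∨ ∀ w' g', B.ImpactSolution q v w' g' → ¬ SingleImpact g') with hK
  have hne : ∃ w g, K w g := by
    by_cases hs : ∃ w g, B.ImpactSolution q v w g ∧ SingleImpact g
    · obtain ⟨w, g, h1, h2⟩ := hs
      exact ⟨w, g, h1, Or.inl h2⟩
    · obtain ⟨w, g, h1⟩ := exists_impactSolution H hq hcol
      exact ⟨w, g, h1, Or.inr fun w' g' h2 h3 => hs ⟨w', g', h2, h3⟩⟩
  by_cases hst : ∃ w g, K w g ∧ B.StickingImpact w g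
  · obtain ⟨w, g, h1, h2⟩ := hst
    exact ⟨w, Or.inr ⟨hcol, g, h1.1, h1.2, Or.inl h2⟩⟩
  · obtain ⟨w, g, h1⟩ := hne
    refine ⟨w, Or.inr ⟨hcol, g, h1.1, h1.2, Or.inr fun w' g' h2 h3 h4 => hst ⟨w', g', ⟨h2, ?_⟩, h4⟩⟩⟩
    exact h1.2.imp_left h3.2

/-! ### Energy estimates -/

/-- The scalar product of velocities given by the kinetic energy. -/
noncomputable def Body.ip (B : Body) (v w : Config) : ℝ :=
  B.m * (v.1 * w.1 + v.2.1 * w.2.1 + B.ρ ^ 2 * (v.2.2 * w.2.2))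

/-- The norm of velocities given by the kinetic energy. -/
noncomputable def Body.speed (B : Body) (v : Config) : ℝ := √(B.ip v v)

lemma ip_self_nonneg (v : Config) : 0 ≤ B.ip v v := by
  have := B.m_pos
  rw [Body.ip]
  have h1 := mul_self_nonneg v.1
  have h2 := mul_self_nonneg v.2.1
  have h3 := mul_self_nonneg v.2.2
  positivity

lemma speed_nonneg (v : Config) : 0 ≤ B.speed v := Real.sqrt_nonneg _

lemma speed_sq (v : Config) : B.speed v ^ 2 = B.ip v v := Real.sq_sqrt (ip_self_nonneg v)

lemma ip_le (v w : Config) : B.ip v w ≤ B.speed v * B.speed w := by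
  rw [Body.speed, Body.speed, ← Real.sqrt_mul (ip_self_nonneg v)]
  refine Real.le_sqrt_of_sq_le ?_
  have h : 0 ≤ (v.1 * w.2.1 - v.2.1 * w.1) ^ 2 + B.ρ ^ 2 * (v.1 * w.2.2 - v.2.2 * w.1) ^ 2 +
      B.ρ ^ 2 * (v.2.1 * w.2.2 - v.2.2 * w.2.1) ^ 2 := by positivity
  have := mul_nonneg (sq_nonneg B.m) h
  simp only [Body.ip]
  nlinarith

lemma ip_add_left (u v w : Config) : B.ip (u + v) w = B.ip u w + B.ip v w := by
  simp [Body.ip]; ring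

lemma ip_smul_left (r : ℝ) (v w : Config) : B.ip (r • v) w = r * B.ip v w := by
  simp [Body.ip]; ring

/-- The power of a contact force is the product with the velocity of the contact. -/
lemma ip_push (i : Fin 2) (c : ℝ × ℝ) (w : Config) :
    B.ip (B.push i c) w = c.1 * B.nor i w + c.2 * B.tan i w := by
  have h1 := B.m_pos.ne'
  have h2 := B.ρ_pos.ne'
  simp only [Body.ip, Body.nor, Body.tan, Body.vertex, Body.push, Body.force, dot, rot, Body.p,
    Body.t, Body.n, Prod.smul_fst, Prod.smul_snd, Prod.fst_add, Prod.snd_add, smul_eq_mul]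
  field_simp
  ring

/-- Contact forces are dissipative. -/
lemma Body.Compl.power_nonpos {i : Fin 2} {c : ℝ × ℝ} {z ζ T : ℝ} (h : B.Compl i c z ζ T) :
    c.1 * ζ + c.2 * T ≤ 0 := by
  have h1 : c.1 * ζ = 0 := by
    by_cases h0 : c = 0
    · simp [h0]
    · rw [(h.closed h0).2.2, mul_zero]
  have h2 : c.2 * T = -(B.μ i * c.1 * |T|) := h.2.2.2.2.2
  have := mul_nonneg (mul_nonneg (B.μ_nonneg i) h.1) (abs_nonneg T)
  linarith

lemma speed_le_of_step {v w : Config} {x : Config} {s : ℝ} (hs : 0 ≤ s) {g : Config}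
    (hw : w = v + s • x) (hx : B.ip x w ≤ B.ip g w) : B.speed w ≤ B.speed v + s * B.speed g := by
  have h1 := ip_le (B := B) v w
  have h2 := ip_le (B := B) g w
  have h3 : B.speed w ^ 2 = B.ip v w + s * B.ip x w := by
    rw [speed_sq, ← ip_smul_left, ← ip_add_left, ← hw]
  have h4 : B.speed w * B.speed w ≤ (B.speed v + s * B.speed g) * B.speed w := by
    nlinarith [mul_le_mul_of_nonneg_left (hx.trans h2) hs]
  rcases eq_or_lt_of_le (speed_nonneg (B := B) w) with h | h
  · rw [← h]
    have := speed_nonneg (B := B) v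
    have := mul_nonneg hs (speed_nonneg (B := B) g)
    linarith
  · exact le_of_mul_le_mul_right h4 h

lemma Body.Impact.speed_le {q v w : Config} (h : B.Impact q v w) : B.speed w ≤ B.speed v := by
  rcases h with ⟨-, rfl⟩ | ⟨-, g, hg, -⟩
  · rfl
  obtain ⟨hw, hc⟩ := impactSolution_iff.1 hg
  have := speed_le_of_step (B := B) (g := 0) zero_le_one
    (x := B.push 0 (B.comps 0 (g 0)) + B.push 1 (B.comps 1 (g 1))) (v := v) (w := w)
    (by rw [one_smul]; exact hw) (by
      rw [ip_add_left, ip_push, ip_push]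
      have h0 : B.ip 0 w = 0 := by simp [Body.ip]
      rw [h0]
      linarith [(hc 0).power_nonpos, (hc 1).power_nonpos])
  have h0 : B.speed 0 = 0 := by simp [Body.speed, Body.ip]
  rw [h0] at this
  linarith

lemma continuous_speed : Continuous B.speed := by
  unfold Body.speed Body.ip; fun_prop

/-- The speed grows at most linearly along trajectories. -/
lemma Body.IsTrajectory.speed_le {T : ℝ} {q v : ℝ → Config}
    (h : B.IsTrajectory (Set.Ico 0 T) q v) :
    ∀ t, 0 ≤ t → t < T → B.speed (v t) ≤ B.speed (v 0) + t * B.speed B.free := by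
  refine real_induction (by simp) ?_ ?_
  · intro t h0 hT ht
    obtain ⟨η, hη, f, hf⟩ := h.motion t ⟨h0, hT⟩
    refine ⟨η, hη, fun s h1 h2 h3 => ?_⟩
    obtain ⟨e1, -, e3⟩ := hf s ⟨by linarith, h3⟩ h1 h2
    have hc := complementarity_iff_compl.1 e3
    have := speed_le_of_step (B := B) (g := B.free) (sub_nonneg.2 h1) e1 (by
      rw [accel_eq, jump_eq, ip_add_left, ip_add_left, ip_push, ip_push]
      have := (hc 0).power_nonpos
      have := (hc 1).power_nonpos
      simp only [Body.free]
      simp only [comps_fst, comps_snd] at *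
      linarith)
    linarith
  · intro t h0 hT hlt
    obtain ⟨w, hw, hi⟩ := h.impact t ⟨h0.le, hT⟩ h0
    refine hi.speed_le.trans ?_
    have h1 : Tendsto (fun s => B.speed (v s)) (𝓝[<] t) (𝓝 (B.speed w)) :=
      (continuous_speed.tendsto w).comp hw
    have h2 : Tendsto (fun s : ℝ => B.speed (v 0) + s * B.speed B.free) (𝓝[<] t)
        (𝓝 (B.speed (v 0) + t * B.speed B.free)) :=
      ((tendsto_id.mul_const _).const_add _).mono_left nhdsWithin_le_nhds
    refine le_of_tendsto_of_tendsto h1 h2 ?_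
    filter_upwards [Ioo_mem_nhdsLT h0] with s hs
    exact hlt s hs.1.le hs.2

lemma speed_equiv (B : Body) : ∃ C > 0, ∀ v, ‖v‖ ≤ C * B.speed v ∧ B.speed v ≤ C * ‖v‖ := by
  have hm := B.m_pos
  have hρ := B.ρ_pos
  set b := √(B.m * (2 + B.ρ ^ 2)) with hb
  have hb0 : 0 < b := Real.sqrt_pos.2 (by positivity)
  have hsm : 0 < √B.m := Real.sqrt_pos.2 hm
  set a := 1 / √B.m + 1 / (√B.m * B.ρ) with ha
  have h1 : ∀ v, |v.1| ≤ 1 / √B.m * B.speed v ∧ |v.2.1| ≤ 1 / √B.m * B.speed v ∧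
      |v.2.2| ≤ 1 / (√B.m * B.ρ) * B.speed v := by
    intro v
    have hx := mul_self_nonneg v.1
    have hy := mul_self_nonneg v.2.1
    have hz := mul_self_nonneg v.2.2
    have e1 := mul_nonneg hm.le hx
    have e2 := mul_nonneg hm.le hy
    have e3 := mul_nonneg (mul_nonneg hm.le (sq_nonneg B.ρ)) hz
    have key : ∀ x y : ℝ, 0 < y → y ^ 2 * x ^ 2 ≤ B.ip v v → |x| ≤ 1 / y * B.speed v := by
      intro x y hy h
      rw [div_mul_eq_mul_div, one_mul, le_div_iff₀ hy]
      refine Real.le_sqrt_of_sq_le ?_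
      rw [mul_pow, sq_abs]
      linarith
    have hsq : √B.m ^ 2 = B.m := Real.sq_sqrt hm.le
    refine ⟨key _ _ hsm ?_, key _ _ hsm ?_, key _ _ (by positivity) ?_⟩
    all_goals
      simp only [mul_pow, hsq, Body.ip]
      nlinarith
  refine ⟨max a b, lt_max_of_lt_right hb0, fun v => ⟨?_, ?_⟩⟩
  · obtain ⟨e1, e2, e3⟩ := h1 v
    have hs := speed_nonneg (B := B) v
    have hle : a * B.speed v ≤ max a b * B.speed v :=
      mul_le_mul_of_nonneg_right (le_max_left _ _) hs
    have e4 : 0 ≤ 1 / √B.m * B.speed v := by positivity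
    have e5 : 0 ≤ 1 / (√B.m * B.ρ) * B.speed v := by positivity
    have e6 : a * B.speed v = 1 / √B.m * B.speed v + 1 / (√B.m * B.ρ) * B.speed v := by
      rw [ha]; ring
    rw [Prod.norm_def, Prod.norm_def, Real.norm_eq_abs, Real.norm_eq_abs, Real.norm_eq_abs]
    refine max_le (by linarith) (max_le (by linarith) (by linarith))
  · have hle : b * ‖v‖ ≤ max a b * ‖v‖ :=
      mul_le_mul_of_nonneg_right (le_max_right _ _) (norm_nonneg v)
    refine le_trans ?_ hle
    rw [Body.speed, ← Real.sqrt_sq (norm_nonneg v), hb, ← Real.sqrt_mul (by positivity)]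
    refine Real.sqrt_le_sqrt ?_
    have hn1 : v.1 * v.1 ≤ ‖v‖ ^ 2 := by
      have := norm_fst_le v
      rw [Real.norm_eq_abs] at this
      rw [← abs_mul_abs_self v.1, sq]
      exact mul_le_mul this this (abs_nonneg _) (norm_nonneg v)
    have hn2 : v.2.1 * v.2.1 ≤ ‖v‖ ^ 2 := by
      have := (norm_fst_le v.2).trans (norm_snd_le v)
      rw [Real.norm_eq_abs] at this
      rw [← abs_mul_abs_self v.2.1, sq]
      exact mul_le_mul this this (abs_nonneg _) (norm_nonneg v)
    have hn3 : v.2.2 * v.2.2 ≤ ‖v‖ ^ 2 := by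
      have := (norm_snd_le v.2).trans (norm_snd_le v)
      rw [Real.norm_eq_abs] at this
      rw [← abs_mul_abs_self v.2.2, sq]
      exact mul_le_mul this this (abs_nonneg _) (norm_nonneg v)
    rw [Body.ip, mul_assoc]
    refine mul_le_mul_of_nonneg_left ?_ hm.le
    nlinarith [mul_le_mul_of_nonneg_left hn3 (sq_nonneg B.ρ)]

/-- Bounds on the velocity after an impact and along a trajectory. -/
lemma velocity_bound (B : Body) : ∃ C ≥ 1, (∀ q v w, B.Impact q v w → ‖w‖ ≤ C * ‖v‖) ∧
    ∀ (T : ℝ) (q v : ℝ → Config), B.IsTrajectory (Set.Ico 0 T) q v →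
      ∀ t, 0 ≤ t → t < T → ‖v t‖ ≤ C * (‖v 0‖ + t) := by
  obtain ⟨C, hC, h⟩ := speed_equiv B
  set D := max (max (C * C) (C * B.speed B.free)) 1 with hD
  have hD1 : C * C ≤ D := (le_max_left _ _).trans (le_max_left _ _)
  have hD2 : C * B.speed B.free ≤ D := (le_max_right _ _).trans (le_max_left _ _)
  refine ⟨D, le_max_right _ _, fun q v w hi => ?_, fun T q v htr t h0 hT => ?_⟩
  · have h1 := (h w).1
    have h2 := (h v).2
    have h3 := hi.speed_le
    calc ‖w‖ ≤ C * (C * ‖v‖) := h1.trans (mul_le_mul_of_nonneg_left (h3.trans h2) hC.le)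
      _ = C * C * ‖v‖ := by ring
      _ ≤ D * ‖v‖ := mul_le_mul_of_nonneg_right hD1 (norm_nonneg v)
  · have h1 := (h (v t)).1
    have h2 := (h (v 0)).2
    have h3 := htr.speed_le t h0 hT
    calc ‖v t‖ ≤ C * (C * ‖v 0‖ + t * B.speed B.free) :=
          h1.trans (mul_le_mul_of_nonneg_left (by linarith) hC.le)
      _ = C * C * ‖v 0‖ + C * B.speed B.free * t := by ring
      _ ≤ D * ‖v 0‖ + D * t := add_le_add (mul_le_mul_of_nonneg_right hD1 (norm_nonneg _))
          (mul_le_mul_of_nonneg_right hD2 h0)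
      _ = D * (‖v 0‖ + t) := by ring

/-- The displacement is bounded by the velocity. -/
lemma Body.IsTrajectory.dist_le {T V a b : ℝ} {q v : ℝ → Config}
    (h : B.IsTrajectory (Set.Ico 0 T) q v) (ha : 0 ≤ a) (hab : a ≤ b) (hb : b < T)
    (hV : ∀ t, a ≤ t → t ≤ b → ‖v t‖ ≤ V) : ‖q b - q a‖ ≤ V * (b - a) := by
  refine norm_image_sub_le_of_norm_deriv_right_le_segment (f' := v)
    (h.continuousOn.mono fun t ht => ⟨ha.trans ht.1, ht.2.trans_lt hb⟩) ?_ ?_ b ⟨hab, le_rfl⟩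
  · intro t ht
    have ht' : t < T := ht.2.trans hb
    obtain ⟨η, hη, f, -, hm⟩ := h.localForce ⟨ha.trans ht.1, ht'⟩
    have hd : HasDerivWithinAt (fun s => q t + (s - t) • v t + ((s - t) ^ 2 / 2) • B.accel f) (v t)
        (Set.Ici t) t := by
      have h1 : HasDerivAt (fun s : ℝ => s - t) 1 t := (hasDerivAt_id t).sub_const t
      have h2 : HasDerivAt (fun s : ℝ => (s - t) ^ 2 / 2) 0 t := by
        have := (h1.pow 2).div_const 2
        simpa using this
      have h3 := ((h1.smul_const (v t)).const_add (q t)).add (h2.smul_const (B.accel f))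
      have h4 : (1 : ℝ) • v t + (0 : ℝ) • B.accel f = v t := by simp
      rw [h4] at h3
      exact h3.hasDerivWithinAt
    refine hd.congr_of_eventuallyEq ?_ (by simp)
    have hmem : Set.Ico t (t + min η (T - t)) ∈ 𝓝[≥] t :=
      Ico_mem_nhdsGE (by linarith [lt_min hη (sub_pos.2 ht')])
    filter_upwards [hmem] with s hs
    have h1 := min_le_left η (T - t)
    have h2 := min_le_right η (T - t)
    exact (hm s hs.1 (by linarith [hs.2]) (by linarith [hs.2])).2
  · intro t ht
    exact hV t ht.1 ht.2.le

/-! ### Slip and rest with both contacts closed -/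

lemma flight_rest (H : B.Regular) {A T : ℝ} (hA : 0 ≤ A) (hT : 0 ≤ T) {q : Config}
    (hq : ∀ i, B.nor i q = 0) : B.Flight A T q 0 q 0 := by
  obtain ⟨f, hf, hc⟩ := exists_static H
  have := flight_const (B := B) (A := A) (q₀ := q) (v₀ := 0) f hT (by simpa [hf] using hA) fun s _ _ => by
    rw [complementarity_iff_compl, hf]
    intro i
    simp only [smul_zero, add_zero, hq i, nor_zero, tan_zero]
    exact ⟨(hc i).1, le_rfl, by simp, fun _ => by simp, (hc i).2, coulomb_zero _ _⟩
  simpa [hf] using this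

/-- A body that slips on both contacts comes to rest in a time proportional to its speed. -/
lemma exists_slip_flight (H : B.Regular) : ∃ A K : ℝ, 0 ≤ A ∧ 0 < K ∧ ∀ q v : Config,
    (∀ i, B.nor i q = 0) → (∀ i, B.nor i v = 0) →
    ∃ T q₁, T ≤ K * ‖v‖ ∧ B.Flight A T q v q₁ 0 ∧ ∀ i, B.nor i q₁ = 0 := by
  have hone : ∀ σ : ℝ, σ = 1 ∨ σ = -1 → ∃ A K : ℝ, 0 ≤ A ∧ 0 < K ∧ ∀ q v : Config,
      (∀ i, B.nor i q = 0) → (∀ i, B.nor i v = 0) → 0 ≤ σ * B.hor v →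
      ∃ T q₁, T ≤ K * ‖v‖ ∧ B.Flight A T q v q₁ 0 ∧ ∀ i, B.nor i q₁ = 0 := by
    intro σ hσ
    obtain ⟨l, hl, hn, hdec⟩ := exists_slip H hσ
    set C : Fin 2 → ℝ × ℝ := fun i => l i • B.slipRay i σ with hC
    set f : Fin 2 → Vec := fun i => B.force i (C i) with hf
    set a := B.slipAcc σ l with ha
    have hacc : B.accel f = a := by
      rw [accel_eq, jump_eq]; simp only [hf, comps_force]; rfl
    set δ := -(σ * B.hor a) with hδ
    have hδ0 : 0 < δ := by linarith
    refine ⟨‖a‖, (1 + |B.h|) / δ, norm_nonneg a, by positivity, fun q v hq hv hu => ?_⟩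
    set T := σ * B.hor v / δ with hT
    have hT0 : 0 ≤ T := div_nonneg hu hδ0.le
    have hTδ : T * δ = σ * B.hor v := by rw [hT]; field_simp
    have hfl := flight_const (A := ‖a‖) (q₀ := q) (v₀ := v) f hT0 (by rw [hacc]) fun s h0 hs => by
      rw [complementarity_iff_compl, hacc]
      intro i
      have e2 : B.nor i (v + s • a) = 0 := by rw [nor_add, nor_smul, hv, hn]; ring
      have e1 : B.nor i (q + s • v + (s ^ 2 / 2) • a) = 0 := by
        rw [nor_add, nor_add, nor_smul, nor_smul, hq, hv, hn]; ring
      rw [e1, e2, tan_eq_hor_div H.cos_ne e2]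
      simp only [hf, comps_force]
      refine ⟨by simpa [hC, Body.slipRay] using (hl i).le, le_rfl, by simp, fun _ => by simp,
        slipRay_cone hσ i (hl i).le, coulomb_slipRay H.cos_ne hσ i _ ?_⟩
      have : σ * B.hor (v + s • a) = (T - s) * δ := by
        rw [hor_add, hor_smul, sub_mul, hTδ, hδ]; ring
      rw [this]; exact mul_nonneg (by linarith) hδ0.le
    rw [hacc] at hfl
    have hend : v + T • a = 0 := by
      refine config_eq_zero H.cos_ne (fun i => ?_) ?_
      · rw [nor_add, nor_smul, hv, hn]; ring
      · have : σ * B.hor (v + T • a) = 0 := by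
          rw [hor_add, hor_smul, mul_add]; linarith
        rcases hσ with rfl | rfl <;> linarith
    rw [hend] at hfl
    refine ⟨T, _, ?_, hfl, fun i => ?_⟩
    · rw [hT, div_mul_eq_mul_div]
      refine div_le_div_of_nonneg_right ?_ hδ0.le
      have h1 : |v.1| ≤ ‖v‖ := norm_fst_le v
      have h2 : |v.2.2| ≤ ‖v‖ := (norm_snd_le v.2).trans (norm_snd_le v)
      have h3 : |B.hor v| ≤ (1 + |B.h|) * ‖v‖ := by
        rw [Body.hor]
        refine (abs_add_le _ _).trans ?_
        rw [abs_mul]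
        nlinarith [mul_le_mul_of_nonneg_left h2 (abs_nonneg B.h)]
      have h4 : σ * B.hor v ≤ |B.hor v| := by
        rcases hσ with rfl | rfl
        · rw [one_mul]; exact le_abs_self _
        · rw [neg_one_mul]; exact neg_le_abs _
      linarith
    · rw [nor_add, nor_add, nor_smul, nor_smul, hq, hv, hn]; ring
  obtain ⟨A, K, hA, hK, h⟩ := hone 1 (Or.inl rfl)
  obtain ⟨A', K', hA', hK', h'⟩ := hone (-1) (Or.inr rfl)
  have hmono : ∀ {A A' T : ℝ} {q v q₁ v₁ : Config}, A ≤ A' → B.Flight A T q v q₁ v₁ →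
      B.Flight A' T q v q₁ v₁ := by
    rintro A A' T q v q₁ v₁ hle (h | ⟨hT, Q, V, h1, h2, h3, h4, h5, h6, h7⟩)
    · exact Or.inl h
    · exact Or.inr ⟨hT, Q, V, h1, h2, h3, h4, h5, h6, fun t ht => (h7 t ht).trans
        (mul_le_mul_of_nonneg_right hle ht.1)⟩
  refine ⟨max A A', max K K', hA.trans (le_max_left _ _), hK.trans_le (le_max_left _ _),
    fun q v hq hv => ?_⟩
  rcases le_total 0 (B.hor v) with hu | hu
  · obtain ⟨T, q₁, h1, h2, h3⟩ := h q v hq hv (by linarith)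
    exact ⟨T, q₁, h1.trans (mul_le_mul_of_nonneg_right (le_max_left _ _) (norm_nonneg v)),
      hmono (le_max_left _ _) h2, h3⟩
  · obtain ⟨T, q₁, h1, h2, h3⟩ := h' q v hq hv (by linarith)
    exact ⟨T, q₁, h1.trans (mul_le_mul_of_nonneg_right (le_max_right _ _) (norm_nonneg v)),
      hmono (le_max_right _ _) h2, h3⟩

/-! ### Cycles of the Poincaré map -/

/-- The two normal components and the horizontal component bound the norm. -/
lemma norm_le_coords (hc : ∀ i, Real.cos (B.φ i) ≠ 0) :
    ∃ K > 0, ∀ w : Config, ‖w‖ ≤ K * (|B.nor 0 w| + |B.nor 1 w| + |B.hor w|) := by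
  let f : Config →ₗ[ℝ] ℝ × ℝ × ℝ :=
    { toFun := fun w => (B.nor 0 w, B.nor 1 w, B.hor w)
      map_add' := fun v w => by simp
      map_smul' := fun r w => by simp }
  have hker : LinearMap.ker f = ⊥ := by
    rw [LinearMap.ker_eq_bot']
    intro w hw
    have h0 : B.nor 0 w = 0 := congrArg (fun x => x.1) hw
    have h1 : B.nor 1 w = 0 := congrArg (fun x => x.2.1) hw
    have h2 : B.hor w = 0 := congrArg (fun x => x.2.2) hw
    exact config_eq_zero hc (fun i => by match i with | 0 => exact h0 | 1 => exact h1) h2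
  obtain ⟨K, hK, hf⟩ := f.exists_antilipschitzWith hker
  refine ⟨K, hK, fun w => ?_⟩
  have h := hf.le_mul_dist w 0
  rw [dist_zero_right, map_zero, dist_zero_right] at h
  refine h.trans (mul_le_mul_of_nonneg_left ?_ K.2)
  change ‖(B.nor 0 w, B.nor 1 w, B.hor w)‖ ≤ _
  rw [Prod.norm_def, Prod.norm_def, Real.norm_eq_abs, Real.norm_eq_abs, Real.norm_eq_abs]
  have e0 := abs_nonneg (B.nor 0 w)
  have e1 := abs_nonneg (B.nor 1 w)
  have e2 := abs_nonneg (B.hor w)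
  exact max_le (by linarith) (max_le (by linarith) (by linarith))

/-- The components are bounded by the norm. -/
lemma coords_le_norm (B : Body) :
    ∃ K > 0, ∀ w : Config, (∀ i, |B.nor i w| ≤ K * ‖w‖) ∧ (∀ i, |B.tan i w| ≤ K * ‖w‖) ∧
      |B.hor w| ≤ K * ‖w‖ := by
  have key : ∀ f : Config → ℝ, (∀ v w, f (v + w) = f v + f w) → (∀ (r : ℝ) v, f (r • v) = r * f v) →
      ∃ K > 0, ∀ w, |f w| ≤ K * ‖w‖ := by
    intro f h1 h2
    let g : Config →ₗ[ℝ] ℝ := { toFun := f, map_add' := h1, map_smul' := h2 }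
    have hg : ∀ w, |f w| ≤ ‖LinearMap.toContinuousLinearMap g‖ * ‖w‖ := fun w =>
      (LinearMap.toContinuousLinearMap g).le_opNorm w
    refine ⟨‖LinearMap.toContinuousLinearMap g‖ + 1, by positivity, fun w => ?_⟩
    nlinarith [hg w, norm_nonneg w]
  obtain ⟨a, ha, h0⟩ := key (B.nor 0) (nor_add 0) (nor_smul 0)
  obtain ⟨b, hb, h1⟩ := key (B.nor 1) (nor_add 1) (nor_smul 1)
  obtain ⟨c, hc, h2⟩ := key (B.tan 0) (tan_add 0) (tan_smul 0)
  obtain ⟨d, hd, h3⟩ := key (B.tan 1) (tan_add 1) (tan_smul 1)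
  obtain ⟨e, he, h4⟩ := key B.hor hor_add hor_smul
  refine ⟨a + b + c + d + e, by positivity, fun w => ⟨fun i => ?_, fun i => ?_, ?_⟩⟩
  all_goals have hn := norm_nonneg w
  · match i with
    | 0 => exact (h0 w).trans (mul_le_mul_of_nonneg_right (by linarith) hn)
    | 1 => exact (h1 w).trans (mul_le_mul_of_nonneg_right (by linarith) hn)
  · match i with
    | 0 => exact (h2 w).trans (mul_le_mul_of_nonneg_right (by linarith) hn)
    | 1 => exact (h3 w).trans (mul_le_mul_of_nonneg_right (by linarith) hn)
  · exact (h4 w).trans (mul_le_mul_of_nonneg_right (by linarith) hn)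

/-- The data of a cycle: the velocity `p.1` before the impact on the Poincaré section, the directions
`p.2.1` of the contact impulses and forces (impact at contact 2, flight of contact 1 in two phases,
impact at contact 1, flight of contact 2 in two phases), and the durations `p.2.2` of the phases. -/
abbrev CycleData : Type := Config × (Fin 6 → ℝ × ℝ) × (Fin 4 → ℝ)

/-- Velocity after the impact at contact 2. -/
noncomputable def Body.postOne (B : Body) (p : CycleData) : Config :=
  p.1 - B.nor 1 p.1 • B.push 1 (p.2.1 0)

/-- Velocity before the impact at contact 1. -/
noncomputable def Body.preZero (B : Body) (p : CycleData) : Config :=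
  B.legVel 1 (B.postOne p) (p.2.1 1) (p.2.1 2) (p.2.2 0) (p.2.2 1)

/-- Configuration at the impact at contact 1. -/
noncomputable def Body.posZero (B : Body) (p : CycleData) : Config :=
  B.legPos 1 0 (B.postOne p) (p.2.1 1) (p.2.1 2) (p.2.2 0) (p.2.2 1)

/-- Velocity after the impact at contact 1. -/
noncomputable def Body.postZero (B : Body) (p : CycleData) : Config :=
  B.preZero p - B.nor 0 (B.preZero p) • B.push 0 (p.2.1 3)

/-- Velocity at the return to the Poincaré section. -/
noncomputable def Body.preOne (B : Body) (p : CycleData) : Config :=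
  B.legVel 0 (B.postZero p) (p.2.1 4) (p.2.1 5) (p.2.2 2) (p.2.2 3)

/-- The motion described by `p`, started at `q = 0`, complies with the impact and contact laws. All
conditions are closed; degenerate cycles of duration zero are included. -/
structure Body.Cycle (B : Body) (p : CycleData) : Prop where
  section_zero : B.nor 0 p.1 = 0
  hit_one : B.Hit 1 p.1 (p.2.1 0) (B.postOne p)
  rise_zero : 0 ≤ B.nor 0 (B.postOne p)
  leg_zero : B.Leg 1 0 0 (B.postOne p) (p.2.1 1) (p.2.1 2) (p.2.2 0) (p.2.2 1)
  fall_zero : B.nor 0 (B.preZero p) ≤ 0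
  hit_zero : B.Hit 0 (B.preZero p) (p.2.1 3) (B.postZero p)
  rise_one : B.nor 1 B.free ≤ 0 → 0 ≤ B.nor 1 (B.postZero p)
  leg_one : B.Leg 0 1 (B.posZero p) (B.postZero p) (p.2.1 4) (p.2.1 5) (p.2.2 2) (p.2.2 3)

section Closed

variable {X : Type*} [TopologicalSpace X]

@[fun_prop] lemma continuous_acc (i : Fin 2) : Continuous (B.acc i) := by
  unfold Body.acc; fun_prop

lemma isClosed_unitCone {i : Fin 2} {c : X → ℝ × ℝ} (hc : Continuous c) :
    IsClosed {x | B.UnitCone i (c x)} := by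
  have h1 : IsClosed {x | B.nor i (B.push i (c x)) = 1} := isClosed_eq (by fun_prop) (by fun_prop)
  have h2 : IsClosed {x | |(c x).2| ≤ B.μ i * (c x).1} := isClosed_le (by fun_prop) (by fun_prop)
  exact h1.inter h2

lemma isClosed_coulomb {i : Fin 2} {c : X → ℝ × ℝ} {T : X → ℝ} (hc : Continuous c)
    (hT : Continuous T) : IsClosed {x | B.Coulomb i (c x) (T x)} :=
  isClosed_eq (by fun_prop) (by fun_prop)

lemma isClosed_imp_const {P : Prop} {S : Set X} (hS : IsClosed S) : IsClosed {x | P → x ∈ S} := by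
  by_cases h : P
  · simpa [h] using hS
  · simp [h]

lemma isClosed_hit {i : Fin 2} {v w : X → Config} {c : X → ℝ × ℝ} (hv : Continuous v)
    (hw : Continuous w) (hc : Continuous c) : IsClosed {x | B.Hit i (v x) (c x) (w x)} := by
  have h1 : IsClosed {x | w x = v x - B.nor i (v x) • B.push i (c x)} :=
    isClosed_eq (by fun_prop) (by fun_prop)
  exact (isClosed_unitCone hc).inter (h1.inter (isClosed_coulomb hc (by fun_prop)))

lemma isClosed_leg {i j : Fin 2} {q w : X → Config} {c c' : X → ℝ × ℝ} {t t' : X → ℝ}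
    (hq : Continuous q) (hw : Continuous w) (hc : Continuous c) (hc' : Continuous c')
    (ht : Continuous t) (ht' : Continuous t') :
    IsClosed {x | B.Leg i j (q x) (w x) (c x) (c' x) (t x) (t' x)} := by
  have h1 : IsClosed {x | 0 ≤ t x} := isClosed_le (by fun_prop) (by fun_prop)
  have h2 : IsClosed {x | 0 ≤ t' x} := isClosed_le (by fun_prop) (by fun_prop)
  have h3 : IsClosed {x | 0 ≤ B.nor j (B.legMid i (q x) (w x) (c x) (t x))} := by
    unfold Body.legMid; exact isClosed_le (by fun_prop) (by fun_prop)
  have h4 : IsClosed {x | B.nor j (B.legPos i (q x) (w x) (c x) (c' x) (t x) (t' x)) = 0} := by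
    unfold Body.legPos Body.legMid; exact isClosed_eq (by fun_prop) (by fun_prop)
  have h5 : IsClosed {x | B.Coulomb i (c x) (B.tan i (w x))} := isClosed_coulomb hc (by fun_prop)
  have h6 : IsClosed {x | B.Coulomb i (c x) (B.tan i (w x + t x • B.acc i (c x)))} :=
    isClosed_coulomb hc (by fun_prop)
  have h7 : IsClosed {x | B.Coulomb i (c' x) (B.tan i (w x + t x • B.acc i (c x)))} :=
    isClosed_coulomb hc' (by fun_prop)
  have h8 : IsClosed {x | B.Coulomb i (c' x)
      (B.tan i (B.legVel i (w x) (c x) (c' x) (t x) (t' x)))} := by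
    unfold Body.legVel; exact isClosed_coulomb hc' (by fun_prop)
  have h9 := isClosed_imp_const (P := B.nor i B.free < 0) (h5.inter (h6.inter (h7.inter h8)))
  convert h1.inter (h2.inter ((isClosed_unitCone (B := B) (i := i) hc).inter
    ((isClosed_unitCone (B := B) (i := i) hc').inter (h9.inter (h3.inter h4))))) using 1
  ext x
  exact ⟨fun h => ⟨h.nonneg, h.nonneg', h.cone, h.cone', h.coulomb, h.mid, h.land⟩,
    fun ⟨a, b, c, d, e, f, g⟩ => ⟨a, b, c, d, e, f, g⟩⟩

end Closed

lemma continuous_postOne : Continuous B.postOne := by unfold Body.postOne; fun_prop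

lemma continuous_preZero : Continuous B.preZero := by
  have := continuous_postOne (B := B)
  unfold Body.preZero Body.legVel; fun_prop

lemma continuous_posZero : Continuous B.posZero := by
  have := continuous_postOne (B := B)
  unfold Body.posZero Body.legPos Body.legMid; fun_prop

lemma continuous_postZero : Continuous B.postZero := by
  have := continuous_preZero (B := B)
  unfold Body.postZero; fun_prop

lemma continuous_preOne : Continuous B.preOne := by
  have := continuous_postZero (B := B)
  unfold Body.preOne Body.legVel; fun_prop

lemma isClosed_cycle : IsClosed {p | B.Cycle p} := by
  have c1 := continuous_postOne (B := B)
  have c2 := continuous_preZero (B := B)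
  have c3 := continuous_posZero (B := B)
  have c4 := continuous_postZero (B := B)
  have h1 : IsClosed {p : CycleData | B.nor 0 p.1 = 0} := isClosed_eq (by fun_prop) (by fun_prop)
  have h2 : IsClosed {p : CycleData | B.Hit 1 p.1 (p.2.1 0) (B.postOne p)} :=
    isClosed_hit (by fun_prop) c1 (by fun_prop)
  have h3 : IsClosed {p : CycleData | 0 ≤ B.nor 0 (B.postOne p)} :=
    isClosed_le (by fun_prop) (by fun_prop)
  have h4 : IsClosed {p : CycleData |
      B.Leg 1 0 0 (B.postOne p) (p.2.1 1) (p.2.1 2) (p.2.2 0) (p.2.2 1)} :=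
    isClosed_leg (by fun_prop) c1 (by fun_prop) (by fun_prop) (by fun_prop) (by fun_prop)
  have h5 : IsClosed {p : CycleData | B.nor 0 (B.preZero p) ≤ 0} :=
    isClosed_le (by fun_prop) (by fun_prop)
  have h6 : IsClosed {p : CycleData | B.Hit 0 (B.preZero p) (p.2.1 3) (B.postZero p)} :=
    isClosed_hit c2 c4 (by fun_prop)
  have h7 : IsClosed {p : CycleData | 0 ≤ B.nor 1 (B.postZero p)} :=
    isClosed_le (by fun_prop) (by fun_prop)
  have h8 : IsClosed {p : CycleData |
      B.Leg 0 1 (B.posZero p) (B.postZero p) (p.2.1 4) (p.2.1 5) (p.2.2 2) (p.2.2 3)} :=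
    isClosed_leg c3 c4 (by fun_prop) (by fun_prop) (by fun_prop) (by fun_prop)
  convert h1.inter (h2.inter (h3.inter (h4.inter (h5.inter (h6.inter
    ((isClosed_imp_const (P := B.nor 1 B.free ≤ 0) h7).inter h8)))))) using 1
  ext p
  exact ⟨fun h => ⟨h.1, h.2, h.3, h.4, h.5, h.6, h.7, h.8⟩,
    fun ⟨a, b, c, d, e, f, g, h⟩ => ⟨a, b, c, d, e, f, g, h⟩⟩

/-- Upper bound for the duration of a flight with downward acceleration at least `β`. -/
lemma duration_bound {β T Z N D : ℝ} (hβ : 0 < β) (hZ : 0 ≤ Z) (hN : 0 ≤ N) (hD : 0 ≤ D)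
    (h : β / 2 * T ^ 2 ≤ Z * D ^ 2 + T * (N * D)) : T ≤ (2 / β * (N + Z) + 1) * D := by
  by_contra hcon
  push Not at hcon
  have h0 : 0 ≤ 2 / β * (N + Z) * D := by positivity
  have h1 : D < T := by linarith
  have hT : 0 < T := by linarith
  have h2 : (N + Z) * D < β / 2 * T := by
    have h3 : β / 2 * (2 / β * (N + Z) * D) = (N + Z) * D := by field_simp
    rw [← h3]
    exact mul_lt_mul_of_pos_left (by linarith) (by positivity)
  have h4 := mul_lt_mul_of_pos_left h2 hT
  have h5 : Z * D * D ≤ Z * D * T := mul_le_mul_of_nonneg_left h1.le (by positivity)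
  linarith

lemma norm_smul_le_of_le {s r A : ℝ} {a : Config} (h0 : 0 ≤ s) (h1 : s ≤ r) (h2 : ‖a‖ ≤ A) :
    ‖s • a‖ ≤ r * A := by
  rw [norm_smul, Real.norm_eq_abs, abs_of_nonneg h0]
  exact mul_le_mul h1 h2 (norm_nonneg _) (h0.trans h1)

lemma Body.Leg.vel_bounds {i j : Fin 2} {q w v : Config} {c c' : ℝ × ℝ} {t t' A F τ : ℝ}
    (h : B.Leg i j q w c c' t t') (hA : ∀ c, B.UnitCone i c → ‖B.acc i c‖ ≤ A)
    (hτ : t + t' ≤ τ) (hw : ‖w - v‖ ≤ F) :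
    ‖w + t • B.acc i c - v‖ ≤ F + τ * A ∧ ‖B.legVel i w c c' t t' - v‖ ≤ F + τ * A + τ * A := by
  have h0 := h.nonneg
  have h1 := h.nonneg'
  have e1 : ‖w + t • B.acc i c - v‖ ≤ F + τ * A := by
    rw [show w + t • B.acc i c - v = (w - v) + t • B.acc i c by abel]
    exact (norm_add_le _ _).trans
      (add_le_add hw (norm_smul_le_of_le h0 (by linarith) (hA c h.cone)))
  refine ⟨e1, ?_⟩
  rw [show B.legVel i w c c' t t' - v = (w + t • B.acc i c - v) + t' • B.acc i c' by
    rw [Body.legVel]; abel]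
  exact (norm_add_le _ _).trans
    (add_le_add e1 (norm_smul_le_of_le h1 (by linarith) (hA c' h.cone')))

/-- The bounds of `cycle_bounds` up to the impact at contact 1. -/
lemma cycle_bounds_first (H : B.Regular) : ∃ τ > 0, ∃ E > 0, ∀ p, B.Cycle p → B.nor 1 p.1 = -1 →
    p.2.2 0 + p.2.2 1 ≤ τ ∧ ‖B.postOne p - p.1‖ ≤ E ∧
    ‖B.postOne p + p.2.2 0 • B.acc 1 (p.2.1 1) - p.1‖ ≤ E ∧ ‖B.preZero p - p.1‖ ≤ E ∧
    ‖B.postZero p - p.1‖ ≤ E := by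
  obtain ⟨D, hD, hDb⟩ := unitCone_norm_le H.painleve
  obtain ⟨A, hA, hAb⟩ := acc_norm_le H.painleve
  obtain ⟨β, hβ, hβb⟩ := nor_acc_le H
  obtain ⟨K, hK, hKb⟩ := coords_le_norm B
  obtain ⟨τ, hτ⟩ : ∃ τ, τ = 2 / β * (K * D + 0) + 1 := ⟨_, rfl⟩
  have hτ0 : 0 < τ := by rw [hτ]; positivity
  obtain ⟨F, hF⟩ : ∃ F, F = D + τ * A + τ * A := ⟨_, rfl⟩
  have hF0 : 0 < F := by rw [hF]; positivity
  have hτA : 0 < τ * A := by positivity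
  have hKFD : 0 < K * F * D := by positivity
  refine ⟨τ, hτ0, F + K * F * D, by positivity, fun p hp hn => ?_⟩
  have e1 : ‖B.postOne p - p.1‖ ≤ D := by
    rw [show B.postOne p - p.1 = B.push 1 (p.2.1 0) by rw [Body.postOne, hn]; module]
    exact (hDb 1 _ hp.hit_one.1).2
  have hdur : p.2.2 0 + p.2.2 1 ≤ τ := by
    have h1 := hp.leg_zero.duration_le fun c hc => hβb 1 0 (by decide) c hc
    have h2 : B.nor 0 (B.postOne p) ≤ K * D := by
      have : B.nor 0 (B.postOne p) = B.nor 0 (B.postOne p - p.1) := by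
        rw [nor_sub, hp.section_zero, sub_zero]
      rw [this]
      exact (le_abs_self _).trans (((hKb _).1 0).trans (mul_le_mul_of_nonneg_left e1 hK.le))
    have h3 := mul_le_mul_of_nonneg_left h2 (add_nonneg hp.leg_zero.nonneg hp.leg_zero.nonneg')
    rw [nor_zero, zero_add] at h1
    have := duration_bound (Z := 0) (N := K * D) (D := 1) hβ le_rfl (by positivity) zero_le_one
      (by rw [zero_mul, zero_add, mul_one]; exact h1.trans h3)
    rw [hτ]; simpa using this
  obtain ⟨e2, e3⟩ := hp.leg_zero.vel_bounds (fun c hc => hAb 1 c hc) hdur e1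
  change ‖B.preZero p - p.1‖ ≤ _ at e3
  rw [← hF] at e3
  refine ⟨hdur, by linarith, by linarith, by linarith, ?_⟩
  rw [show B.postZero p - p.1 = (B.preZero p - p.1) -
      B.nor 0 (B.preZero p) • B.push 0 (p.2.1 3) by rw [Body.postZero]; abel]
  refine (norm_sub_le _ _).trans (add_le_add e3 ?_)
  rw [norm_smul, Real.norm_eq_abs]
  have h0 : B.nor 0 (B.preZero p) = B.nor 0 (B.preZero p - p.1) := by
    rw [nor_sub, hp.section_zero, sub_zero]
  have h1 : |B.nor 0 (B.preZero p)| ≤ K * F := by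
    rw [h0]; exact ((hKb _).1 0).trans (mul_le_mul_of_nonneg_left e3 hK.le)
  exact mul_le_mul h1 (hDb 0 _ hp.hit_zero.1).2 (norm_nonneg _) (by positivity)

/-- The velocities of the events of a normalized cycle differ from the initial one by a bounded
amount, whatever the initial horizontal velocity. -/
lemma cycle_bounds (H : B.Regular) : ∃ M > 0, ∀ p, B.Cycle p → B.nor 1 p.1 = -1 →
    (∀ i, ‖p.2.1 i‖ ≤ M) ∧ (∀ i, |p.2.2 i| ≤ M) ∧ ‖B.postOne p - p.1‖ ≤ M ∧
    ‖B.postOne p + p.2.2 0 • B.acc 1 (p.2.1 1) - p.1‖ ≤ M ∧ ‖B.preZero p - p.1‖ ≤ M ∧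
    ‖B.postZero p - p.1‖ ≤ M ∧ ‖B.postZero p + p.2.2 2 • B.acc 0 (p.2.1 4) - p.1‖ ≤ M ∧
    ‖B.preOne p - p.1‖ ≤ M := by
  obtain ⟨D, hD, hDb⟩ := unitCone_norm_le H.painleve
  obtain ⟨A, hA, hAb⟩ := acc_norm_le H.painleve
  obtain ⟨β, hβ, hβb⟩ := nor_acc_le H
  obtain ⟨K, hK, hKb⟩ := coords_le_norm B
  obtain ⟨τ, hτ, E, hE, h⟩ := cycle_bounds_first H
  obtain ⟨Z, hZ⟩ : ∃ Z, Z = τ ^ 2 / 2 * max (B.nor 1 B.free) 0 := ⟨_, rfl⟩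
  have hZ0 : 0 ≤ Z := by rw [hZ]; positivity
  obtain ⟨τ', hτ'⟩ : ∃ τ', τ' = 2 / β * (K * E + Z) + 1 := ⟨_, rfl⟩
  have hτ'0 : 0 < τ' := by rw [hτ']; positivity
  have hτA : 0 < τ' * A := by positivity
  refine ⟨D + τ + E + τ' + (E + τ' * A + τ' * A), by positivity, fun p hp hn => ?_⟩
  obtain ⟨hdur, e1, e2, e3, e4⟩ := h p hp hn
  have n0 := hp.leg_zero.nonneg
  have n1 := hp.leg_zero.nonneg'
  have n2 := hp.leg_one.nonneg
  have n3 := hp.leg_one.nonneg'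
  have hdur' : p.2.2 2 + p.2.2 3 ≤ τ' := by
    have h1 := hp.leg_one.duration_le fun c hc => hβb 0 1 (by decide) c hc
    have h2 : B.nor 1 (B.postZero p) ≤ K * E := by
      have h0 : B.nor 1 (B.postZero p) = -1 + B.nor 1 (B.postZero p - p.1) := by
        rw [nor_sub, hn]; ring
      have h3 := (le_abs_self _).trans (((hKb (B.postZero p - p.1)).1 1).trans
        (mul_le_mul_of_nonneg_left e4 hK.le))
      rw [h0]; linarith
    have h3 : B.nor 1 (B.posZero p) ≤ Z := by
      have h4 := (hp.leg_zero.nor_self (nor_zero 1) hp.hit_one.nor_eq).1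
      rw [Body.posZero, h4, hZ]
      refine mul_le_mul_of_nonneg_right ?_ (le_max_right _ _)
      have := pow_le_pow_left₀ (add_nonneg n0 n1) hdur 2
      linarith
    have h5 := mul_le_mul_of_nonneg_left h2 (add_nonneg n2 n3)
    have := duration_bound (T := p.2.2 2 + p.2.2 3) (Z := Z) (N := K * E) (D := 1) hβ hZ0 (by positivity) zero_le_one
      (by rw [one_pow, mul_one, mul_one]; exact h1.trans (add_le_add h3 h5))
    rw [hτ']; simpa using this
  obtain ⟨e5, e6⟩ := hp.leg_one.vel_bounds (fun c hc => hAb 0 c hc) hdur' e4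
  change ‖B.preOne p - p.1‖ ≤ _ at e6
  refine ⟨fun i => ?_, fun i => ?_, by linarith, by linarith, by linarith, by linarith,
    by linarith, by linarith⟩
  · have : ‖p.2.1 i‖ ≤ D := by
      match i with
      | 0 => exact (hDb 1 _ hp.hit_one.1).1
      | 1 => exact (hDb 1 _ hp.leg_zero.cone).1
      | 2 => exact (hDb 1 _ hp.leg_zero.cone').1
      | 3 => exact (hDb 0 _ hp.hit_zero.1).1
      | 4 => exact (hDb 0 _ hp.leg_one.cone).1
      | 5 => exact (hDb 0 _ hp.leg_one.cone').1
    linarith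
  · match i with
    | 0 => rw [abs_of_nonneg n0]; linarith
    | 1 => rw [abs_of_nonneg n1]; linarith
    | 2 => rw [abs_of_nonneg n2]; linarith
    | 3 => rw [abs_of_nonneg n3]; linarith

/-! ### Uniform contraction of the cycles -/

lemma Body.Cycle.nor_postOne {p : CycleData} (h : B.Cycle p) : B.nor 1 (B.postOne p) = 0 :=
  h.hit_one.nor_eq

lemma Body.Cycle.nor_postZero {p : CycleData} (h : B.Cycle p) : B.nor 0 (B.postZero p) = 0 :=
  h.hit_zero.nor_eq

lemma Body.Cycle.nor_one_posZero {p : CycleData} (h : B.Cycle p) :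
    B.nor 1 (B.posZero p) = (p.2.2 0 + p.2.2 1) ^ 2 / 2 * max (B.nor 1 B.free) 0 :=
  (h.leg_zero.nor_self (nor_zero 1) h.nor_postOne).1

lemma Body.Cycle.nor_one_preZero {p : CycleData} (h : B.Cycle p) :
    B.nor 1 (B.preZero p) = (p.2.2 0 + p.2.2 1) * max (B.nor 1 B.free) 0 :=
  (h.leg_zero.nor_self (nor_zero 1) h.nor_postOne).2

/-- The flights of a cycle that returns to the section with a downward velocity have positive
durations. -/
lemma Body.Cycle.duration_pos (H : B.Regular) {p : CycleData} (h : B.Cycle p)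
    (hd : B.nor 1 (B.preOne p) < 0) : 0 < p.2.2 0 + p.2.2 1 ∧ 0 < p.2.2 2 + p.2.2 3 := by
  have n0 := h.leg_zero.nonneg
  have n1 := h.leg_zero.nonneg'
  have n2 := h.leg_one.nonneg
  have n3 := h.leg_one.nonneg'
  have hz : p.2.2 0 + p.2.2 1 = 0 → B.nor 1 (B.postZero p) = 0 ∧ B.nor 1 (B.posZero p) = 0 := by
    intro hT
    have e0 : p.2.2 0 = 0 := by linarith
    have e1 : p.2.2 1 = 0 := by linarith
    have e2 : B.preZero p = B.postOne p := by simp [Body.preZero, Body.legVel, e0, e1]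
    have e3 : B.nor 0 (B.preZero p) = 0 :=
      le_antisymm h.fall_zero (by rw [e2]; exact h.rise_zero)
    refine ⟨?_, by rw [h.nor_one_posZero, hT]; simp⟩
    rw [Body.postZero, e3, e2, zero_smul, sub_zero, h.nor_postOne]
  have h2 : 0 < p.2.2 2 + p.2.2 3 := by
    refine lt_of_le_of_ne (add_nonneg n2 n3) fun hT => ?_
    have e2 : p.2.2 2 = 0 := by linarith
    have e3 : p.2.2 3 = 0 := by linarith
    have e4 : B.preOne p = B.postZero p := by simp [Body.preOne, Body.legVel, e2, e3]
    rw [e4] at hd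
    rcases le_or_gt (B.nor 1 B.free) 0 with hf | hf
    · exact absurd (h.rise_one hf) hd.not_ge
    · have hl := h.leg_one.land
      rw [legPos_nor, legMid_nor, e2, e3, h.nor_one_posZero, max_eq_left hf.le] at hl
      have : (p.2.2 0 + p.2.2 1) ^ 2 = 0 := by
        have h3 : (p.2.2 0 + p.2.2 1) ^ 2 * B.nor 1 B.free = 0 := by linarith
        exact (mul_eq_zero.1 h3).resolve_right hf.ne'
      have h4 := (hz (pow_eq_zero_iff (by norm_num) |>.1 this)).1
      linarith
  refine ⟨lt_of_le_of_ne (add_nonneg n0 n1) fun hT => ?_, h2⟩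
  obtain ⟨e1, e2⟩ := hz hT.symm
  exact (h.leg_one.start_pos H (by decide) h2 e2).ne' e1

/-- A cycle which returns with a downward velocity is an iterate of the Poincaré map. -/
lemma Body.Cycle.poincareMap (H : B.Regular) {p : CycleData} (h : B.Cycle p)
    (hp : B.nor 1 p.1 < 0) (hd : B.nor 1 (B.preOne p) < 0) :
    ∃ q₁, B.PoincareMap 0 p.1 q₁ (B.preOne p) := by
  obtain ⟨hT, hT'⟩ := h.duration_pos H hd
  obtain ⟨C₁, -, hC₁⟩ := acc_norm_le H.painleve
  have h01 : (0 : Fin 2) ≠ 1 := by decide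
  have hmax : 0 ≤ max (B.nor 1 B.free) 0 := le_max_right _ _
  have hq1 : 0 ≤ B.nor 1 (B.posZero p) := by rw [h.nor_one_posZero]; positivity
  have hv1 : 0 ≤ B.nor 1 (B.preZero p) := by rw [h.nor_one_preZero]; positivity
  have hq0 : B.nor 0 (B.posZero p) = 0 := h.leg_zero.land
  have hv0 : B.nor 0 (B.preZero p) < 0 :=
    h.leg_zero.land_neg H h01.symm hT (nor_zero 0).ge
  have hw1 : B.nor 1 (B.posZero p) = 0 → 0 ≤ B.nor 1 (B.postZero p) := by
    intro h0
    refine h.rise_one ?_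
    rw [h.nor_one_posZero] at h0
    have := (mul_eq_zero.1 h0).resolve_left (by positivity)
    exact max_eq_right_iff.1 this
  obtain ⟨-, q, v, htr, hc, e1, e2, l1, l2, -⟩ := (h.leg_zero.flight H h01.symm (hC₁ 1)
    (nor_zero 1) h.nor_postOne (nor_zero 0).ge (fun _ => h.rise_zero)).proper hT
  obtain ⟨-, q', v', htr', hc', e1', e2', l1', l2', -⟩ := (h.leg_one.flight H h01 (hC₁ 0)
    hq0 h.nor_postZero hq1 hw1).proper hT'
  set T := p.2.2 0 + p.2.2 1 with hTd
  set T' := p.2.2 2 + p.2.2 3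
  have hi : B.Impact (B.posZero p) (B.preZero p) (B.postZero p) :=
    h.hit_zero.impact H.painleve h01 hq0 hv0 hq1 (Or.inr hv1) hw1
  have hi0 : B.Impact 0 p.1 (B.postOne p) :=
    h.hit_one.impact H.painleve h01.symm (nor_zero 1) hp (nor_zero 0).ge
      (Or.inr h.section_zero.ge) fun _ => h.rise_zero
  have hglue := htr.glue hT (I' := Set.Ico 0 T') (fun t ht => ht.1) htr'
    (by rw [e1']; exact l1) l2 (by rw [e1', e2']; exact hi)
  rw [glue_domain hT'.le] at hglue
  have hself := h.leg_one.nor_self hq0 h.nor_postZero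
  rw [max_eq_right H.free_neg.le, mul_zero, mul_zero] at hself
  have hlt : T < T + T' := by linarith
  -- inside a flight the velocity is continuous, and the states are feasible
  have hno : ∀ {S : ℝ} {Q V : ℝ → Config} {t : ℝ} {w : Config},
      B.IsTrajectory (Set.Ico 0 S) Q V → ContinuousOn V (Set.Ico 0 S) → t ∈ Set.Ioo 0 S →
      Tendsto V (𝓝[<] t) (𝓝 w) → ¬ B.Section (Q t) w := by
    intro S Q V t w hQ hV ht hw hs
    have hle : 𝓝[<] t ≤ 𝓝[Set.Ico 0 S] t :=
      nhdsWithin_le_of_mem (mem_of_superset (Ioo_mem_nhdsLT ht.1)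
        fun s hs => ⟨hs.1.le, hs.2.trans ht.2⟩)
    have : Tendsto V (𝓝[<] t) (𝓝 (V t)) := (hV t ⟨ht.1.le, ht.2⟩).mono_left hle
    rw [tendsto_nhds_unique hw this] at hs
    exact absurd ((hQ.feasible ⟨ht.1.le, ht.2⟩ 1).2 hs.2.1) hs.2.2.2.not_ge
  refine ⟨_, ⟨nor_zero 0, nor_zero 1, h.section_zero, hp⟩,
    ⟨hself.1, h.leg_one.land, hself.2, hd⟩, T + T', by linarith, _, _, hglue, ?_, ?_, ?_, ?_, ?_⟩
  · rw [glue_of_lt hT, e1]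
  · rw [glue_of_lt hT, e2]; exact hi0
  · rw [tendsto_glue_right hlt, add_sub_cancel_left]; exact l1'
  · rw [tendsto_glue_right hlt, add_sub_cancel_left]; exact l2'
  · intro t ht w hw
    rcases lt_trichotomy t T with htT | htT | htT
    · rw [tendsto_glue_left htT.le] at hw
      rw [glue_of_lt htT]
      exact hno htr hc ⟨ht.1, htT⟩ hw
    · rw [tendsto_glue_left htT.le, htT] at hw
      intro hs
      rw [tendsto_nhds_unique hw l2] at hs
      exact hv0.ne hs.2.2.1
    · rw [tendsto_glue_right htT] at hw
      rw [glue_of_le htT.le]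
      exact hno htr' hc' ⟨by linarith, by linarith [ht.2]⟩ hw

/-- The growth map of the body takes values less than one wherever the reduced map is defined. -/
def Body.Contracting (B : Body) : Prop :=
  ∀ ϕ ∈ Set.Ioo (-(Real.pi / 2)) (Real.pi / 2),
    (∃ ϕ', B.ReducedMap ϕ ϕ') → ∀ g, B.GrowthMap ϕ g → g < 1

lemma Body.Cycle.gain_lt_one (H : B.Regular) (hG : B.Contracting) {p : CycleData} (h : B.Cycle p)
    (hp : B.nor 1 p.1 = -1) : -B.nor 1 (B.preOne p) < 1 := by
  rcases le_or_gt 0 (B.nor 1 (B.preOne p)) with hd | hd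
  · linarith
  obtain ⟨q₁, hq⟩ := h.poincareMap H (by rw [hp]; norm_num) hd
  have := hG (B.angle p.1) ⟨Real.neg_pi_div_two_lt_arctan _, Real.arctan_lt_pi_div_two _⟩
    ⟨_, _, _, _, _, hq, rfl, rfl⟩ _ ⟨_, _, _, _, hq, rfl, rfl⟩
  rwa [hp, abs_neg, abs_one, div_one, abs_of_neg hd] at this

/-- At a slipping contact, the friction law does not see a change of the horizontal velocity
that does not reverse the slip. -/
lemma coulomb_shift (hc : ∀ i, Real.cos (B.φ i) ≠ 0) {σ : ℝ} (hσ : σ = 1 ∨ σ = -1) {i : Fin 2}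
    {c : ℝ × ℝ} {w e : Config} {r : ℝ} (he : B.nor i e = 0) (he' : B.hor e = 1)
    (hw : B.nor i w = 0) (h0 : 0 < σ * B.hor w) (h1 : 0 ≤ σ * (B.hor w - r))
    (h : B.Coulomb i c (B.tan i w)) : B.Coulomb i c (B.tan i (w - r • e)) := by
  rw [tan_eq_hor_div hc hw] at h
  rw [eq_slipRay_of_coulomb hc hσ h0 h, tan_eq_hor_div hc (by rw [nor_sub, nor_smul, hw, he]; ring)]
  refine coulomb_slipRay hc hσ i _ ?_
  rwa [hor_sub, hor_smul, he', mul_one]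

lemma Body.Hit.shift (hc : ∀ i, Real.cos (B.φ i) ≠ 0) {σ : ℝ} (hσ : σ = 1 ∨ σ = -1) {i : Fin 2}
    {c : ℝ × ℝ} {v w e : Config} {r : ℝ} (he : B.nor i e = 0) (he' : B.hor e = 1)
    (h0 : 0 < σ * B.hor w) (h1 : 0 ≤ σ * (B.hor w - r)) (h : B.Hit i v c w) :
    B.Hit i (v - r • e) c (w - r • e) := by
  refine ⟨h.1, ?_, coulomb_shift hc hσ he he' h.nor_eq h0 h1 h.2.2⟩
  rw [nor_sub, nor_smul, he, mul_zero, sub_zero, h.2.1]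
  abel

lemma legVel_sub (i : Fin 2) (w x : Config) (c c' : ℝ × ℝ) (t t' : ℝ) :
    B.legVel i (w - x) c c' t t' = B.legVel i w c c' t t' - x := by
  simp only [Body.legVel]; abel

lemma Body.Leg.shift (hc : ∀ i, Real.cos (B.φ i) ≠ 0) {σ : ℝ} (hσ : σ = 1 ∨ σ = -1)
    {i j : Fin 2} {c c' : ℝ × ℝ} {q q' w e : Config} {t t' r : ℝ} (h : B.Leg i j q w c c' t t')
    (he : ∀ i, B.nor i e = 0) (he' : B.hor e = 1) (hq : B.nor j q' = B.nor j q)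
    (hw : B.nor i w = 0)
    (hs : ∀ u ∈ ({w, w + t • B.acc i c, B.legVel i w c c' t t'} : Set Config),
      0 < σ * B.hor u ∧ 0 ≤ σ * (B.hor u - r)) :
    B.Leg i j q' (w - r • e) c c' t t' where
  nonneg := h.nonneg
  nonneg' := h.nonneg'
  cone := h.cone
  cone' := h.cone'
  coulomb hg := by
    obtain ⟨h1, h2, h3, h4⟩ := h.coulomb hg
    have e1 : B.nor i (w + t • B.acc i c) = 0 := by
      rw [nor_add, nor_smul, hw, nor_acc_self h.cone, max_eq_right hg.le]; ring
    have e2 : B.nor i (B.legVel i w c c' t t') = 0 := by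
      rw [legVel_nor, hw, nor_acc_self h.cone, nor_acc_self h.cone', max_eq_right hg.le]; ring
    obtain ⟨s1, s1'⟩ := hs w (by simp)
    obtain ⟨s2, s2'⟩ := hs (w + t • B.acc i c) (by simp)
    obtain ⟨s3, s3'⟩ := hs (B.legVel i w c c' t t') (by simp)
    rw [legVel_sub, sub_add_eq_add_sub]
    exact ⟨coulomb_shift hc hσ (he i) he' hw s1 s1' h1, coulomb_shift hc hσ (he i) he' e1 s2 s2' h2,
      coulomb_shift hc hσ (he i) he' e1 s2 s2' h3, coulomb_shift hc hσ (he i) he' e2 s3 s3' h4⟩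
  mid := by
    have := h.mid
    rw [legMid_nor] at this ⊢
    rwa [hq, nor_sub, nor_smul, he, mul_zero, sub_zero]
  land := by
    have := h.land
    rw [legPos_nor, legMid_nor] at this ⊢
    rwa [hq, nor_sub, nor_smul, he, mul_zero, sub_zero]

/-- A cycle during which the body slips in one direction can be slowed down horizontally. -/
lemma Body.Cycle.shift (hc : ∀ i, Real.cos (B.φ i) ≠ 0) {σ : ℝ} (hσ : σ = 1 ∨ σ = -1)
    {p : CycleData} (h : B.Cycle p) {e : Config} {r : ℝ} (he : ∀ i, B.nor i e = 0)
    (he' : B.hor e = 1)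
    (hs : ∀ u ∈ ({B.postOne p, B.postOne p + p.2.2 0 • B.acc 1 (p.2.1 1), B.preZero p,
      B.postZero p, B.postZero p + p.2.2 2 • B.acc 0 (p.2.1 4), B.preOne p} : Set Config),
      0 < σ * B.hor u ∧ 0 ≤ σ * (B.hor u - r)) :
    B.Cycle (p.1 - r • e, p.2) ∧ B.preOne (p.1 - r • e, p.2) = B.preOne p - r • e := by
  have hn : ∀ i (w : Config), B.nor i (w - r • e) = B.nor i w := fun i w => by
    rw [nor_sub, nor_smul, he, mul_zero, sub_zero]
  have e1 : B.postOne (p.1 - r • e, p.2) = B.postOne p - r • e := by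
    simp only [Body.postOne, hn]; abel
  have e2 : B.preZero (p.1 - r • e, p.2) = B.preZero p - r • e := by
    simp only [Body.preZero, e1, legVel_sub]
  have e3 : B.postZero (p.1 - r • e, p.2) = B.postZero p - r • e := by
    simp only [Body.postZero, e2, hn]; abel
  have e4 : B.preOne (p.1 - r • e, p.2) = B.preOne p - r • e := by
    simp only [Body.preOne, e3, legVel_sub]
  have e5 : B.nor 1 (B.posZero (p.1 - r • e, p.2)) = B.nor 1 (B.posZero p) := by
    simp only [Body.posZero, legPos_nor, legMid_nor, e1, hn]
  refine ⟨⟨?_, ?_, ?_, ?_, ?_, ?_, ?_, ?_⟩, e4⟩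
  · rw [hn]; exact h.section_zero
  · rw [e1]
    exact h.hit_one.shift hc hσ (he 1) he' (hs _ (by simp)).1 (hs _ (by simp)).2
  · rw [e1, hn]; exact h.rise_zero
  · rw [e1]
    refine h.leg_zero.shift hc hσ he he' rfl h.nor_postOne fun u hu => hs u ?_
    simp only [Set.mem_insert_iff, Set.mem_singleton_iff] at hu ⊢
    rcases hu with rfl | rfl | rfl
    · simp
    · simp
    · exact Or.inr (Or.inr (Or.inl rfl))
  · rw [e2, hn]; exact h.fall_zero
  · rw [e2, e3]
    exact h.hit_zero.shift hc hσ (he 0) he' (hs _ (by simp)).1 (hs _ (by simp)).2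
  · rw [e3, hn]; exact h.rise_one
  · rw [e3]
    refine h.leg_one.shift hc hσ he he' e5 h.nor_postZero fun u hu => hs u ?_
    simp only [Set.mem_insert_iff, Set.mem_singleton_iff] at hu ⊢
    rcases hu with rfl | rfl | rfl
    · simp
    · simp
    · exact Or.inr (Or.inr (Or.inr (Or.inr (Or.inr rfl))))

/-- The gain of normalized cycles is bounded away from one. Cycles of bounded horizontal velocity
form a compact set, and the others have the gain of a slower cycle. -/
lemma exists_contraction (H : B.Regular) (hG : B.Contracting) : ∃ γ, 0 ≤ γ ∧ γ < 1 ∧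
    ∀ p, B.Cycle p → B.nor 1 p.1 = -1 → -B.nor 1 (B.preOne p) ≤ γ := by
  obtain ⟨M, hM, hb⟩ := cycle_bounds H
  obtain ⟨K, hK, hKb⟩ := coords_le_norm B
  obtain ⟨L, hL, hLb⟩ := norm_le_coords H.cos_ne
  obtain ⟨e, he, he'⟩ := exists_horizontal (B := B) H.cos_ne
  set S := K * M with hS
  set X : Set CycleData := {p | B.Cycle p} ∩ ({p | B.nor 1 p.1 = -1} ∩ {p | |B.hor p.1| ≤ S})
    with hX
  have hXc : IsCompact X := by
    refine Metric.isCompact_of_isClosed_isBounded ?_ ?_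
    · exact isClosed_cycle.inter ((isClosed_eq (by fun_prop) (by fun_prop)).inter
        (isClosed_le (by fun_prop) (by fun_prop)))
    · refine (isBounded_iff_forall_norm_le).2 ⟨max (L * (1 + S)) M, ?_⟩
      rintro p ⟨h1, h2, h3⟩
      obtain ⟨b1, b2, -⟩ := hb p h1 h2
      refine norm_prod_le_iff.2 ⟨le_max_of_le_left ?_, le_max_of_le_right (norm_prod_le_iff.2 ⟨?_, ?_⟩)⟩
      · refine (hLb p.1).trans (mul_le_mul_of_nonneg_left ?_ hL.le)
        have h2' : B.nor 1 p.1 = -1 := h2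
        have h3' : |B.hor p.1| ≤ S := h3
        rw [h1.section_zero, h2', abs_zero, abs_neg, abs_one]
        linarith
      · exact (pi_norm_le_iff_of_nonneg hM.le).2 b1
      · exact (pi_norm_le_iff_of_nonneg hM.le).2 b2
  have hsmall : ∃ γ, 0 ≤ γ ∧ γ < 1 ∧ ∀ p ∈ X, -B.nor 1 (B.preOne p) ≤ γ := by
    rcases X.eq_empty_or_nonempty with h | h
    · exact ⟨0, le_rfl, one_pos, by simp [h]⟩
    · have hcont : ContinuousOn (fun p => -B.nor 1 (B.preOne p)) X := by
        have := continuous_preOne (B := B)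
        fun_prop
      obtain ⟨p₀, hp₀, hmax⟩ := hXc.exists_isMaxOn h hcont
      refine ⟨max (-B.nor 1 (B.preOne p₀)) 0, le_max_right _ _,
        max_lt (hp₀.1.gain_lt_one H hG hp₀.2.1) one_pos, fun p hp => le_max_of_le_left (hmax hp)⟩
  obtain ⟨γ, h0, h1, hγ⟩ := hsmall
  refine ⟨γ, h0, h1, fun p hp hn => ?_⟩
  rcases le_or_gt |B.hor p.1| S with hle | hlt
  · exact hγ p ⟨hp, hn, hle⟩
  obtain ⟨σ, hσ, hσp⟩ : ∃ σ : ℝ, (σ = 1 ∨ σ = -1) ∧ σ * B.hor p.1 = |B.hor p.1| := by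
    rcases le_total 0 (B.hor p.1) with h | h
    · exact ⟨1, Or.inl rfl, by rw [abs_of_nonneg h, one_mul]⟩
    · exact ⟨-1, Or.inr rfl, by rw [abs_of_nonpos h]; ring⟩
  have hσσ : σ * σ = 1 := by rcases hσ with rfl | rfl <;> norm_num
  -- The shifted cycle has the horizontal velocity `σ * S`. No velocity of the cycle differs from the
  -- initial one by more than `S` horizontally, so that no slip is reversed.
  set r := σ * (|B.hor p.1| - S) with hr
  have hσr : σ * r = |B.hor p.1| - S := by rw [hr, ← mul_assoc, hσσ, one_mul]
  have hclose : ∀ u : Config, ‖u - p.1‖ ≤ M →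
      0 < σ * B.hor u ∧ 0 ≤ σ * (B.hor u - r) := by
    intro u hu
    have h2 : |B.hor (u - p.1)| ≤ S := (hKb _).2.2.trans (mul_le_mul_of_nonneg_left hu hK.le)
    have h3 : σ * B.hor u = |B.hor p.1| + σ * B.hor (u - p.1) := by rw [hor_sub, ← hσp]; ring
    have h4 : |σ * B.hor (u - p.1)| ≤ S := by
      rw [abs_mul]; rcases hσ with rfl | rfl <;> simpa using h2
    have h5 := (abs_le.1 h4).1
    constructor
    · linarith
    · rw [mul_sub, hσr]; linarith
  obtain ⟨-, -, b1, b2, b3, b4, b5, b6⟩ := hb p hp hn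
  obtain ⟨hp', hpre⟩ := hp.shift H.cos_ne hσ (r := r) he he' (by
    intro u hu
    simp only [Set.mem_insert_iff, Set.mem_singleton_iff] at hu
    rcases hu with rfl | rfl | rfl | rfl | rfl | rfl
    exacts [hclose _ b1, hclose _ b2, hclose _ b3, hclose _ b4, hclose _ b5, hclose _ b6])
  have hnn : ∀ i (w : Config), B.nor i (w - r • e) = B.nor i w := fun i w => by
    rw [nor_sub, nor_smul, he, mul_zero, sub_zero]
  have := hγ (p.1 - r • e, p.2) ⟨hp', by simpa [hnn] using hn, ?_⟩
  · rwa [hpre, hnn] at this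
  · have h2 : B.hor (p.1 - r • e) = σ * S := by
      rw [hor_sub, hor_smul, he', hr, mul_one]
      have : B.hor p.1 = σ * |B.hor p.1| := by rw [← hσp, ← mul_assoc, hσσ, one_mul]
      nth_rewrite 1 [this]; ring
    change |B.hor (p.1 - r • e)| ≤ S
    rw [h2, abs_mul]
    have hS0 : 0 ≤ S := by positivity
    rcases hσ with rfl | rfl <;> simp [abs_of_nonneg hS0]

lemma Body.Hit.smul {i : Fin 2} {v w : Config} {c : ℝ × ℝ} (h : B.Hit i v c w) {r : ℝ}
    (hr : 0 < r) : B.Hit i (r • v) c (r • w) := by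
  refine ⟨h.1, ?_, ?_⟩
  · rw [h.2.1, nor_smul]; module
  · rw [tan_smul, coulomb_smul hr]; exact h.2.2

/-- Cycles are invariant under the scaling of velocities and durations. -/
lemma Body.Cycle.scale {p : CycleData} (h : B.Cycle p) {r : ℝ} (hr : 0 < r) :
    ∃ p', B.Cycle p' ∧ p'.1 = r • p.1 ∧ (∀ i, p'.2.2 i = r * p.2.2 i) ∧
      B.postOne p' = r • B.postOne p ∧ B.preZero p' = r • B.preZero p ∧
      B.postZero p' = r • B.postZero p ∧ B.preOne p' = r • B.preOne p := by
  set p' : CycleData := (r • p.1, p.2.1, fun i => r * p.2.2 i) with hp'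
  have e1 : B.postOne p' = r • B.postOne p := by
    simp only [Body.postOne, hp', nor_smul]; module
  have e2 : B.preZero p' = r • B.preZero p := by
    simp only [Body.preZero, e1, Body.legVel]; simp only [hp']; module
  have e3 : B.postZero p' = r • B.postZero p := by
    simp only [Body.postZero, e2, nor_smul]; simp only [hp']; module
  have e4 : B.preOne p' = r • B.preOne p := by
    simp only [Body.preOne, e3, Body.legVel]; simp only [hp']; module
  have e5 : B.nor 1 (B.posZero p') = r ^ 2 * B.nor 1 (B.posZero p) := by
    simp only [Body.posZero, legPos_nor, legMid_nor, e1, nor_zero, nor_smul]; simp only [hp']; ring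
  refine ⟨p', ⟨?_, ?_, ?_, ?_, ?_, ?_, ?_, ?_⟩, rfl, fun _ => rfl, e1, e2, e3, e4⟩
  · simp only [hp', nor_smul, h.section_zero, mul_zero]
  · rw [e1]; exact h.hit_one.smul hr
  · rw [e1, nor_smul]; exact mul_nonneg hr.le h.rise_zero
  · rw [e1]; exact h.leg_zero.scale hr (by simp)
  · rw [e2, nor_smul]; exact mul_nonpos_of_nonneg_of_nonpos hr.le h.fall_zero
  · rw [e2, e3]; exact h.hit_zero.smul hr
  · intro hf; rw [e3, nor_smul]; exact mul_nonneg hr.le (h.rise_one hf)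
  · rw [e3]; exact h.leg_one.scale hr e5

/-- Uniform bounds for cycles, in terms of the normal velocity `y` before the impact on the
section. -/
lemma cycle_estimates (H : B.Regular) (hG : B.Contracting) : ∃ γ M : ℝ, 0 ≤ γ ∧ γ < 1 ∧ 0 < M ∧
    ∀ (p : CycleData) (y : ℝ), B.Cycle p → 0 < y → B.nor 1 p.1 = -y →
      -B.nor 1 (B.preOne p) ≤ γ * y ∧
      p.2.2 0 + p.2.2 1 ≤ M * y ∧ p.2.2 2 + p.2.2 3 ≤ M * y ∧ ‖B.postOne p - p.1‖ ≤ M * y ∧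
      ‖B.postZero p - p.1‖ ≤ M * y ∧ ‖B.preOne p - p.1‖ ≤ M * y := by
  obtain ⟨γ, h0, h1, hγ⟩ := exists_contraction H hG
  obtain ⟨M, hM, hb⟩ := cycle_bounds H
  refine ⟨γ, 2 * M, h0, h1, by positivity, fun p y hp hy hn => ?_⟩
  obtain ⟨p', hp', e0, et, e1, -, e3, e4⟩ := hp.scale (inv_pos.2 hy)
  have hn' : B.nor 1 p'.1 = -1 := by rw [e0, nor_smul, hn]; field_simp
  obtain ⟨-, b2, b3, -, -, b6, -, b8⟩ := hb p' hp' hn'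
  have hg := hγ p' hp' hn'
  have ht : ∀ i, p.2.2 i ≤ M * y := fun i => by
    have := (le_abs_self _).trans (b2 i)
    rw [et, inv_mul_le_iff₀ hy, mul_comm] at this
    exact this
  have hv : ∀ u : Config, ‖y⁻¹ • u - p'.1‖ ≤ M → ‖u - p.1‖ ≤ 2 * M * y := fun u hu => by
    rw [e0, ← smul_sub, norm_smul, Real.norm_eq_abs, abs_of_pos (inv_pos.2 hy),
      inv_mul_le_iff₀ hy] at hu
    have : 0 < M * y := by positivity
    linarith
  refine ⟨?_, by linarith [ht 0, ht 1], by linarith [ht 2, ht 3], hv _ (e1 ▸ b3), hv _ (e3 ▸ b6),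
    hv _ (e4 ▸ b8)⟩
  rw [e4, nor_smul, ← mul_neg, inv_mul_le_iff₀ hy, mul_comm] at hg
  exact hg

/-! ### Settling of trajectories -/

/-- The position of a trajectory on a bounded time interval has a limit at the end. -/
lemma Body.IsTrajectory.exists_tendsto {T : ℝ} (hT : 0 < T) {q v : ℝ → Config}
    (h : B.IsTrajectory (Set.Ico 0 T) q v) : ∃ q₁, Tendsto q (𝓝[<] T) (𝓝 q₁) := by
  obtain ⟨C, hC, -, hv⟩ := velocity_bound B
  set V := C * (‖v 0‖ + T) with hVd
  have hV0 : 0 ≤ V := by have := norm_nonneg (v 0); positivity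
  have hb : ∀ t, 0 ≤ t → t < T → ‖v t‖ ≤ V := fun t h0 h1 =>
    (hv T q v h t h0 h1).trans (mul_le_mul_of_nonneg_left (by linarith) (by linarith))
  have hlip : LipschitzOnWith ⟨V, hV0⟩ q (Set.Ico 0 T) := by
    have key : ∀ a b, 0 ≤ a → a ≤ b → b < T → ‖q b - q a‖ ≤ V * (b - a) := fun a b h0 h1 h2 =>
      h.dist_le h0 h1 h2 fun t h3 h4 => hb t (h0.trans h3) (by linarith)
    refine LipschitzOnWith.of_dist_le_mul fun x hx y hy => ?_
    rw [dist_eq_norm, Real.dist_eq]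
    change _ ≤ V * _
    rcases le_total y x with hle | hle
    · rw [abs_of_nonneg (by linarith)]; exact key y x hy.1 hle hx.2
    · rw [abs_of_nonpos (by linarith), norm_sub_rev, neg_sub]; exact key x y hx.1 hle hy.2
  have hc : Cauchy (map q (𝓝[<] T)) := by
    have hc' : Cauchy (𝓝[<] T) := cauchy_nhds.mono nhdsWithin_le_nhds
    have hmem : 𝓝[<] T ≤ 𝓟 (Set.Ico 0 T) := le_principal_iff.2
      (mem_of_superset (Ioo_mem_nhdsLT hT) fun s hs => ⟨hs.1.le, hs.2⟩)
    exact hc'.map_of_le hlip.uniformContinuousOn hmem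
  exact cauchy_map_iff_exists_tendsto.1 hc

lemma Body.ProperFlight.bounds {A τ : ℝ} {q₀ v₀ q₁ v₁ : Config} (hA : 0 ≤ A)
    (h : B.ProperFlight A τ q₀ v₀ q₁ v₁) :
    ‖v₁‖ ≤ ‖v₀‖ + A * τ ∧ ‖q₁ - q₀‖ ≤ (‖v₀‖ + A * τ) * τ := by
  obtain ⟨hτ, q, v, htr, -, rfl, rfl, hq, hv, hb⟩ := h
  have hvb : ∀ t, 0 ≤ t → t < τ → ‖v t‖ ≤ ‖v 0‖ + A * τ := fun t h0 h1 => by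
    have h2 := norm_sub_norm_le (v t) (v 0)
    have h3 := hb t ⟨h0, h1⟩
    have h4 := mul_le_mul_of_nonneg_left h1.le hA
    linarith
  have hV : 0 ≤ ‖v 0‖ + A * τ := by positivity
  constructor
  · refine le_of_tendsto hv.norm ?_
    filter_upwards [Ioo_mem_nhdsLT hτ] with s hs using hvb s hs.1.le hs.2
  · refine le_of_tendsto (hq.sub_const (q 0)).norm ?_
    filter_upwards [Ioo_mem_nhdsLT hτ] with s hs
    have := htr.dist_le le_rfl hs.1.le hs.2 fun t h0 h1 => hvb t h0 (h1.trans_lt hs.2)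
    rw [sub_zero] at this
    exact this.trans (mul_le_mul_of_nonneg_left hs.2.le hV)

/-- A trajectory follows the flight that starts in its state at time `t`, until the end of the
flight or of the trajectory. -/
lemma Body.IsTrajectory.follow (H : B.Regular) {T t τ A : ℝ} {q v : ℝ → Config}
    {q₁ v₁ : Config} (h : B.IsTrajectory (Set.Ico 0 T) q v) (ht : 0 ≤ t) (htT : t < T)
    (hF : B.ProperFlight A τ (q t) (v t) q₁ v₁) :
    (∀ s, t ≤ s → s < t + τ → s < T → ‖v s - v t‖ ≤ A * (s - t)) ∧
    ((T ≤ t + τ ∧ ∃ w, Tendsto v (𝓝[<] T) (𝓝 w)) ∨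
      (t + τ < T ∧ q (t + τ) = q₁ ∧ Tendsto v (𝓝[<] (t + τ)) (𝓝 v₁) ∧
        B.Impact (q (t + τ)) v₁ (v (t + τ)))) := by
  obtain ⟨hτ, Q, V, hQV, hVc, hQ0, hV0, hQ1, hV1, hb⟩ := hF
  have heq := (h.shift ht).eqOn H hQV hVc (by simp [hQ0]) (by simp [hV0])
  refine ⟨fun s h1 h2 h3 => ?_, ?_⟩
  · have := (heq (s - t) (by linarith) (lt_min (by linarith) (by linarith))).2
    simp only [add_sub_cancel] at this
    rw [this]
    exact hb (s - t) ⟨by linarith, by linarith⟩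
  have hev : ∀ r, 0 < r → r ≤ min τ (T - t) →
      ∀ᶠ s in 𝓝[<] r, q (t + s) = Q s ∧ v (t + s) = V s := fun r h0 h1 => by
    filter_upwards [Ioo_mem_nhdsLT h0] with s hs using heq s hs.1.le (hs.2.trans_le h1)
  rcases lt_or_ge (t + τ) T with hlt | hge
  · right
    have hev' := hev τ hτ (le_min le_rfl (by linarith))
    have hv : Tendsto v (𝓝[<] (t + τ)) (𝓝 v₁) :=
      tendsto_shift.1 (hV1.congr' (hev'.mono fun s hs => hs.2.symm))
    have hq : Tendsto q (𝓝[<] (t + τ)) (𝓝 q₁) :=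
      tendsto_shift.1 (hQ1.congr' (hev'.mono fun s hs => hs.1.symm))
    have hmem : t + τ ∈ Set.Ico 0 T := ⟨by linarith, hlt⟩
    have hle : 𝓝[<] (t + τ) ≤ 𝓝[Set.Ico 0 T] (t + τ) :=
      nhdsWithin_le_of_mem (mem_of_superset (Ioo_mem_nhdsLT (by linarith : 0 < t + τ))
        fun s hs => ⟨hs.1.le, hs.2.trans hlt⟩)
    obtain ⟨w, hw, hi⟩ := h.impact _ hmem (by linarith)
    rw [tendsto_nhds_unique hw hv] at hi
    exact ⟨hlt, tendsto_nhds_unique ((h.continuousOn _ hmem).mono_left hle) hq, hv, hi⟩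
  · left
    refine ⟨hge, ?_⟩
    have hev' := hev (T - t) (by linarith) (le_min (by linarith) le_rfl)
    have key : ∀ w, Tendsto V (𝓝[<] (T - t)) (𝓝 w) → ∃ w, Tendsto v (𝓝[<] T) (𝓝 w) := by
      intro w hw
      have := tendsto_shift.1 (hw.congr' (hev'.mono fun s hs => hs.2.symm))
      rw [add_sub_cancel] at this
      exact ⟨w, this⟩
    rcases eq_or_lt_of_le hge with he | hlt
    · exact key v₁ (by rw [he, add_sub_cancel_left]; exact hV1)
    · refine key (V (T - t)) ((hVc (T - t) ⟨by linarith, by linarith⟩).mono_left ?_)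
      exact nhdsWithin_le_of_mem (mem_of_superset (Ioo_mem_nhdsLT (by linarith : 0 < T - t))
        fun s hs => ⟨hs.1.le, by linarith [hs.2]⟩)

/-- The velocity of a trajectory on `[0, T)` has a limit at the end, and after the time `t` it takes
at most the time `C` until the body is at rest on both contacts. -/
def Body.Settled (B : Body) (q v : ℝ → Config) (T t C : ℝ) : Prop :=
  (∃ w, Tendsto v (𝓝[<] T) (𝓝 w)) ∧ (t + C < T → ∃ tf, t ≤ tf ∧ tf ≤ t + C ∧
    ∀ s, tf ≤ s → s < T → q s = q tf ∧ v s = 0 ∧ ∀ i, B.nor i (q s) = 0)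

lemma Body.Settled.mono {q v : ℝ → Config} {T t t₀ C C₀ : ℝ} (h : B.Settled q v T t C)
    (ht : t₀ ≤ t) (hC : t + C ≤ t₀ + C₀) : B.Settled q v T t₀ C₀ := by
  refine ⟨h.1, fun hT => ?_⟩
  obtain ⟨tf, h1, h2, h3⟩ := h.2 (by linarith)
  exact ⟨tf, by linarith, by linarith, h3⟩

lemma settled_of_le {q v : ℝ → Config} {T t C : ℝ} (h : ∃ w, Tendsto v (𝓝[<] T) (𝓝 w))
    (hT : T ≤ t + C) : B.Settled q v T t C :=
  ⟨h, fun hlt => absurd hlt hT.not_gt⟩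

/-- All trajectories from the state `(q₀, v₀)` come to rest within the time `C`, without
accumulations of impacts at which the velocity has no limit. -/
def Body.Settles (B : Body) (C : ℝ) (q₀ v₀ : Config) : Prop :=
  ∀ (T : ℝ) (q v : ℝ → Config), 0 < T → B.IsTrajectory (Set.Ico 0 T) q v → q 0 = q₀ → v 0 = v₀ →
    B.Settled q v T 0 C

lemma Body.Settles.settled {C T t : ℝ} {q v : ℝ → Config} (hs : B.Settles C (q t) (v t))
    (h : B.IsTrajectory (Set.Ico 0 T) q v) (ht : 0 ≤ t) (htT : t < T) : B.Settled q v T t C := by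
  obtain ⟨⟨w, hw⟩, h2⟩ := hs (T - t) _ _ (by linarith) (h.shift ht) (by simp) (by simp)
  rw [tendsto_shift, add_sub_cancel] at hw
  refine ⟨⟨w, hw⟩, fun hlt => ?_⟩
  obtain ⟨tf, h3, h4, h5⟩ := h2 (by linarith)
  refine ⟨t + tf, by linarith, by linarith, fun s h6 h7 => ?_⟩
  have := h5 (s - t) (by linarith) (by linarith)
  simpa only [add_sub_cancel] using this

lemma Body.Settles.mono {C C' : ℝ} {q v : Config} (h : B.Settles C q v) (hC : C ≤ C') :
    B.Settles C' q v := fun T Q V hT htr hQ hV => (h T Q V hT htr hQ hV).mono le_rfl (by linarith)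

lemma Body.ProperFlight.settles (H : B.Regular) {A τ C : ℝ} {q₀ v₀ q₁ v₁ : Config}
    (hF : B.ProperFlight A τ q₀ v₀ q₁ v₁) (hC : 0 ≤ C)
    (h : ∀ w, B.Impact q₁ v₁ w → B.Settles C q₁ w) : B.Settles (τ + C) q₀ v₀ := by
  rintro T q v hT htr rfl rfl
  have hτ := hF.1
  rcases (htr.follow H le_rfl hT hF).2 with ⟨h1, h2⟩ | ⟨h1, h2, -, h4⟩
  · exact settled_of_le h2 (by linarith)
  · rw [← h2] at h
    exact ((h _ h4).settled htr (by linarith) h1).mono (by linarith) (by linarith)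

lemma settles_rest (H : B.Regular) {q₀ : Config} (hq : ∀ i, B.nor i q₀ = 0) :
    B.Settles 0 q₀ 0 := by
  rintro T q v hT htr hq0 hv0
  have hF := (flight_rest H (A := 0) le_rfl hT.le hq).proper hT
  rw [← hq0] at hF hq
  have h1 := (htr.follow H (A := 0) (τ := T) le_rfl hT (by rw [hv0]; exact hF)).1
  have hv : ∀ s, 0 ≤ s → s < T → v s = 0 := fun s h2 h3 => by
    have := h1 s h2 (by linarith) h3
    rw [zero_mul, hv0, sub_zero] at this
    exact norm_le_zero_iff.1 this
  refine ⟨⟨0, tendsto_const_nhds.congr' ?_⟩, fun _ => ⟨0, le_rfl, by simp, fun s h2 h3 => ?_⟩⟩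
  · filter_upwards [Ioo_mem_nhdsLT hT] with s hs using (hv s hs.1.le hs.2).symm
  · have h4 := htr.dist_le le_rfl h2 h3 (V := 0) fun t h5 h6 => by
      rw [hv t h5 (by linarith), norm_zero]
    rw [zero_mul] at h4
    have h5 : q s = q 0 := sub_eq_zero.1 (norm_le_zero_iff.1 h4)
    exact ⟨h5, hv s h2 h3, fun i => by rw [h5]; exact hq i⟩

/-- A body with two sustained contacts slips until it stops. -/
lemma settles_closed (H : B.Regular) : ∃ K > 0, ∀ q v : Config, (∀ i, B.nor i q = 0) →
    (∀ i, B.nor i v = 0) → B.Settles (K * ‖v‖) q v := by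
  obtain ⟨A, K, -, hK, h⟩ := exists_slip_flight H
  refine ⟨K, hK, fun q v hq hv => ?_⟩
  obtain ⟨τ, q₁, hτ, hF, hq₁⟩ := h q v hq hv
  rcases hF with ⟨rfl, rfl, rfl⟩ | hF
  · exact (settles_rest H hq).mono hτ
  · have := hF.settles H le_rfl fun w hw => by
      rw [hw.eq_of_feasible fun i => ⟨(hq₁ i).ge, fun _ => (nor_zero i).ge⟩]
      exact settles_rest H hq₁
    exact this.mono (by linarith)

/-- Flights on one contact, from states of size `D`. -/
lemma exists_leg_flight (H : B.Regular) : ∃ A C : ℝ, 0 ≤ A ∧ 1 ≤ C ∧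
    ∀ (i j : Fin 2) (q w : Config) (D : ℝ), i ≠ j → B.nor i q = 0 → B.nor i w = 0 →
      0 ≤ B.nor j q → (0 < B.nor j q ∨ 0 < B.nor j w) → B.nor j q ≤ D ^ 2 → ‖w‖ ≤ D →
      ∃ c c' t t', B.Leg i j q w c c' t t' ∧ 0 < t + t' ∧ t + t' ≤ C * D ∧
        B.ProperFlight A (t + t') q w (B.legPos i q w c c' t t') (B.legVel i w c c' t t') ∧
        B.nor j (B.legVel i w c c' t t') < 0 ∧ 0 ≤ B.nor i (B.legPos i q w c c' t t') ∧
        0 ≤ B.nor i (B.legVel i w c c' t t') ∧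
        B.nor i (B.legPos i q w c c' t t') ≤ (C * D) ^ 2 ∧ ‖B.legVel i w c c' t t'‖ ≤ C * D := by
  obtain ⟨A, hA, hAb⟩ := acc_norm_le H.painleve
  obtain ⟨β, hβ, hβb⟩ := nor_acc_le H
  obtain ⟨K, hK, hKb⟩ := coords_le_norm B
  set κ := 2 / β * (K + 1) + 1 with hκ
  have hκ0 : 0 < κ := by positivity
  set F := |B.nor 0 B.free| + |B.nor 1 B.free| with hF
  have hF0 : 0 ≤ F := by positivity
  set C := κ + (1 + A * κ) + κ * (F + 1) with hC
  have h1 : κ ≤ C := by have : 0 ≤ A * κ := by positivity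
                        have : 0 ≤ κ * (F + 1) := by positivity
                        linarith
  have h2 : 1 + A * κ ≤ C := by have : 0 ≤ κ * (F + 1) := by positivity
                                linarith
  have h3 : κ * (F + 1) ≤ C := by have : 0 ≤ A * κ := by positivity
                                  linarith
  have h4 : 1 ≤ C := by have : 0 ≤ A * κ := by positivity
                        linarith
  refine ⟨A, C, hA.le, h4, fun i j q w D hij hiq hiw hj ho hq hw => ?_⟩
  have hD : 0 ≤ D := (norm_nonneg w).trans hw
  have hj' : B.nor j q = 0 → 0 ≤ B.nor j w := fun h =>
    (ho.resolve_left (by rw [h]; exact lt_irrefl _)).le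
  obtain ⟨c, c', t, t', hleg, hT⟩ := exists_leg H hij hj ho
  have hTD : t + t' ≤ κ * D := by
    have e1 := hleg.duration_le fun c hc => hβb i j hij c hc
    have e2 : B.nor j w ≤ K * D := (le_abs_self _).trans
      (((hKb w).1 j).trans (mul_le_mul_of_nonneg_left hw hK.le))
    refine duration_bound (T := t + t') (Z := 1) (N := K) hβ zero_le_one hK.le hD ?_
    rw [one_mul]
    exact e1.trans (add_le_add hq (mul_le_mul_of_nonneg_left e2 hT.le))
  have hfl := (hleg.flight H hij (hAb i) hiq hiw hj hj').proper hT
  have hself := hleg.nor_self hiq hiw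
  have hmax : 0 ≤ max (B.nor i B.free) 0 := le_max_right _ _
  have hmaxF : max (B.nor i B.free) 0 ≤ F := by
    refine max_le ((le_abs_self _).trans ?_) hF0
    match i with
    | 0 => linarith [abs_nonneg (B.nor 1 B.free)]
    | 1 => linarith [abs_nonneg (B.nor 0 B.free)]
  refine ⟨c, c', t, t', hleg, hT, hTD.trans (mul_le_mul_of_nonneg_right h1 hD), hfl,
    hleg.land_neg H hij hT hj, ?_, ?_, ?_, ?_⟩
  · rw [hself.1]; positivity
  · rw [hself.2]; positivity
  · rw [hself.1]
    have e1 : (t + t') ^ 2 ≤ (κ * D) ^ 2 := pow_le_pow_left₀ hT.le hTD 2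
    have e2 : (t + t') ^ 2 / 2 * max (B.nor i B.free) 0 ≤ (κ * D) ^ 2 * F :=
      mul_le_mul (by linarith [sq_nonneg (t + t')]) hmaxF hmax (by positivity)
    have e3 : (κ * (F + 1) * D) ^ 2 ≤ (C * D) ^ 2 :=
      pow_le_pow_left₀ (by positivity) (mul_le_mul_of_nonneg_right h3 hD) 2
    have e4 : (κ * (F + 1) * D) ^ 2 = (κ * D) ^ 2 * (F + 1) ^ 2 := by ring
    have e5 : (κ * D) ^ 2 * F ≤ (κ * D) ^ 2 * (F + 1) ^ 2 :=
      mul_le_mul_of_nonneg_left (by nlinarith) (by positivity)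
    linarith
  · have e1 := (hfl.bounds hA.le).1
    have e2 := mul_le_mul_of_nonneg_left hTD hA.le
    have e3 := mul_le_mul_of_nonneg_right h2 hD
    linarith

/-! ### Accumulation of impacts -/

/-- The motion between two successive crossings of the section is a cycle. -/
lemma exists_cycle {q u w w' : Config} {c₀ c₁ c₂ c₃ c₄ c₅ : ℝ × ℝ}
    {t₀ t₁ t₂ t₃ : ℝ} (hs : B.Section q u) (h0 : B.Hit 1 u c₀ w) (hw : 0 ≤ B.nor 0 w)
    (h1 : B.Leg 1 0 q w c₁ c₂ t₀ t₁) (h2 : B.nor 0 (B.legVel 1 w c₁ c₂ t₀ t₁) ≤ 0)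
    (h3 : B.Hit 0 (B.legVel 1 w c₁ c₂ t₀ t₁) c₃ w')
    (h4 : B.nor 1 B.free ≤ 0 → 0 ≤ B.nor 1 w')
    (h5 : B.Leg 0 1 (B.legPos 1 q w c₁ c₂ t₀ t₁) w' c₄ c₅ t₂ t₃) :
    ∃ p, B.Cycle p ∧ p.1 = u ∧ B.postOne p = w ∧ B.postZero p = w' ∧
      B.preOne p = B.legVel 0 w' c₄ c₅ t₂ t₃ ∧ p.2.2 0 + p.2.2 1 = t₀ + t₁ ∧
      p.2.2 2 + p.2.2 3 = t₂ + t₃ := by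
  set p : CycleData := (u, ![c₀, c₁, c₂, c₃, c₄, c₅], ![t₀, t₁, t₂, t₃]) with hp
  have e1 : B.postOne p = w := h0.2.1.symm
  have e2 : B.preZero p = B.legVel 1 w c₁ c₂ t₀ t₁ := by rw [Body.preZero, e1]; rfl
  have e3 : B.postZero p = w' := by rw [Body.postZero, e2]; exact h3.2.1.symm
  have e4 : B.preOne p = B.legVel 0 w' c₄ c₅ t₂ t₃ := by rw [Body.preOne, e3]; rfl
  have e5 : B.nor 1 (B.posZero p) = B.nor 1 (B.legPos 1 q w c₁ c₂ t₀ t₁) := by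
    rw [Body.posZero, e1, legPos_nor, legPos_nor, legMid_nor, legMid_nor, hs.2.1, nor_zero]; rfl
  refine ⟨p, ⟨hs.2.2.1, by rw [e1]; exact h0, by rw [e1]; exact hw, ?_, by rw [e2]; exact h2,
    by rw [e2, e3]; exact h3, by rw [e3]; exact h4, ?_⟩, rfl, e1, e3, e4, rfl, rfl⟩
  · rw [e1]
    have := h1.scale one_pos (q' := 0) (by rw [nor_zero, hs.1, mul_zero])
    simp only [one_smul, one_mul] at this
    exact this
  · rw [e3]
    have := h5.scale one_pos (q' := B.posZero p) (by rw [e5, one_pow, one_mul])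
    simp only [one_smul, one_mul] at this
    exact this

/-- From a crossing of the section with velocity `u`, a trajectory ends or settles soon, or it crosses
the section again after a cycle. -/
lemma section_step (H : B.Regular) (hG : B.Contracting) : ∃ γ M C : ℝ, 0 ≤ γ ∧ γ < 1 ∧ 0 < M ∧
    0 < C ∧ ∀ (T t : ℝ) (q v : ℝ → Config) (u : Config), B.IsTrajectory (Set.Ico 0 T) q v →
      0 ≤ t → t < T → B.Section (q t) u → B.Impact (q t) u (v t) →
      B.Settled q v T t (C * ‖u‖) ∨ ∃ t' u', t < t' ∧ t' < T ∧ t' ≤ t + M * -B.nor 1 u ∧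
        B.Section (q t') u' ∧ Tendsto v (𝓝[<] t') (𝓝 u') ∧ B.Impact (q t') u' (v t') ∧
        -B.nor 1 u' ≤ γ * -B.nor 1 u ∧ ‖u' - u‖ ≤ M * -B.nor 1 u ∧
        ∀ s, t ≤ s → s < t' → ‖v s - u‖ ≤ M * -B.nor 1 u := by
  obtain ⟨γ, M, hγ0, hγ1, hM, hcyc⟩ := cycle_estimates H hG
  obtain ⟨A, L, hA, hL, hleg⟩ := exists_leg_flight H
  obtain ⟨V, hV, hVi, -⟩ := velocity_bound B
  obtain ⟨K, hK, hKs⟩ := settles_closed H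
  have h01 : (0 : Fin 2) ≠ 1 := by decide
  -- sizes of the states after the first impact, the first flight and the second impact
  set a := L * V with ha
  set b := L * (V * a) with hb
  have hL0 : 0 < L := by linarith
  have hV0 : 0 < V := by linarith
  have ha0 : 0 < a := by positivity
  have hb0 : 0 < b := by positivity
  refine ⟨γ, (2 + A) * M, K * V + a + K * (V * a) + b, hγ0, hγ1, by positivity, by positivity, ?_⟩
  intro T t q v u htr ht htT hs hi
  set y := -B.nor 1 u with hy
  have hy0 : 0 < y := by have := hs.2.2.2; linarith
  have hu0 := norm_nonneg u
  have p1 : 0 ≤ K * V * ‖u‖ := by positivity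
  have p2 : 0 ≤ a * ‖u‖ := by positivity
  have p3 : 0 ≤ K * (V * a) * ‖u‖ := by positivity
  have p4 : 0 ≤ b * ‖u‖ := by positivity
  have hw : ‖v t‖ ≤ V * ‖u‖ := hVi _ _ _ hi
  have hfw := htr.feasible ⟨ht, htT⟩
  obtain ⟨hw1, hw2⟩ := hi.cases H.painleve h01.symm hs.2.1 hs.2.2.2 (Or.inr hs.2.2.1.ge)
  by_cases hw0 : B.nor 0 (v t) = 0
  · left
    have := (hKs (q t) (v t) (fun i => by match i with | 0 => exact hs.1 | 1 => exact hs.2.1)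
      (fun i => by match i with | 0 => exact hw0 | 1 => exact hw1)).settled htr ht htT
    refine this.mono le_rfl ?_
    have := mul_le_mul_of_nonneg_left hw hK.le
    linarith
  have hw0' : 0 < B.nor 0 (v t) := lt_of_le_of_ne ((hfw 0).2 hs.1) (Ne.symm hw0)
  obtain ⟨c₀, hhit⟩ := hw2.resolve_left fun h => hw0 h.2
  obtain ⟨c₁, c₂, t₀, t₁, leg, hT, hTD, hF, hv0, hq1, hv1, hqD, hvD⟩ := hleg 1 0 (q t) (v t)
    (V * ‖u‖) h01.symm hs.2.1 hw1 hs.1.ge (Or.inr hw0') (by rw [hs.1]; positivity) hw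
  have hTD' : t₀ + t₁ ≤ a * ‖u‖ := by rw [ha, mul_assoc]; exact hTD
  have hvD' : ‖B.legVel 1 (v t) c₁ c₂ t₀ t₁‖ ≤ a * ‖u‖ := by rw [ha, mul_assoc]; exact hvD
  have hqD' : B.nor 1 (B.legPos 1 (q t) (v t) c₁ c₂ t₀ t₁) ≤ (a * ‖u‖) ^ 2 := by
    rw [ha, mul_assoc]; exact hqD
  obtain ⟨hd1, hnext⟩ := htr.follow H ht htT hF
  rcases hnext with ⟨h1, h2⟩ | ⟨hlt, hqe, -, hi'⟩
  · left; exact settled_of_le h2 (by linarith)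
  set s₁ := t + (t₀ + t₁) with hs₁
  have hs₁0 : 0 ≤ s₁ := by linarith
  have hland := leg.land
  have hself := leg.nor_self hs.2.1 hw1
  rw [← hqe] at hq1 hqD' hland hself
  have hw' : ‖v s₁‖ ≤ V * a * ‖u‖ := by
    rw [mul_assoc]; exact (hVi _ _ _ hi').trans (mul_le_mul_of_nonneg_left hvD' hV0.le)
  have hfw' := htr.feasible ⟨hs₁0, hlt⟩
  obtain ⟨hx0, hx1⟩ := hi'.cases H.painleve h01 hland hv0 (Or.inr hv1)
  by_cases hcl : B.nor 1 (q s₁) = 0 ∧ B.nor 1 (v s₁) = 0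
  · left
    have := (hKs (q s₁) (v s₁) (fun i => by match i with | 0 => exact hland | 1 => exact hcl.1)
      (fun i => by match i with | 0 => exact hx0 | 1 => exact hcl.2)).settled htr hs₁0 hlt
    refine this.mono (by linarith) ?_
    have := mul_le_mul_of_nonneg_left hw' hK.le
    linarith
  obtain ⟨c₃, hhit'⟩ := hx1.resolve_left hcl
  have ho : 0 < B.nor 1 (q s₁) ∨ 0 < B.nor 1 (v s₁) := by
    rcases eq_or_lt_of_le hq1 with h | h
    · exact Or.inr (lt_of_le_of_ne ((hfw' 1).2 h.symm) fun h' => hcl ⟨h.symm, h'.symm⟩)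
    · exact Or.inl h
  obtain ⟨c₄, c₅, t₂, t₃, leg', hT', hTD2, hF', hv1', -, -, -, -⟩ := hleg 0 1 (q s₁) (v s₁)
    (V * a * ‖u‖) h01 hland hx0 hq1 ho
    (hqD'.trans (pow_le_pow_left₀ p2 (by nlinarith) 2)) hw'
  have hTD2' : t₂ + t₃ ≤ b * ‖u‖ := by rw [hb]; linarith
  obtain ⟨hd2, hnext⟩ := htr.follow H hs₁0 hlt hF'
  rcases hnext with ⟨h1, h2⟩ | ⟨hlt2, hqe2, hlim, hi2⟩
  · left; exact settled_of_le h2 (by linarith)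
  right
  obtain ⟨p, hp, e1, e2, e3, e4, e5, e6⟩ := exists_cycle hs hhit hw0'.le leg hv0.le hhit'
    (fun hf => by
      refine (hfw' 1).2 ?_
      rw [hself.1, max_eq_right hf, mul_zero]) (by rw [← hqe]; exact leg')
  obtain ⟨b1, b2, b3, b4, b5, b6⟩ := hcyc p y hp hy0 (by rw [e1, hy, neg_neg])
  rw [e4] at b1 b6
  rw [e1] at b4 b5 b6
  rw [e2] at b4
  rw [e3] at b5
  rw [e5] at b2
  rw [e6] at b3
  have hMy : 0 < M * y := by positivity
  have hAMy : 0 ≤ A * (M * y) := by positivity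
  have hland' := leg'.land
  have hself' := leg'.nor_self hland hx0
  rw [max_eq_right H.free_neg.le, mul_zero, mul_zero] at hself'
  rw [← hqe2] at hland' hself'
  refine ⟨s₁ + (t₂ + t₃), _, by linarith, hlt2, by linarith, ⟨hself'.1, hland', hself'.2, hv1'⟩,
    hlim, hi2, b1, by linarith, fun s g1 g2 => ?_⟩
  rcases lt_or_ge s s₁ with hss | hss
  · have r1 := hd1 s g1 hss (by linarith)
    have r2 : A * (s - t) ≤ A * (M * y) := mul_le_mul_of_nonneg_left (by linarith) hA
    have r3 := norm_add_le (v s - v t) (v t - u)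
    rw [sub_add_sub_cancel] at r3
    linarith
  · have r1 := hd2 s hss g2 (by linarith)
    have r2 : A * (s - s₁) ≤ A * (M * y) := mul_le_mul_of_nonneg_left (by linarith) hA
    have r3 := norm_add_le (v s - v s₁) (v s₁ - u)
    rw [sub_add_sub_cancel] at r3
    linarith

/-- The bouncing motion that starts on the section settles: the velocities at the successive crossings
decrease geometrically, hence the impacts accumulate at a state with two sustained contacts. -/
lemma settles_section (H : B.Regular) (hG : B.Contracting) : ∃ C > 0, ∀ q₀ u₀ w₀ : Config,
    B.Section q₀ u₀ → B.Impact q₀ u₀ w₀ → B.Settles (C * ‖u₀‖) q₀ w₀ := by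
  obtain ⟨γ, M, C, hγ0, hγ1, hM, hC, hstep⟩ := section_step H hG
  obtain ⟨K, hK, hKs⟩ := settles_closed H
  obtain ⟨Kn, hKn, hKb⟩ := coords_le_norm B
  set κ := M / (1 - γ) with hκ
  have h1γ : 0 < 1 - γ := by linarith
  have hκ0 : 0 < κ := by positivity
  have hκM : M + κ * γ = κ := by rw [hκ]; field_simp; ring
  set E := κ * Kn + (C + K) * (1 + κ * Kn) with hE
  have hE0 : 0 < E := by positivity
  refine ⟨E, hE0, ?_⟩
  rintro q₀ u₀ w₀ hs₀ hi₀ T q v hT htr rfl rfl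
  set y₀ := -B.nor 1 u₀ with hy₀
  have hy₀K : y₀ ≤ Kn * ‖u₀‖ := (neg_le_abs _).trans ((hKb u₀).1 1)
  have hu0 := norm_nonneg u₀
  have hκy : κ * y₀ ≤ κ * Kn * ‖u₀‖ := by
    rw [mul_assoc]; exact mul_le_mul_of_nonneg_left hy₀K hκ0.le
  have hnorm : ∀ u : Config, ‖u - u₀‖ ≤ κ * y₀ → ‖u‖ ≤ (1 + κ * Kn) * ‖u₀‖ := fun u hu => by
    have := norm_sub_norm_le u u₀
    linarith
  -- The crossings of the section that are reached before the accumulation. The quantity `κ * y`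
  -- bounds the remaining time and the remaining change of the velocity.
  let P : ℝ × Config → Prop := fun x => 0 ≤ x.1 ∧ x.1 < T ∧ B.Section (q x.1) x.2 ∧
    B.Impact (q x.1) x.2 (v x.1) ∧ x.1 + κ * -B.nor 1 x.2 ≤ κ * y₀ ∧
    ‖x.2 - u₀‖ + κ * -B.nor 1 x.2 ≤ κ * y₀
  have hP0 : P (0, u₀) := ⟨le_rfl, hT, hs₀, hi₀, by simp [hy₀], by simp [hy₀]⟩
  have hPb : ∀ x, P x → x.1 ≤ κ * y₀ ∧ ‖x.2 - u₀‖ ≤ κ * y₀ := fun x hx => by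
    obtain ⟨-, -, h3, -, h5, h6⟩ := hx
    have : 0 ≤ κ * -B.nor 1 x.2 := mul_nonneg hκ0.le (by linarith [h3.2.2.2])
    exact ⟨by linarith, by linarith⟩
  -- unless the motion settles after finitely many crossings, there is an infinite sequence of them
  by_cases hex : ∃ x, P x ∧ B.Settled q v T x.1 (C * ‖x.2‖)
  · obtain ⟨x, hx, hset⟩ := hex
    obtain ⟨b1, b2⟩ := hPb x hx
    refine hset.mono hx.1 ?_
    have h1 := mul_le_mul_of_nonneg_left (hnorm _ b2) hC.le
    have h2 : 0 ≤ K * (1 + κ * Kn) * ‖u₀‖ := by positivity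
    rw [hE]
    linarith
  push Not at hex
  have hnext : ∀ x : {x // P x}, ∃ x' : {x // P x}, x.1.1 < x'.1.1 ∧
      -B.nor 1 x'.1.2 ≤ γ * -B.nor 1 x.1.2 ∧ ‖x'.1.2 - x.1.2‖ ≤ M * -B.nor 1 x.1.2 ∧
      ∀ s, x.1.1 ≤ s → s < x'.1.1 → ‖v s - x.1.2‖ ≤ M * -B.nor 1 x.1.2 := by
    rintro ⟨⟨t, u⟩, hx⟩
    obtain ⟨g1, g2, g3, g4, g5, g6⟩ := id hx
    simp only at g1 g2 g3 g4 g5 g6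
    obtain ⟨t', u', k1, k2, k3, k4, -, k6, k7, k8, k9⟩ :=
      (hstep T t q v u htr g1 g2 g3 g4).resolve_left (hex _ hx)
    have hred : M * -B.nor 1 u + κ * -B.nor 1 u' ≤ κ * -B.nor 1 u := by
      have := mul_le_mul_of_nonneg_left k7 hκ0.le
      calc M * -B.nor 1 u + κ * -B.nor 1 u' ≤ (M + κ * γ) * -B.nor 1 u := by linarith
        _ = κ * -B.nor 1 u := by rw [hκM]
    refine ⟨⟨(t', u'), by simp only; linarith, k2, k4, k6, by simp only; linarith, ?_⟩, k1, k7, k8, k9⟩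
    have := norm_add_le (u' - u) (u - u₀)
    rw [sub_add_sub_cancel] at this
    simp only
    linarith
  choose next hn1 hn2 hn3 hn4 using hnext
  let x : ℕ → {x // P x} := fun n => next^[n] ⟨(0, u₀), hP0⟩
  have hx : ∀ n, x (n + 1) = next (x n) := fun n => Function.iterate_succ_apply' _ _ _
  set t : ℕ → ℝ := fun n => (x n).1.1 with htd
  set u : ℕ → Config := fun n => (x n).1.2 with hud
  have ht_lt : ∀ n, t n < t (n + 1) := fun n => by simp only [htd, hx]; exact hn1 _
  have hy_nonneg : ∀ n, 0 ≤ -B.nor 1 (u n) := fun n => by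
    have := (x n).2.2.2.1.2.2.2; simp only [hud]; linarith
  have hyn : ∀ n, -B.nor 1 (u n) ≤ y₀ * γ ^ n := by
    intro n
    induction n with
    | zero => simp [hud, x, hy₀]
    | succ n ih =>
      have h1 : -B.nor 1 (u (n + 1)) ≤ γ * -B.nor 1 (u n) := by simp only [hud, hx]; exact hn2 _
      have h2 := mul_le_mul_of_nonneg_left ih hγ0
      rw [pow_succ]
      linarith
  have hdist : ∀ n, ‖u (n + 1) - u n‖ ≤ M * y₀ * γ ^ n := fun n => by
    have h1 : ‖u (n + 1) - u n‖ ≤ M * -B.nor 1 (u n) := by simp only [hud, hx]; exact hn3 _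
    have h2 := mul_le_mul_of_nonneg_left (hyn n) hM.le
    linarith
  have hpow : Tendsto (fun n : ℕ => γ ^ n) atTop (𝓝 0) := tendsto_pow_atTop_nhds_zero_of_lt_one hγ0 hγ1
  have hy_lim : Tendsto (fun n => -B.nor 1 (u n)) atTop (𝓝 0) := by
    refine squeeze_zero hy_nonneg hyn ?_
    simpa using hpow.const_mul y₀
  obtain ⟨uf, huf⟩ : ∃ uf, Tendsto u atTop (𝓝 uf) := by
    refine cauchySeq_tendsto_of_complete (cauchySeq_of_le_geometric γ (M * y₀) hγ1 fun n => ?_)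
    rw [dist_eq_norm, norm_sub_rev]
    exact hdist n
  have hmono : StrictMono t := strictMono_nat_of_lt_succ ht_lt
  have hbdd : BddAbove (Set.range t) := ⟨T, by rintro _ ⟨n, rfl⟩; exact (x n).2.2.1.le⟩
  obtain ⟨tf, htf⟩ : ∃ tf, Tendsto t atTop (𝓝 tf) := ⟨_, tendsto_atTop_ciSup hmono.monotone hbdd⟩
  have ht_lt_tf : ∀ n, t n < tf := fun n =>
    (ht_lt n).trans_le (hmono.monotone.ge_of_tendsto htf (n + 1))
  have htf0 : 0 < tf := lt_of_le_of_lt (x 0).2.1 (ht_lt_tf 0)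
  have htfT : tf ≤ T := le_of_tendsto' htf fun n => (x n).2.2.1.le
  have htfκ : tf ≤ κ * y₀ := le_of_tendsto' htf fun n => (hPb _ (x n).2).1
  have hufκ : ‖uf - u₀‖ ≤ κ * y₀ :=
    le_of_tendsto' (huf.sub_const u₀).norm fun n => (hPb _ (x n).2).2
  have hcover : ∀ m s, t m ≤ s → s < tf → ∃ n, m ≤ n ∧ t n ≤ s ∧ s < t (n + 1) := by
    intro m s h1 h2
    have hev : ∃ n, s < t n := (htf.eventually (lt_mem_nhds h2)).exists
    have hfind := Nat.find_spec hev
    have hmin : ∀ k, k < Nat.find hev → t k ≤ s := fun k hk => not_lt.1 (Nat.find_min hev hk)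
    have hmk : m < Nat.find hev := by
      by_contra hcon
      have := hmono.monotone (not_lt.1 hcon)
      linarith
    obtain ⟨k, hk⟩ : ∃ k, Nat.find hev = k + 1 := Nat.exists_eq_succ_of_ne_zero (by omega)
    refine ⟨k, by omega, hmin k (by omega), ?_⟩
    rw [← hk]; exact hfind
  have hv_lim : Tendsto v (𝓝[<] tf) (𝓝 uf) := by
    rw [Metric.tendsto_nhds]
    intro ε hε
    have e1 : Tendsto (fun n => M * (y₀ * γ ^ n)) atTop (𝓝 0) := by
      simpa using (hpow.const_mul y₀).const_mul M
    obtain ⟨m, hm⟩ := ((e1.eventually (gt_mem_nhds (half_pos hε))).and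
      (huf.eventually (Metric.ball_mem_nhds uf (half_pos hε)))).exists_forall_of_atTop
    filter_upwards [Ioo_mem_nhdsLT (ht_lt_tf m)] with s hs
    obtain ⟨n, h1, h2, h3⟩ := hcover m s hs.1.le hs.2
    obtain ⟨k1, k2⟩ := hm n h1
    have h4 : ‖v s - u n‖ ≤ M * -B.nor 1 (u n) := by
      refine hn4 (x n) s h2 ?_
      rw [← hx]; exact h3
    have h5 := mul_le_mul_of_nonneg_left (hyn n) hM.le
    calc Dist.dist (v s) uf ≤ Dist.dist (v s) (u n) + Dist.dist (u n) uf := dist_triangle _ _ _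
      _ < ε / 2 + ε / 2 := by
        refine add_lt_add ?_ k2
        rw [dist_eq_norm]; linarith
      _ = ε := by ring
  rcases eq_or_lt_of_le htfT with rfl | hlt
  · refine (settled_of_le ⟨uf, hv_lim⟩ ?_)
    have : 0 ≤ (C + K) * (1 + κ * Kn) * ‖u₀‖ := by positivity
    rw [hE]
    linarith
  -- the trajectory goes on from the accumulation point, with two sustained contacts
  have hmem : tf ∈ Set.Ico 0 T := ⟨htf0.le, hlt⟩
  have hq_lim : Tendsto (fun n => q (t n)) atTop (𝓝 (q tf)) := by
    have h1 : Tendsto t atTop (𝓝[Set.Ico 0 T] tf) := tendsto_nhdsWithin_iff.2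
      ⟨htf, Eventually.of_forall fun n => ⟨(x n).2.1, (x n).2.2.1⟩⟩
    exact (htr.continuousOn tf hmem).tendsto.comp h1
  have hnor : ∀ i, Continuous (B.nor i) := fun i => by fun_prop
  have hq0 : ∀ i, B.nor i (q tf) = 0 := fun i => by
    refine tendsto_nhds_unique (((hnor i).tendsto _).comp hq_lim) ?_
    refine tendsto_const_nhds.congr fun n => ?_
    match i with
    | 0 => exact (x n).2.2.2.1.1.symm
    | 1 => exact (x n).2.2.2.1.2.1.symm
  have hu0 : ∀ i, B.nor i uf = 0 := fun i => by
    refine tendsto_nhds_unique (((hnor i).tendsto _).comp huf) ?_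
    match i with
    | 0 => exact tendsto_const_nhds.congr fun n => (x n).2.2.2.1.2.2.1.symm
    | 1 => simpa [Function.comp_def] using hy_lim.neg
  obtain ⟨w, hw, hi⟩ := htr.impact tf hmem htf0
  rw [tendsto_nhds_unique hw hv_lim] at hi
  have hvf := hi.eq_of_feasible fun i => ⟨(hq0 i).ge, fun _ => (hu0 i).ge⟩
  have := (hKs (q tf) (v tf) hq0 (by rw [hvf]; exact hu0)).settled htr htf0.le hlt
  refine this.mono htf0.le ?_
  rw [hvf]
  have h1 := mul_le_mul_of_nonneg_left (hnorm _ hufκ) hK.le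
  have h2 : 0 ≤ C * (1 + κ * Kn) * ‖u₀‖ := by positivity
  rw [hE]
  linarith

/-! ### All motions settle -/

lemma settles_zero_closed (H : B.Regular) (hG : B.Contracting) : ∃ C > 0,
    ∀ (q w : Config) (D : ℝ), B.nor 0 q = 0 → B.nor 0 w = 0 → 0 ≤ B.nor 1 q →
      (0 < B.nor 1 q ∨ 0 < B.nor 1 w) → B.nor 1 q ≤ D ^ 2 → ‖w‖ ≤ D → B.Settles (C * D) q w := by
  obtain ⟨C, hC, hs⟩ := settles_section H hG
  obtain ⟨A, L, hA, hL, hleg⟩ := exists_leg_flight H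
  refine ⟨L + C * L, by positivity, fun q w D hq hw hq1 ho hqD hwD => ?_⟩
  obtain ⟨c, c', t, t', leg, hT, hTD, hF, hv, -, -, -, hvD⟩ :=
    hleg 0 1 q w D (by decide) hq hw hq1 ho hqD hwD
  have hself := leg.nor_self hq hw
  rw [max_eq_right H.free_neg.le, mul_zero, mul_zero] at hself
  have := hF.settles H (C := C * ‖B.legVel 0 w c c' t t'‖) (by positivity) fun w' hw' =>
    hs _ _ _ ⟨hself.1, leg.land, hself.2, hv⟩ hw'
  refine this.mono ?_
  have := mul_le_mul_of_nonneg_left hvD hC.le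
  linarith

lemma settles_one_closed (H : B.Regular) (hG : B.Contracting) : ∃ C > 0,
    ∀ (q w : Config) (D : ℝ), B.nor 1 q = 0 → B.nor 1 w = 0 → 0 ≤ B.nor 0 q →
      (0 < B.nor 0 q ∨ 0 < B.nor 0 w) → B.nor 0 q ≤ D ^ 2 → ‖w‖ ≤ D → B.Settles (C * D) q w := by
  obtain ⟨C, hC, hs⟩ := settles_zero_closed H hG
  obtain ⟨K, hK, hKs⟩ := settles_closed H
  obtain ⟨A, L, hA, hL, hleg⟩ := exists_leg_flight H
  obtain ⟨V, hV, hVi, -⟩ := velocity_bound B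
  refine ⟨L + (C + K) * (V * L), by positivity, fun q w D hq hw hq0 ho hqD hwD => ?_⟩
  have hD : 0 ≤ D := (norm_nonneg w).trans hwD
  obtain ⟨c, c', t, t', leg, hT, hTD, hF, hv, hq1, hv1, hq1D, hvD⟩ :=
    hleg 1 0 q w D (by decide) hq hw hq0 ho hqD hwD
  have hland := leg.land
  have hCK : 0 ≤ (C + K) * (V * L * D) := by positivity
  have := hF.settles H hCK fun w' hw' => by
    obtain ⟨h0, h1⟩ := hw'.cases H.painleve (show (0 : Fin 2) ≠ 1 by decide) hland hv (Or.inr hv1)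
    have hwD' : ‖w'‖ ≤ V * L * D := by
      rw [mul_assoc]
      exact (hVi _ _ _ hw').trans (mul_le_mul_of_nonneg_left hvD (by linarith))
    have hfe := hw'.feasible fun i => by
      match i with
      | 0 => exact hland.ge
      | 1 => exact hq1
    by_cases hcl : B.nor 1 (B.legPos 1 q w c c' t t') = 0 ∧ B.nor 1 w' = 0
    · refine (hKs _ w' (fun i => by match i with | 0 => exact hland | 1 => exact hcl.1)
        (fun i => by match i with | 0 => exact h0 | 1 => exact hcl.2)).mono ?_
      have h2 := mul_le_mul_of_nonneg_left hwD' hK.le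
      have h3 : 0 ≤ C * (V * L * D) := by positivity
      linarith
    · refine (hs _ w' (V * L * D) hland h0 hq1 ?_ (hq1D.trans ?_) hwD').mono ?_
      · rcases eq_or_lt_of_le hq1 with h | h
        · exact Or.inr (lt_of_le_of_ne ((hfe 1).2 h.symm) fun h' => hcl ⟨h.symm, h'.symm⟩)
        · exact Or.inl h
      · refine pow_le_pow_left₀ (by positivity) ?_ 2
        rw [mul_assoc]
        exact le_mul_of_one_le_left (by positivity) hV
      · have h3 : 0 ≤ K * (V * L * D) := by positivity
        linarith
  refine this.mono ?_
  linarith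

lemma settles_closed_contact (H : B.Regular) (hG : B.Contracting) : ∃ C > 0,
    ∀ (q v : Config) (D : ℝ), B.Feasible q v → (∃ i, B.nor i q = 0 ∧ B.nor i v = 0) →
      (∀ i, B.nor i q ≤ D ^ 2) → ‖v‖ ≤ D → B.Settles (C * D) q v := by
  obtain ⟨C₀, hC₀, h0⟩ := settles_zero_closed H hG
  obtain ⟨C₁, hC₁, h1⟩ := settles_one_closed H hG
  obtain ⟨K, hK, hKs⟩ := settles_closed H
  refine ⟨C₀ + C₁ + K, by positivity, fun q v D hf hcl hq hv => ?_⟩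
  have hD : 0 ≤ D := (norm_nonneg v).trans hv
  have p0 : 0 ≤ C₀ * D := by positivity
  have p1 : 0 ≤ C₁ * D := by positivity
  have p2 : 0 ≤ K * D := by positivity
  have hopen : ∀ i, ¬ (B.nor i q = 0 ∧ B.nor i v = 0) → 0 < B.nor i q ∨ 0 < B.nor i v := by
    intro i hi
    rcases eq_or_lt_of_le (hf i).1 with h | h
    · exact Or.inr (lt_of_le_of_ne ((hf i).2 h.symm) fun h' => hi ⟨h.symm, h'.symm⟩)
    · exact Or.inl h
  by_cases e0 : B.nor 0 q = 0 ∧ B.nor 0 v = 0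
  · by_cases e1 : B.nor 1 q = 0 ∧ B.nor 1 v = 0
    · refine (hKs q v (fun i => by match i with | 0 => exact e0.1 | 1 => exact e1.1)
        (fun i => by match i with | 0 => exact e0.2 | 1 => exact e1.2)).mono ?_
      have := mul_le_mul_of_nonneg_left hv hK.le
      linarith
    · exact (h0 q v D e0.1 e0.2 (hf 1).1 (hopen 1 e1) (hq 1) hv).mono (by linarith)
  · have e1 : B.nor 1 q = 0 ∧ B.nor 1 v = 0 := by
      obtain ⟨i, hi⟩ := hcl
      match i with
      | 0 => exact absurd hi e0
      | 1 => exact hi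
    exact (h1 q v D e1.1 e1.2 (hf 0).1 (hopen 0 e0) (hq 0) hv).mono (by linarith)

/-- Feasible states of size `D` come to rest in a time proportional to `D`. -/
lemma settles_feasible (H : B.Regular) (hG : B.Contracting) : ∃ C > 0,
    ∀ (q v : Config) (D : ℝ), B.Feasible q v → (∀ i, B.nor i q ≤ D ^ 2) → ‖v‖ ≤ D →
      B.Settles (C * D) q v := by
  obtain ⟨C, hC, hs⟩ := settles_closed_contact H hG
  obtain ⟨V, hV, hVi, -⟩ := velocity_bound B
  obtain ⟨K, hK, hKb⟩ := coords_le_norm B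
  set A := ‖B.free‖ with hA
  set β := -B.nor 0 B.free with hβ
  have hA0 : 0 ≤ A := norm_nonneg _
  have hβ0 : 0 < β := by have := H.free_neg; linarith
  set κ := 2 / β * (K + 1) + 1 with hκ
  have hκ0 : 0 < κ := by positivity
  set E := 1 + K * (1 + A * κ) * κ + V * (1 + A * κ) with hE
  have hVA : 0 < V * (1 + A * κ) := by positivity
  have hKA : 0 < K * (1 + A * κ) * κ := by positivity
  have hE1 : 1 ≤ E := by linarith
  refine ⟨C + (κ + C * E), by positivity, fun q v D hf hq hv => ?_⟩
  have hD : 0 ≤ D := (norm_nonneg v).trans hv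
  by_cases hcl : ∃ i, B.nor i q = 0 ∧ B.nor i v = 0
  · refine (hs q v D hf hcl hq hv).mono ?_
    have : 0 ≤ (κ + C * E) * D := by positivity
    linarith
  push Not at hcl
  have hopen : ∀ i, 0 < B.nor i q ∨ 0 < B.nor i v := by
    intro i
    rcases eq_or_lt_of_le (hf i).1 with h | h
    · exact Or.inr (lt_of_le_of_ne ((hf i).2 h.symm) (hcl i h.symm).symm)
    · exact Or.inl h
  obtain ⟨T, q₁, v₁, hT, hF, hq₁, hcol, hTb⟩ := exists_free_flight H (A := A) le_rfl
    (fun i => (hf i).1) hopen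
  have hTD : T ≤ κ * D := by
    have e2 : B.nor 0 v ≤ K * D := (le_abs_self _).trans
      (((hKb v).1 0).trans (mul_le_mul_of_nonneg_left hv hK.le))
    refine duration_bound (T := T) (Z := 1) (N := K) hβ0 zero_le_one hK.le hD ?_
    have := mul_le_mul_of_nonneg_left e2 hT.le
    have := hq 0
    rw [hβ]
    linarith
  have hPF := hF.proper hT
  obtain ⟨b1, b2⟩ := hPF.bounds hA0
  have hAT := mul_le_mul_of_nonneg_left hTD hA0
  have b1' : ‖v₁‖ ≤ (1 + A * κ) * D := by linarith
  have b2' : ‖q₁ - q‖ ≤ (1 + A * κ) * κ * D ^ 2 := by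
    refine b2.trans ?_
    calc (‖v‖ + A * T) * T ≤ ((1 + A * κ) * D) * (κ * D) :=
          mul_le_mul (by linarith) hTD hT.le (by positivity)
      _ = (1 + A * κ) * κ * D ^ 2 := by ring
  have hCE : 0 ≤ C * (E * D) := by positivity
  have := hPF.settles H hCE fun w hw => by
    refine hs q₁ w (E * D) (hw.feasible hq₁) (hw.exists_closed hcol) (fun i => ?_) ?_
    · have h1 := (le_abs_self _).trans (((hKb (q₁ - q)).1 i).trans
        (mul_le_mul_of_nonneg_left b2' hK.le))
      rw [nor_sub] at h1
      have h2 := hq i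
      have h3 : (1 + K * (1 + A * κ) * κ) * D ^ 2 ≤ E * D ^ 2 :=
        mul_le_mul_of_nonneg_right (by linarith) (sq_nonneg D)
      have h4 : E * D ^ 2 ≤ (E * D) ^ 2 := by
        rw [mul_pow]; exact mul_le_mul_of_nonneg_right (by nlinarith) (sq_nonneg D)
      linarith
    · have h1 := (hVi _ _ _ hw).trans (mul_le_mul_of_nonneg_left b1' (by linarith))
      have h3 : (V * (1 + A * κ)) * D ≤ E * D := mul_le_mul_of_nonneg_right (by linarith) hD
      linarith
  refine this.mono ?_
  have : 0 ≤ C * D := by positivity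
  linarith

/-! ### Existence of trajectories -/

lemma exists_properFlight (H : B.Regular) {q v : Config} (hf : B.Feasible q v) :
    ∃ A T q₁ v₁, B.ProperFlight A T q v q₁ v₁ := by
  have hopen : ∀ i, ¬ (B.nor i q = 0 ∧ B.nor i v = 0) → 0 < B.nor i q ∨ 0 < B.nor i v := by
    intro i hi
    rcases eq_or_lt_of_le (hf i).1 with h | h
    · exact Or.inr (lt_of_le_of_ne ((hf i).2 h.symm) fun h' => hi ⟨h.symm, h'.symm⟩)
    · exact Or.inl h
  have hleg : ∀ i j : Fin 2, i ≠ j → B.nor i q = 0 → B.nor i v = 0 →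
      (0 < B.nor j q ∨ 0 < B.nor j v) → ∃ A T q₁ v₁, B.ProperFlight A T q v q₁ v₁ := by
    intro i j hij hq hv ho
    obtain ⟨A, -, hA⟩ := acc_norm_le H.painleve
    obtain ⟨c, c', t, t', leg, hT⟩ := exists_leg H hij (hf j).1 ho
    exact ⟨_, _, _, _, (leg.flight H hij (hA i) hq hv (hf j).1 (hf j).2).proper hT⟩
  by_cases e0 : B.nor 0 q = 0 ∧ B.nor 0 v = 0
  · by_cases e1 : B.nor 1 q = 0 ∧ B.nor 1 v = 0
    · have hq : ∀ i, B.nor i q = 0 := fun i => by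
        match i with
        | 0 => exact e0.1
        | 1 => exact e1.1
      obtain ⟨A, K, hA, -, h⟩ := exists_slip_flight H
      obtain ⟨T, q₁, -, hF, -⟩ := h q v hq fun i => by
        match i with
        | 0 => exact e0.2
        | 1 => exact e1.2
      rcases hF with ⟨-, -, hv⟩ | hF
      · rw [← hv]
        exact ⟨_, _, _, _, (flight_rest H hA zero_le_one hq).proper one_pos⟩
      · exact ⟨_, _, _, _, hF⟩
    · exact hleg 0 1 (by decide) e0.1 e0.2 (hopen 1 e1)
  · by_cases e1 : B.nor 1 q = 0 ∧ B.nor 1 v = 0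
    · exact hleg 1 0 (by decide) e1.1 e1.2 (hopen 0 e0)
    · obtain ⟨T, q₁, v₁, hT, hF, -⟩ := exists_free_flight H le_rfl (fun i => (hf i).1) fun i => by
        match i with
        | 0 => exact hopen 0 e0
        | 1 => exact hopen 1 e1
      exact ⟨_, _, _, _, hF.proper hT⟩

/-- The trajectory property is local in time. -/
lemma isTrajectory_of_local {T : ℝ} {q v : ℝ → Config}
    (h : ∀ t, 0 ≤ t → t < T → ∃ T' q' v', t < T' ∧ B.IsTrajectory (Set.Ico 0 T') q' v' ∧
      ∀ s, 0 ≤ s → s < T' → q s = q' s ∧ v s = v' s) : B.IsTrajectory (Set.Ico 0 T) q v where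
  continuousOn t ht := by
    obtain ⟨T', q', v', hT', htr, heq⟩ := h t ht.1 ht.2
    have hmem : Set.Ico 0 T' ∈ 𝓝[Set.Ico 0 T] t := by
      filter_upwards [mem_nhdsWithin_of_mem_nhds (Iio_mem_nhds hT'), self_mem_nhdsWithin]
        with s hs hs' using ⟨hs'.1, hs⟩
    have h1 : ContinuousWithinAt q (Set.Ico 0 T') t :=
      (htr.continuousOn.congr fun s hs => (heq s hs.1 hs.2).1) t ⟨ht.1, hT'⟩
    exact h1.mono_of_mem_nhdsWithin hmem
  motion t ht := by
    obtain ⟨T', q', v', hT', htr, heq⟩ := h t ht.1 ht.2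
    obtain ⟨η, hη, f, hf⟩ := htr.motion t ⟨ht.1, hT'⟩
    refine ⟨min η (T' - t), lt_min hη (by linarith), f, fun s hs h1 h2 => ?_⟩
    have h3 : s < T' := by have := h2.trans_le (add_le_add_right (min_le_right η (T' - t)) t); linarith
    have h4 : s < t + η := h2.trans_le (add_le_add_right (min_le_left η (T' - t)) t)
    rw [(heq s hs.1 h3).1, (heq s hs.1 h3).2, (heq t ht.1 hT').1, (heq t ht.1 hT').2]
    exact hf s ⟨hs.1, h3⟩ h1 h4
  impact t ht h0 := by
    obtain ⟨T', q', v', hT', htr, heq⟩ := h t ht.1 ht.2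
    obtain ⟨w, hw, hi⟩ := htr.impact t ⟨ht.1, hT'⟩ h0
    rw [(heq t ht.1 hT').1, (heq t ht.1 hT').2]
    refine ⟨w, hw.congr' ?_, hi⟩
    filter_upwards [Ioo_mem_nhdsLT h0] with s hs
    exact (heq s hs.1.le (hs.2.trans hT')).2.symm

/-- Trajectories from a settling state can be continued up to any time. The continuation exists by
Zorn's lemma: at the end of a maximal trajectory the impact law and a flight would go on. -/
lemma Body.Settles.exists_trajectory (H : B.Regular) {C T₁ : ℝ} (hT₁ : 0 < T₁) {q₀ v₀ : Config}
    (hf : B.Feasible q₀ v₀) (hs : B.Settles C q₀ v₀) :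
    ∃ q v, B.IsTrajectory (Set.Ico 0 T₁) q v ∧ q 0 = q₀ ∧ v 0 = v₀ := by
  let X : Type := {x : ℝ × (ℝ → Config) × (ℝ → Config) // 0 < x.1 ∧ x.1 ≤ T₁ ∧
    B.IsTrajectory (Set.Ico 0 x.1) x.2.1 x.2.2 ∧ x.2.1 0 = q₀ ∧ x.2.2 0 = v₀}
  let r : X → X → Prop := fun x y => x.1.1 ≤ y.1.1 ∧
    ∀ s, 0 ≤ s → s < x.1.1 → y.1.2.1 s = x.1.2.1 s ∧ y.1.2.2 s = x.1.2.2 s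
  have hne : Nonempty X := by
    obtain ⟨A, τ, q₁, v₁, hτ, q, v, htr, -, h0, h1, -⟩ := exists_properFlight H hf
    exact ⟨⟨(min τ T₁, q, v), lt_min hτ hT₁, min_le_right _ _,
      htr.mono (Set.Ico_subset_Ico_right (min_le_left _ _)), h0, h1⟩⟩
  obtain ⟨m, hm⟩ : ∃ m : X, ∀ a, r m a → r a m := by
    refine exists_maximal_of_nonempty_chains_bounded (r := r) (fun c hc hcne => ?_) ?_
    · have hbdd : BddAbove ((fun x : X => x.1.1) '' c) :=
        ⟨T₁, by rintro _ ⟨x, -, rfl⟩; exact x.2.2.1⟩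
      set S := sSup ((fun x : X => x.1.1) '' c) with hS
      have hle : ∀ x ∈ c, x.1.1 ≤ S := fun x hx => le_csSup hbdd ⟨x, hx, rfl⟩
      have hlt : ∀ s, s < S → ∃ x ∈ c, s < x.1.1 := fun s hs => by
        obtain ⟨_, ⟨x, hx, rfl⟩, h⟩ := exists_lt_of_lt_csSup (hcne.image _) hs
        exact ⟨x, hx, h⟩
      have hagree : ∀ x ∈ c, ∀ y ∈ c, ∀ s, 0 ≤ s → s < x.1.1 → s < y.1.1 →
          x.1.2.1 s = y.1.2.1 s ∧ x.1.2.2 s = y.1.2.2 s := by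
        intro x hx y hy s h0 h1 h2
        rcases eq_or_ne x y with rfl | hxy
        · exact ⟨rfl, rfl⟩
        rcases hc hx hy hxy with h | h
        · exact ⟨(h.2 s h0 h1).1.symm, (h.2 s h0 h1).2.symm⟩
        · exact h.2 s h0 h2
      classical
      let Q : ℝ → Config := fun s => if h : ∃ x ∈ c, s < x.1.1 then h.choose.1.2.1 s else 0
      let W : ℝ → Config := fun s => if h : ∃ x ∈ c, s < x.1.1 then h.choose.1.2.2 s else 0
      have hQW : ∀ x ∈ c, ∀ s, 0 ≤ s → s < x.1.1 → Q s = x.1.2.1 s ∧ W s = x.1.2.2 s := by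
        intro x hx s h0 h1
        have h : ∃ x ∈ c, s < x.1.1 := ⟨x, hx, h1⟩
        have e1 : Q s = h.choose.1.2.1 s := dif_pos h
        have e2 : W s = h.choose.1.2.2 s := dif_pos h
        rw [e1, e2]
        exact hagree _ h.choose_spec.1 x hx s h0 h.choose_spec.2 h1
      obtain ⟨x₀, hx₀⟩ := hcne
      have hx₀' := hQW x₀ hx₀ 0 le_rfl x₀.2.1
      refine ⟨⟨(S, Q, W), x₀.2.1.trans_le (hle x₀ hx₀), csSup_le (Set.Nonempty.image _ ⟨x₀, hx₀⟩) ?_,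
        isTrajectory_of_local fun t h0 h1 => ?_, hx₀'.1.trans x₀.2.2.2.2.1,
        hx₀'.2.trans x₀.2.2.2.2.2⟩, fun x hx => ⟨hle x hx, fun s h0 h1 => hQW x hx s h0 h1⟩⟩
      · rintro _ ⟨x, -, rfl⟩; exact x.2.2.1
      · obtain ⟨x, hx, hlt'⟩ := hlt t h1
        exact ⟨x.1.1, x.1.2.1, x.1.2.2, hlt', x.2.2.2.1, fun s h2 h3 => hQW x hx s h2 h3⟩
    · rintro a b c ⟨h1, h2⟩ ⟨h3, h4⟩
      refine ⟨h1.trans h3, fun s h5 h6 => ?_⟩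
      rw [(h4 s h5 (h6.trans_le h1)).1, (h4 s h5 (h6.trans_le h1)).2]
      exact h2 s h5 h6
  obtain ⟨⟨T, q, v⟩, hT, hTT, htr, hq0, hv0⟩ := m
  simp only at hT hTT htr hq0 hv0
  rcases eq_or_lt_of_le hTT with rfl | hlt
  · exact ⟨q, v, htr, hq0, hv0⟩
  exfalso
  obtain ⟨w, hw⟩ := (hs T q v hT htr hq0 hv0).1
  obtain ⟨q₁, hq⟩ := htr.exists_tendsto hT
  have hq₁ : ∀ i, 0 ≤ B.nor i q₁ := fun i => by
    have hc : Continuous (B.nor i) := by fun_prop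
    refine ge_of_tendsto ((hc.tendsto _).comp hq) ?_
    filter_upwards [Ioo_mem_nhdsLT hT] with s hs' using (htr.feasible ⟨hs'.1.le, hs'.2⟩ i).1
  obtain ⟨w', hi⟩ := exists_impact H w hq₁
  obtain ⟨A, τ, q₂, v₂, hτ, q', v', htr', -, rfl, rfl, -⟩ := exists_properFlight H (hi.feasible hq₁)
  have hgl := htr.glue hT (I' := Set.Ico 0 τ) (fun t ht => ht.1) htr' hq hw hi
  rw [glue_domain hτ.le] at hgl
  have := hm ⟨(min (T + τ) T₁, glue T q q', glue T v v'), lt_min (by linarith) hT₁, min_le_right _ _,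
    hgl.mono (Set.Ico_subset_Ico_right (min_le_left _ _)), (glue_of_lt hT).trans hq0,
    (glue_of_lt hT).trans hv0⟩
    ⟨le_min (by simp only; linarith) hTT, fun s _ h1 => ⟨glue_of_lt h1, glue_of_lt h1⟩⟩
  have h2 : min (T + τ) T₁ ≤ T := this.1
  rcases min_le_iff.1 h2 with h | h <;> linarith

/-- A body at rest on both contacts remains there. -/
lemma isTrajectory_rest (H : B.Regular) {q : Config} (hq : ∀ i, B.nor i q = 0) :
    B.IsTrajectory (Set.Ici 0) (fun _ => q) fun _ => 0 where
  continuousOn := continuousOn_const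
  motion t _ := by
    obtain ⟨f, hf, hc⟩ := exists_static H
    refine ⟨1, one_pos, f, fun s _ _ _ => ⟨by simp [hf], by simp [hf], ?_⟩⟩
    rw [complementarity_iff_compl]
    intro i
    simp only [hq i, nor_zero, tan_zero]
    exact ⟨(hc i).1, le_rfl, by simp, fun _ => by simp, (hc i).2, coulomb_zero _ _⟩
  impact t _ _ := ⟨0, tendsto_const_nhds,
    impact_self fun i => ⟨(hq i).ge, fun _ => (nor_zero i).ge⟩⟩

lemma Body.Settles.exists_global (H : B.Regular) {C : ℝ} (hC : 0 ≤ C) {q₀ v₀ : Config}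
    (hf : B.Feasible q₀ v₀) (hs : B.Settles C q₀ v₀) :
    ∃ q v, B.IsTrajectory (Set.Ici 0) q v ∧ q 0 = q₀ ∧ v 0 = v₀ := by
  have hT : 0 < C + 1 := by linarith
  obtain ⟨q, v, htr, rfl, rfl⟩ := hs.exists_trajectory H hT hf
  obtain ⟨tf, h0, h1, h2⟩ := (hs _ q v hT htr rfl rfl).2 (by linarith)
  have hlt : tf < C + 1 := by linarith
  have hrest := isTrajectory_rest H (h2 tf le_rfl hlt).2.2
  have hq : Tendsto q (𝓝[<] (C + 1)) (𝓝 (q tf)) := by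
    refine tendsto_const_nhds.congr' ?_
    filter_upwards [Ioo_mem_nhdsLT hlt] with s hs' using (h2 s hs'.1.le hs'.2).1.symm
  have hv : Tendsto v (𝓝[<] (C + 1)) (𝓝 0) := by
    refine tendsto_const_nhds.congr' ?_
    filter_upwards [Ioo_mem_nhdsLT hlt] with s hs' using (h2 s hs'.1.le hs'.2).2.1.symm
  have hgl := htr.glue hT (I' := Set.Ici 0) (fun t ht => ht) hrest hq hv
    (impact_self fun i => ⟨((h2 tf le_rfl hlt).2.2 i).ge, fun _ => (nor_zero i).ge⟩)
  have hdom : {t | 0 ≤ t ∧ (t < C + 1 ∨ t - (C + 1) ∈ Set.Ici 0)} = Set.Ici 0 := by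
    ext t
    simp only [Set.mem_ofPred_eq, Set.mem_Ici, sub_nonneg]
    exact ⟨fun h => h.1, fun h => ⟨h, lt_or_ge _ _⟩⟩
  rw [hdom] at hgl
  exact ⟨_, _, hgl, glue_of_lt hT, glue_of_lt hT⟩

/-! ### Stability -/

/-- Bounds of a state of distance less than `δ` from the equilibrium. -/
lemma dist_bounds (hc : ∀ i, Real.cos (B.φ i) ≠ 0) : ∃ c ≥ 1, ∀ (q v : Config) (δ : ℝ),
    B.Feasible q v → B.dist q v < δ →
      (∀ i, B.nor i q ≤ δ ^ 2) ∧ |B.tan 1 q| ≤ δ ^ 2 ∧ ‖v‖ ≤ c * δ := by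
  obtain ⟨L, hL, hLb⟩ := norm_le_coords hc
  refine ⟨1 + 4 * L, by linarith, fun q v δ hf hd => ?_⟩
  simp only [Body.dist, max_lt_iff] at hd
  obtain ⟨h0, h1, h2, h3, h4, h5⟩ := hd
  have hδ : 0 < δ := (Real.sqrt_nonneg _).trans_lt h0
  refine ⟨fun i => ?_, ((Real.sqrt_lt' hδ).1 h2).le, ?_⟩
  · match i with
    | 0 => exact ((Real.sqrt_lt' hδ).1 h0).le
    | 1 => exact ((Real.sqrt_lt' hδ).1 h1).le
  · have hh : |B.hor v| ≤ 2 * δ := by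
      have e : B.hor v = Real.cos (B.φ 1) * B.tan 1 v - Real.sin (B.φ 1) * B.nor 1 v := by
        rw [cos_mul_tan]; ring
      have e1 : |Real.cos (B.φ 1) * B.tan 1 v| ≤ 1 * δ := by
        rw [abs_mul]; exact mul_le_mul (Real.abs_cos_le_one _) h5.le (abs_nonneg _) zero_le_one
      have e2 : |Real.sin (B.φ 1) * B.nor 1 v| ≤ 1 * δ := by
        rw [abs_mul]; exact mul_le_mul (Real.abs_sin_le_one _) h4.le (abs_nonneg _) zero_le_one
      rw [e]
      exact (abs_sub _ _).trans (by linarith)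
    refine (hLb v).trans ?_
    have := mul_le_mul_of_nonneg_left (show |B.nor 0 v| + |B.nor 1 v| + |B.hor v| ≤ 4 * δ by
      linarith) hL.le
    linarith

/-- The equilibrium is finite-time Lyapunov stable: a state at distance `δ` has size of the order `δ`,
so it stops after a time of the order `δ`, before it can move farther than that. -/
theorem ftls (H : B.Regular) (hG : B.Contracting) : B.FTLS := by
  obtain ⟨C, hC, hset⟩ := settles_feasible H hG
  obtain ⟨c, hc, hdist⟩ := dist_bounds H.cos_ne
  obtain ⟨V, hV, -, hVt⟩ := velocity_bound B
  obtain ⟨K, hK, hKb⟩ := coords_le_norm B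
  -- `a * δ` bounds the velocities, and `W * δ ^ 2` the displacements, until the body stops
  set a := V * (c + C * c) with ha
  have ha0 : 0 < a := by positivity
  set W := 1 + K * (a * (C * c)) + K * a + C * c with hW
  have p1 : 0 < K * (a * (C * c)) := by positivity
  have p2 : 0 < K * a := by positivity
  have p3 : 0 < C * c := by positivity
  have hW1 : 1 ≤ W := by linarith
  intro ε hε
  set δ := ε / (2 * W) with hδd
  have hδ : 0 < δ := by positivity
  have hWδ : W * δ = ε / 2 := by rw [hδd]; field_simp
  have hsmall : ∀ x, x ≤ W * δ ^ 2 → √x < ε := fun x hx => by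
    rw [Real.sqrt_lt' hε]
    have h1 : W * δ ^ 2 ≤ (W * δ) ^ 2 := by
      rw [mul_pow]; exact mul_le_mul_of_nonneg_right (by nlinarith) (sq_nonneg δ)
    rw [hWδ] at h1
    nlinarith
  have hsmall' : ∀ x, x ≤ W * δ → x < ε := fun x hx => by linarith
  refine ⟨δ, hδ, fun q₀ v₀ hf hd => ?_⟩
  obtain ⟨d1, d2, d3⟩ := hdist q₀ v₀ δ hf hd
  have hs := hset q₀ v₀ (c * δ) hf (fun i => (d1 i).trans (by
    refine pow_le_pow_left₀ hδ.le (le_mul_of_one_le_left hδ.le hc) 2)) d3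
  set tf := C * (c * δ) with htf
  have htf0 : 0 ≤ tf := by positivity
  refine ⟨hs.exists_global H htf0 hf, ?_⟩
  rintro q v htr rfl rfl
  have htr' : ∀ T, B.IsTrajectory (Set.Ico 0 T) q v := fun T => htr.mono fun t ht => ht.1
  have hrest : ∀ t, tf ≤ t → q t = q tf ∧ v t = 0 ∧ ∀ i, B.nor i (q t) = 0 := by
    intro t ht
    obtain ⟨t₀, -, h1, h2⟩ := (hs (t + 1) q v (by linarith) (htr' _) rfl rfl).2 (by linarith)
    obtain ⟨e1, e2, e3⟩ := h2 t (by linarith) (by linarith)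
    exact ⟨e1.trans (h2 tf (by linarith) (by linarith)).1.symm, e2, e3⟩
  have hv : ∀ t, 0 ≤ t → ‖v t‖ ≤ a * δ := by
    intro t h0
    rcases le_or_gt tf t with h | h
    · rw [(hrest t h).2.1, norm_zero]; positivity
    · refine (hVt _ q v (htr' (t + 1)) t h0 (by linarith)).trans ?_
      rw [ha, mul_assoc]
      exact mul_le_mul_of_nonneg_left (by linarith) (by linarith)
  have hq : ∀ t, 0 ≤ t → ‖q t - q 0‖ ≤ a * (C * c) * δ ^ 2 := by
    have key : ∀ t, 0 ≤ t → t ≤ tf → ‖q t - q 0‖ ≤ a * (C * c) * δ ^ 2 := by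
      intro t h0 h1
      have := (htr' (t + 1)).dist_le le_rfl h0 (by linarith) fun s h2 _ => hv s h2
      refine this.trans ?_
      rw [sub_zero]
      calc a * δ * t ≤ a * δ * tf := mul_le_mul_of_nonneg_left h1 (by positivity)
        _ = a * (C * c) * δ ^ 2 := by rw [htf]; ring
    intro t h0
    rcases le_or_gt tf t with h | h
    · rw [(hrest t h).1]; exact key tf htf0 le_rfl
    · exact key t h0 h.le
  refine ⟨fun t ht => ?_, tf, htf0, hsmall' _ (by rw [htf, ← mul_assoc]; gcongr; linarith),
    fun t ht => hrest t ht⟩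
  have hqK := mul_le_mul_of_nonneg_left (hq t ht.le) hK.le
  have hvK := mul_le_mul_of_nonneg_left (hv t ht.le) hK.le
  have e1 : ∀ i, B.nor i (q t) ≤ W * δ ^ 2 := fun i => by
    have h1 := (le_abs_self _).trans (((hKb (q t - q 0)).1 i).trans hqK)
    rw [nor_sub] at h1
    have h2 := d1 i
    have h3 : (1 + K * (a * (C * c))) * δ ^ 2 ≤ W * δ ^ 2 :=
      mul_le_mul_of_nonneg_right (by linarith) (sq_nonneg δ)
    linarith
  have e2 : |B.tan 1 (q t)| ≤ W * δ ^ 2 := by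
    have h1 := ((hKb (q t - q 0)).2.1 1).trans hqK
    rw [tan_sub] at h1
    have h2 := abs_sub_abs_le_abs_sub (B.tan 1 (q t)) (B.tan 1 (q 0))
    have h3 : (1 + K * (a * (C * c))) * δ ^ 2 ≤ W * δ ^ 2 :=
      mul_le_mul_of_nonneg_right (by linarith) (sq_nonneg δ)
    linarith
  have e3 : K * (a * δ) ≤ W * δ := by
    rw [← mul_assoc]; exact mul_le_mul_of_nonneg_right (by linarith) hδ.le
  have e4 : ∀ i, |B.nor i (v t)| < ε := fun i =>
    hsmall' _ (((hKb (v t)).1 i).trans (hvK.trans e3))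
  have e5 : |B.tan 1 (v t)| < ε := hsmall' _ (((hKb (v t)).2.1 1).trans (hvK.trans e3))
  simp only [Body.dist, max_lt_iff]
  exact ⟨hsmall _ (e1 0), hsmall _ (e1 1), hsmall _ e2, e4 0, e4 1, e5⟩

end TwoContact

theorem theorem3 (B : TwoContact.Body)
    (hcos : ∀ i, Real.cos (B.φ i) ≠ 0)
    (hpainleve : B.PainleveFree)
    (hFF : B.nor 0 (B.accel 0) < 0)
    (hpersistent : B.Persistent)
    (hslip : B.SlipAccelNonzero)
    (hG : ∀ ϕ ∈ Set.Ioo (-(Real.pi / 2)) (Real.pi / 2),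
      (∃ ϕ', B.ReducedMap ϕ ϕ') → ∀ g, B.GrowthMap ϕ g → g < 1) :
    B.FTLS :=
  TwoContact.ftls ⟨hcos, hpainleve, hFF, hpersistent, hslip⟩ hG
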